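/- Let $X$ be a finite set with $n\ge 1$ elements and let $r\colon X\times X\to X\times X$ be an involutive bijection ($r^2=\mathrm{id}$) which is square-free, i.e. $r(x,x)=(x,x)$ for all $x\in X$. Write $r(x,y)=(\mathcal L_x(y),\mathcal R_y(x))$, and identify $X\times X$ with the set of words of length two in $X$. Let $\Re(r)$ be the set of relations $u=r(u)$, for the words $u$ of length two with $r(u)\ne u$; let $S=S(X,r)=\langle X;\Re(r)\rangle$ be the monoid with generators $X$ and defining relations $\Re(r)$, and, for a field $k$, let $A(k,X,r)=k\langle X\rangle/(\Re(r))$ be the associative unital $k$-algebra with the same generators and relations. Then the following conditions are equivalent. 1. $(X,r)$ is a nondegenerate solution of the set-theoretic Yang--Baxter equation: all the maps $\mathcal L_x$ and $\mathcal R_y$ are bijections of $X$, and $(r\times\mathrm{id})(\mathrm{id}\times r)(r\times\mathrm{id})=(\mathrm{id}\times r)(r\times\mathrm{id})(\mathrm{id}\times r)$ on $X\times X\times X$. 2. $S$ is of (left) $I$-type: with $X=\{x_1,\dots,x_n\}$ and $\mathcal U=[u_1,\dots,u_n]$ the free commutative monoid on $u_1,\dots,u_n$, there is a bijection $v\colon\mathcal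 U\to S$ with $v(1)=1$ and $\{v(u_1a),\dots,v(u_na)\}=\{x_1v(a),\dots,x_nv(a)\}$ for every $a\in\mathcal U$. 3. There is an ordering $X=\{x_1<\dots<x_n\}$ for which $S$ is of skew-polynomial type: $S$ has a presentation $\langle X;\Re_0\rangle$ in which $\Re_0$ consists of precisely $n(n-1)/2$ relations, each of the form $x_jx_i=x_{i'}x_{j'}$ with $i<j$, $i'<j'$ and $i'<j$, such that each word $xy$ with $x\ne y$ occurs in exactly one relation of $\Re_0$, no word $xx$ occurs in a relation of $\Re_0$, and no word $x_kx_jx_i$ with $k>j>i$ gives rise to a new relation (replacing $x_kx_j$, respectively $x_jx_i$, by the right-hand side of its relation gives two words that can be rewritten, by replacing left-hand sides by right-hand sides, to a common word); equivalently, $\Re_0$ is a Gröbner basis with respect to the degree-lexicographic order. 4. There is an ordering $X=\{x_1<\dots<x_n\}$ such that, for every field $k$, the algebra $A(k,X,r)$ is a Poincaré--Birkhoff--Witt algebra in the sense of Priddy with PBW basis the set $\mathcal N_0=\{x_1^{\alpha_1}\cdots x_n^{\alpha_n}\mid\alpha_i\ge 0\}$ of ordered monomials: the monomials in $\mathcal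 N_0$ form a $k$-basis of $A(k,X,r)$, and whenever $u,v\in\mathcal N_0$ but the word $uv$ is not in $\mathcal N_0$, then $uv$ is in $A(k,X,r)$ a $k$-linear combination of elements of $\mathcal N_0$ that are smaller than the word $uv$ in the degree-lexicographic order (the other requirements on a PBW basis, that $\mathcal N_0$ contains $1$ and $X$, and that a word of length greater than two is in $\mathcal N_0$ if and only if both parts of each of its splittings into two nonempty words are, hold for the ordered words). Moreover, if $n\ge 2$, each of these conditions implies that $(X,r)$ is decomposable: $X$ is a disjoint union of two nonempty $r$-invariant subsets, where $Y\subseteq X$ is $r$-invariant if $r$ restricts to a bijection of $Y\times Y$. -/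

import Mathlib

/-! ### Set-theoretic maps `r : X × X → X × X` -/

universe u v

namespace SetTheoreticYBE

variable {X : Type*}

/-- `r` is square-free: `r (x, x) = (x, x)` for all `x`. -/
def IsSquareFree (r : X × X → X × X) : Prop :=
  ∀ x, r (x, x) = (x, x)

/-- `r × id` on `X × X × X`. -/
def actLeft (r : X × X → X × X) (t : X × X × X) : X × X × X :=
  ((r (t.1, t.2.1)).1, (r (t.1, t.2.1)).2, t.2.2)

/-- `id × r` on `X × X × X`. -/
def actRight (r : X × X → X × X) (t : X × X × X) : X × X × X :=
  (t.1, r t.2)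

/-- The set-theoretic Yang-Baxter equation (braid relation)
`(r × id)(id × r)(r × id) = (id × r)(r × id)(id × r)`. -/
def IsBraided (r : X × X → X × X) : Prop :=
  actLeft r ∘ actRight r ∘ actLeft r = actRight r ∘ actLeft r ∘ actRight r

/-- Writing `r (x, y) = (L_x y, R_y x)`, every `L_x` and every `R_y` is a bijection of `X`. -/
def IsNondegenerate (r : X × X → X × X) : Prop :=
  (∀ x, Function.Bijective fun y => (r (x, y)).1) ∧
    (∀ y, Function.Bijective fun x => (r (x, y)).2)

/-- `Y ⊆ X` is `r`-invariant: `r` restricts to a bijection of `Y × Y`. -/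
def IsInvariantSubset (r : X × X → X × X) (Y : Set X) : Prop :=
  Set.BijOn r (Y ×ˢ Y) (Y ×ˢ Y)

/-- `X` is a disjoint union of two nonempty `r`-invariant subsets. -/
def IsDecomposable (r : X × X → X × X) : Prop :=
  ∃ Y Z : Set X, Y.Nonempty ∧ Z.Nonempty ∧ Disjoint Y Z ∧ Y ∪ Z = Set.univ ∧
    IsInvariantSubset r Y ∧ IsInvariantSubset r Z

/-! ### Quadratic binomial relations and the associated objects

A relation `x y = x' y'` between words of length two is encoded as the pair `((x, y), (x', y'))`. -/

/-- The relations `u = r u` for the words `u` of length two with `r u ≠ u`. -/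
def definingRelations (r : X × X → X × X) : Set ((X × X) × (X × X)) :=
  {ρ | r ρ.1 ≠ ρ.1 ∧ ρ.2 = r ρ.1}

/-- A set of quadratic binomial relations as a relation on the free monoid. -/
def monoidRel (R : Set ((X × X) × (X × X))) (u v : FreeMonoid X) : Prop :=
  ∃ ρ ∈ R, u = FreeMonoid.of ρ.1.1 * FreeMonoid.of ρ.1.2 ∧
    v = FreeMonoid.of ρ.2.1 * FreeMonoid.of ρ.2.2

/-- A set of quadratic binomial relations as a relation on the free associative algebra. -/
def algebraRel (k : Type*) [Field k] (R : Set ((X × X) × (X × X))) (f g : FreeAlgebra k X) : Prop :=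
  ∃ ρ ∈ R, f = FreeAlgebra.ι k ρ.1.1 * FreeAlgebra.ι k ρ.1.2 ∧
    g = FreeAlgebra.ι k ρ.2.1 * FreeAlgebra.ι k ρ.2.2

/-- The semigroup (with unit) `S(X, r)` with generators `X` and relations `u = r u`. -/
abbrev AssocMonoid (r : X × X → X × X) : Type _ :=
  PresentedMonoid (monoidRel (definingRelations r))

/-- The generator of `S(X, r)` given by `x ∈ X`. -/
def AssocMonoid.gen (r : X × X → X × X) (x : X) : AssocMonoid r :=
  PresentedMonoid.of (monoidRel (definingRelations r)) x

/-- The quadratic algebra `A(k, X, r)`: the free algebra `k⟨X⟩` modulo the two-sided ideal generated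
by all `u - r u`. -/
abbrev AssocAlgebra (k : Type*) [Field k] (r : X × X → X × X) : Type _ :=
  RingQuot (algebraRel k (definingRelations r))

/-- The generator of `A(k, X, r)` given by `x ∈ X`. -/
def AssocAlgebra.gen (k : Type*) [Field k] (r : X × X → X × X) (x : X) : AssocAlgebra k r :=
  RingQuot.mkAlgHom k (algebraRel k (definingRelations r)) (FreeAlgebra.ι k x)

/-! ### Semigroups of I-type -/

/-- A monoid `S` generated by the elements `x i` is of (left) I-type: there is a bijection `v` from
the free commutative monoid on symbols `u i` (written additively as `Multiset X`, so that
multiplication by `u i` is `i ::ₘ ·`) onto `S` with `v 1 = 1` and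
`{v (u i * a) | i} = {x i * v a | i}` for all `a`. -/
def IsOfIType {S : Type*} [Monoid S] (x : X → S) : Prop :=
  Submonoid.closure (Set.range x) = ⊤ ∧
    ∃ v : Multiset X → S, Function.Bijective v ∧ v 0 = 1 ∧
      ∀ a : Multiset X, Set.range (fun i => v (i ::ₘ a)) = Set.range (fun i => x i * v a)

/-! ### Semigroups of skew-polynomial type -/

/-- One rewriting step on words: a factor which is the left-hand side of a relation of `R` is
replaced by the right-hand side of that relation. -/
def RewriteStep (R : Set ((X × X) × (X × X))) (u v : List X) : Prop :=
  ∃ a b : List X, ∃ ρ ∈ R, u = a ++ [ρ.1.1, ρ.1.2] ++ b ∧ v = a ++ [ρ.2.1, ρ.2.2] ++ b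

/-- The conditions on a set `R` of relations `x_j x_i = x_i' x_j'` which make `⟨X; R⟩` a
skew-polynomial presentation with respect to the given order of `X`. -/
structure IsSkewPolynomialPresentation [LinearOrder X] (R : Set ((X × X) × (X × X))) : Prop where
  /-- There are precisely `n (n - 1) / 2` relations. -/
  ncard_eq : R.ncard = Nat.card X * (Nat.card X - 1) / 2
  /-- The relations have the form `x_j x_i = x_i' x_j'` with `i < j` and `i' < j'`. -/
  shape : ∀ ρ ∈ R, ρ.1.2 < ρ.1.1 ∧ ρ.2.1 < ρ.2.2
  /-- Each `x y` with `x ≠ y` occurs in exactly one relation. -/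
  occurs_once : ∀ x y, x ≠ y → ∃! ρ, ρ ∈ R ∧ (ρ.1 = (x, y) ∨ ρ.2 = (x, y))
  /-- No `x x` occurs in a relation. -/
  square_free : ∀ x, ∀ ρ ∈ R, ρ.1 ≠ (x, x) ∧ ρ.2 ≠ (x, x)
  /-- In `x_j x_i = x_i' x_j'` one has `i' < j`; so every relation replaces a word by a smaller one
  in the degree-lexicographic order. -/
  lt_head : ∀ ρ ∈ R, ρ.2.1 < ρ.1.1
  /-- The words `x_k x_j x_i` with `i < j < k` (the overlaps of two left-hand sides) give no new
  relations: the results of reducing `x_k x_j` and of reducing `x_j x_i` can be reduced to a common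
  word. Hence `R` is a Groebner basis for the degree-lexicographic order. -/
  overlap : ∀ i j k, i < j → j < k → ∀ p q : X × X, ((k, j), p) ∈ R → ((j, i), q) ∈ R →
    Relation.Join (Relation.ReflTransGen (RewriteStep R)) [p.1, p.2, i] [k, q.1, q.2]

/-- A monoid `S` generated by the elements `x i` (`i : X`) is of skew-polynomial type with respect
to the given order of `X`: it has a skew-polynomial presentation on these generators. -/
def IsOfSkewPolynomialType [LinearOrder X] {S : Type*} [Monoid S] (x : X → S) : Prop :=
  ∃ R : Set ((X × X) × (X × X)), IsSkewPolynomialPresentation R ∧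
    Function.Surjective (FreeMonoid.lift x) ∧
    Con.ker (FreeMonoid.lift x) = conGen (monoidRel R)

/-! ### Poincaré-Birkhoff-Witt bases -/

/-- The words `x_1 ^ α_1 ⋯ x_n ^ α_n` with `α_i ≥ 0`, that is, the non-decreasing words. -/
def orderedWords (X : Type*) [LinearOrder X] : Set (List X) :=
  {w | w.Pairwise (· ≤ ·)}

/-- The monomials labelled by the words in `B` form a Poincaré-Birkhoff-Witt basis, in the sense of
Priddy, of the algebra `A` with ordered generators `x i`. -/
structure IsPBWBasis [LinearOrder X] (k : Type*) [Field k] {A : Type*} [Ring A] [Algebra k A]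
    (x : X → A) (B : Set (List X)) : Prop where
  /-- The monomials are linearly independent (in particular, pairwise distinct). -/
  linearIndependent : LinearIndependent k (fun w : B => ((w : List X).map x).prod)
  /-- The monomials span `A`. -/
  span_eq_top : Submodule.span k ((fun w : List X => (w.map x).prod) '' B) = ⊤
  /-- The unit and the generators belong to the basis. -/
  nil_mem : [] ∈ B
  singleton_mem : ∀ i, [i] ∈ B
  /-- A product of two basis monomials which is not labelled by a word in `B` is a linear
  combination of basis monomials with smaller labels in the degree-lexicographic order. -/
  straighten : ∀ u ∈ B, ∀ v ∈ B, u ++ v ∉ B →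
    ((u ++ v).map x).prod ∈ Submodule.span k
      ((fun w : List X => (w.map x).prod) '' {w ∈ B | List.Shortlex (· < ·) w (u ++ v)})
  /-- A word of length greater than two belongs to `B` if and only if both parts of each of its
  splittings into two nonempty words do. -/
  mem_iff_split : ∀ w : List X, 2 < w.length →
    (w ∈ B ↔ ∀ u v : List X, u ≠ [] → v ≠ [] → w = u ++ v → u ∈ B ∧ v ∈ B)

end SetTheoreticYBE

namespace SetTheoreticYBE

variable {X : Type*}

/-! ### Rewriting and the monoid `S(X, r)` -/

/-! For a fixed order of $X$, the third and fourth conditions are both equivalent to one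
combinatorial property, `IsStraightening`: $r$ turns every descent into an ascent with a smaller
head, and distinct ordered words represent distinct elements of $S$. For skew-polynomial
presentations this is the diamond lemma (Newman's lemma applied to the rewriting of descents). For
PBW bases it follows by mapping $A(k,X,r)$ to the monoid algebra $k[S]$, where linear independence
of monomials becomes distinctness of elements of $S$.

A solution is of I-type because $S$ acts on $X$ by permutations. Twisting each letter by the
permutation of the word to its right makes letters commute, so words can be replaced by multisets
(`ofMultiset`), and an action of $S$ on pairs of a multiset and a permutation inverts this.
Conversely, I-type gives bijections $f_a$ of $X$ indexed by multisets. Comparing the ways of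
building the same multiset shows that they are compositions of the $f_{\{x\}}$ and that $\mathcal
L_x=f_{\{x\}}$, from which nondegeneracy and the braid relation follow.

That straightening implies nondegeneracy and the braid relation is proved by counting among words of
length three. Signed counts of ascents and descents over the classes of words with one repetition
control $r$ enough to prove nondegeneracy by descending induction on the letters (`eq_of_snd_eq`).
Then the class of each ordered triple is an orbit under two involutions and has at least as many
elements as the triple has rearrangements. All these numbers add up to $|X|^3$, so equality holds
everywhere, and an orbit of this smallest size forces the braid relation (`isBraided`).

The remaining implication, from solutions to an order, rests on Rump's theorem that the permutation
group of a square-free solution is intransitive (`exists_forall_perm_ne`). The group has a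
complement to each Sylow subgroup, hence is solvable by Hall's criterion. The base of that criterion
is Burnside's theorem on classes of prime power size, proved here by complex representations. Each
Sylow subgroup is generated by powers of the permutations attached to letters, and each of these
fixes its own letter. If the group were transitive, a point stabilizer would meet the conjugacy
classes of all these generators, and in a solvable group this makes it the whole group. An orbit and
its complement decompose $X$. Placing one part below the other and recursing gives the order, and
comparison with the I-type bijection shows that ordered words are normal forms. -/

theorem RewriteStep.append {R : Set ((X × X) × (X × X))} {u v : List X} (h : RewriteStep R u v)
    (a b : List X) : RewriteStep R (a ++ u ++ b) (a ++ v ++ b) := by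
  obtain ⟨c, d, ρ, hρ, rfl, rfl⟩ := h
  exact ⟨a ++ c, d ++ b, ρ, hρ, by simp, by simp⟩

theorem RewriteStep.length_eq {R : Set ((X × X) × (X × X))} {u v : List X}
    (h : RewriteStep R u v) : u.length = v.length := by
  obtain ⟨c, d, ρ, hρ, rfl, rfl⟩ := h
  simp

theorem eqvGen_rewriteStep_append {R : Set ((X × X) × (X × X))} {u v : List X}
    (h : Relation.EqvGen (RewriteStep R) u v) (a b : List X) :
    Relation.EqvGen (RewriteStep R) (a ++ u ++ b) (a ++ v ++ b) := by
  induction h with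
  | rel _ _ h => exact .rel _ _ (h.append a b)
  | refl _ => exact .refl _
  | symm _ _ _ ih => exact .symm _ _ ih
  | trans _ _ _ _ _ ih₁ ih₂ => exact .trans _ _ _ ih₁ ih₂

theorem eqvGen_rewriteStep_length {R : Set ((X × X) × (X × X))} {u v : List X}
    (h : Relation.EqvGen (RewriteStep R) u v) : u.length = v.length := by
  induction h with
  | rel _ _ h => exact h.length_eq
  | refl _ => rfl
  | symm _ _ _ ih => exact ih.symm
  | trans _ _ _ _ _ ih₁ ih₂ => exact ih₁.trans ih₂

theorem reflTransGen_rewriteStep_append {R : Set ((X × X) × (X × X))} {u v : List X}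
    (h : Relation.ReflTransGen (RewriteStep R) u v) (a b : List X) :
    Relation.ReflTransGen (RewriteStep R) (a ++ u ++ b) (a ++ v ++ b) := by
  induction h with
  | refl => exact .refl
  | tail _ h ih => exact ih.tail (h.append a b)

theorem eqvGen_rewriteStep_of_conGen {R : Set ((X × X) × (X × X))} {u v : FreeMonoid X}
    (h : conGen (monoidRel R) u v) :
    Relation.EqvGen (RewriteStep R) u.toList v.toList := by
  have h' : ConGen.Rel (monoidRel R) u v := h
  clear h
  induction h' with
  | of x y hxy =>
    obtain ⟨ρ, hρ, rfl, rfl⟩ := hxy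
    exact .rel _ _ ⟨[], [], ρ, hρ, rfl, rfl⟩
  | refl _ => exact .refl _
  | symm _ ih => exact .symm _ _ ih
  | trans _ _ ih₁ ih₂ => exact .trans _ _ _ ih₁ ih₂
  | @mul w x y z _ _ ih₁ ih₂ =>
    have e₁ := eqvGen_rewriteStep_append ih₁ [] y.toList
    have e₂ := eqvGen_rewriteStep_append ih₂ x.toList []
    simp only [List.nil_append, List.append_nil] at e₁ e₂
    exact .trans _ _ _ e₁ e₂

theorem conGen_of_rewriteStep {R : Set ((X × X) × (X × X))} {u v : List X}
    (h : RewriteStep R u v) :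
    conGen (monoidRel R) (FreeMonoid.ofList u) (FreeMonoid.ofList v) := by
  obtain ⟨c, d, ρ, hρ, rfl, rfl⟩ := h
  exact (conGen (monoidRel R)).mul ((conGen (monoidRel R)).mul ((conGen _).refl _)
    (ConGen.Rel.of _ _ ⟨ρ, hρ, rfl, rfl⟩)) ((conGen _).refl _)

theorem conGen_monoidRel_iff {R : Set ((X × X) × (X × X))} {u v : List X} :
    conGen (monoidRel R) (FreeMonoid.ofList u) (FreeMonoid.ofList v) ↔
      Relation.EqvGen (RewriteStep R) u v := by
  refine ⟨fun h => eqvGen_rewriteStep_of_conGen h, fun h => ?_⟩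
  induction h with
  | rel _ _ h => exact conGen_of_rewriteStep h
  | refl _ => exact (conGen _).refl _
  | symm _ _ _ ih => exact (conGen _).symm ih
  | trans _ _ _ _ _ ih₁ ih₂ => exact (conGen _).trans ih₁ ih₂

/-- The element of `S(X, r)` represented by a word. -/
def wordProd (r : X × X → X × X) (w : List X) : AssocMonoid r :=
  (w.map (AssocMonoid.gen r)).prod

theorem wordProd_eq_mk (r : X × X → X × X) (w : List X) :
    wordProd r w = PresentedMonoid.mk (monoidRel (definingRelations r)) (FreeMonoid.ofList w) := by
  induction w with
  | nil => rfl
  | cons x w ih =>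
    rw [wordProd, List.map_cons, List.prod_cons, ← wordProd, ih, FreeMonoid.ofList_cons, map_mul]
    rfl

theorem wordProd_append (r : X × X → X × X) (u w : List X) :
    wordProd r (u ++ w) = wordProd r u * wordProd r w := by
  simp [wordProd]

theorem wordProd_surjective (r : X × X → X × X) : Function.Surjective (wordProd r) := by
  intro s
  obtain ⟨w, rfl⟩ := PresentedMonoid.surjective_mk s
  exact ⟨w.toList, wordProd_eq_mk r _⟩

theorem wordProd_eq_iff {r : X × X → X × X} {u w : List X} :
    wordProd r u = wordProd r w ↔ Relation.EqvGen (RewriteStep (definingRelations r)) u w := by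
  rw [wordProd_eq_mk, wordProd_eq_mk, PresentedMonoid.mk_eq_mk_iff, conGen_monoidRel_iff]

theorem length_eq_of_wordProd_eq {r : X × X → X × X} {u w : List X}
    (h : wordProd r u = wordProd r w) : u.length = w.length :=
  eqvGen_rewriteStep_length (wordProd_eq_iff.1 h)

theorem gen_mul_gen (r : X × X → X × X) (p : X × X) :
    AssocMonoid.gen r p.1 * AssocMonoid.gen r p.2 =
      AssocMonoid.gen r (r p).1 * AssocMonoid.gen r (r p).2 := by
  by_cases h : r p = p
  · rw [h]
  · have : PresentedMonoid.mk (monoidRel (definingRelations r))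
        (FreeMonoid.of p.1 * FreeMonoid.of p.2) =
        PresentedMonoid.mk _ (FreeMonoid.of (r p).1 * FreeMonoid.of (r p).2) :=
      PresentedMonoid.mk_eq_mk_of_rel ⟨(p, r p), ⟨h, rfl⟩, rfl, rfl⟩
    exact this

theorem wordProd_pair (r : X × X → X × X) (a b : List X) (p : X × X) :
    wordProd r (a ++ [p.1, p.2] ++ b) = wordProd r (a ++ [(r p).1, (r p).2] ++ b) := by
  have := gen_mul_gen r p
  simp only [wordProd, List.map_append, List.prod_append, List.map_cons, List.prod_cons,
    List.map_nil, List.prod_nil, mul_one, this]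

/-- In degree two the classes of words are exactly the orbits of $r$, because a rewriting step on a
word of length two has no room for context. This lets $r$ be recovered from equalities in $S$. -/
theorem wordProd_pair_eq_iff {r : X × X → X × X} (hinv : Function.Involutive r) {p q : X × X} :
    wordProd r [p.1, p.2] = wordProd r [q.1, q.2] ↔ q = p ∨ q = r p := by
  constructor
  · intro h
    -- `F w` is the $r$-orbit of `w` when `w` has length two and is empty otherwise; it is constant
    -- on equivalence classes of words.
    let F : List X → Set (X × X) := fun w => {p | ∃ q : X × X, w = [q.1, q.2] ∧ (p = q ∨ p = r q)}
    have hF : ∀ u w, Relation.EqvGen (RewriteStep (definingRelations r)) u w → F u = F w := by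
      intro u w h
      induction h with
      | rel u w h =>
        obtain ⟨a, b, ρ, ⟨-, hρ⟩, rfl, rfl⟩ := h
        by_cases hab : a = [] ∧ b = []
        · obtain ⟨rfl, rfl⟩ := hab
          ext p
          have h1 : ∀ (x y : X) , ((∃ q : X × X, [x, y] = [q.1, q.2] ∧ (p = q ∨ p = r q)) ↔
              (p = (x, y) ∨ p = r (x, y))) := by
            intro x y
            constructor
            · rintro ⟨⟨q1, q2⟩, hq, h⟩
              simp only [List.cons.injEq, and_true] at hq
              obtain ⟨rfl, rfl⟩ := hq
              exact h
            · intro h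
              exact ⟨(x, y), rfl, h⟩
          simp only [F, Set.mem_ofPred_eq, List.nil_append, List.append_nil, h1]
          rw [hρ]
          simp only [Prod.mk.eta, hinv ρ.1]
          exact or_comm
        · have hlen : ∀ x y : X, F (a ++ [x, y] ++ b) = ∅ := by
            intro x y
            ext p
            simp only [F, Set.mem_ofPred_eq, Set.mem_empty_iff_false, iff_false]
            rintro ⟨q, hq, -⟩
            apply hab
            have := congrArg List.length hq
            simp only [List.length_append, List.length_cons, List.length_nil] at this
            exact ⟨List.length_eq_zero_iff.1 (by omega), List.length_eq_zero_iff.1 (by omega)⟩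
          rw [hlen, hlen]
      | refl _ => rfl
      | symm _ _ _ ih => exact ih.symm
      | trans _ _ _ _ _ ih₁ ih₂ => exact ih₁.trans ih₂
    have hq : q ∈ F [q.1, q.2] := ⟨q, rfl, Or.inl rfl⟩
    rw [← hF _ _ (wordProd_eq_iff.1 h)] at hq
    obtain ⟨⟨p1, p2⟩, hp, h⟩ := hq
    simp only [List.cons.injEq, and_true] at hp
    obtain ⟨rfl, rfl⟩ := hp
    exact h
  · rintro (rfl | rfl)
    · rfl
    · exact wordProd_pair r [] [] p

theorem map_gen_prod_eq_iff {r : X × X → X × X} (hinv : Function.Involutive r) {x y x' y' : X} :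
    AssocMonoid.gen r x * AssocMonoid.gen r y = AssocMonoid.gen r x' * AssocMonoid.gen r y' ↔
      (x', y') = (x, y) ∨ (x', y') = r (x, y) := by
  rw [← wordProd_pair_eq_iff hinv]
  simp [wordProd]

/-! ### Normal forms -/

theorem exists_descent_of_not_mem_orderedWords [LinearOrder X] {w : List X}
    (hw : w ∉ orderedWords X) : ∃ a b : List X, ∃ i j : X, i < j ∧ w = a ++ [j, i] ++ b := by
  induction w with
  | nil => exact absurd List.Pairwise.nil hw
  | cons x w ih =>
    by_cases h : w ∈ orderedWords X
    · cases w with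
      | nil => exact absurd (List.pairwise_singleton _ _) hw
      | cons y t =>
        refine ⟨[], t, y, x, ?_, rfl⟩
        by_contra hxy
        apply hw
        have h' : (y :: t).Pairwise (· ≤ ·) := h
        have : (x :: y :: t).Pairwise (· ≤ ·) := by
          refine List.Pairwise.cons ?_ h'
          intro z hz
          rcases List.mem_cons.1 hz with rfl | hz
          · exact not_lt.1 hxy
          · exact (not_lt.1 hxy).trans ((List.pairwise_cons.1 h').1 z hz)
        exact this
    · obtain ⟨a, b, i, j, hij, rfl⟩ := ih h
      exact ⟨x :: a, b, i, j, hij, rfl⟩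

theorem not_mem_orderedWords_of_descent [LinearOrder X] {a b : List X} {i j : X} (hij : i < j) :
    a ++ [j, i] ++ b ∉ orderedWords X := by
  intro h
  have h' : (a ++ [j, i] ++ b).Pairwise (· ≤ ·) := h
  rw [List.pairwise_append, List.pairwise_append] at h'
  have := h'.1.2.1
  simp only [List.pairwise_cons, List.mem_singleton, forall_eq] at this
  exact absurd this.1 (not_le.2 hij)

theorem RewriteStep.shortlex [LinearOrder X] {R : Set ((X × X) × (X × X))}
    (hR : ∀ ρ ∈ R, ρ.2.1 < ρ.1.1) {u v : List X} (h : RewriteStep R u v) :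
    List.Shortlex (· < ·) v u := by
  obtain ⟨a, b, ρ, hρ, rfl, rfl⟩ := h
  rw [List.append_assoc, List.append_assoc]
  refine List.Shortlex.append_left ?_ a
  refine List.Shortlex.of_lex (by simp) ?_
  exact List.Lex.rel (hR ρ hρ)

theorem wellFounded_rewriteStep [LinearOrder X] [Finite X] {R : Set ((X × X) × (X × X))}
    (hR : ∀ ρ ∈ R, ρ.2.1 < ρ.1.1) : WellFounded (fun u v => RewriteStep R v u) :=
  Subrelation.wf (fun h => h.shortlex hR) (List.Shortlex.wf (α := X) wellFounded_lt)

theorem exists_ordered_reflTransGen [LinearOrder X] [Finite X] {R : Set ((X × X) × (X × X))}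
    (hR : ∀ ρ ∈ R, ρ.2.1 < ρ.1.1) (hR' : ∀ i j, i < j → ∃ p, ((j, i), p) ∈ R) (w : List X) :
    ∃ w' ∈ orderedWords X, Relation.ReflTransGen (RewriteStep R) w w' := by
  induction w using (wellFounded_rewriteStep hR).induction with
  | _ w ih =>
    by_cases hw : w ∈ orderedWords X
    · exact ⟨w, hw, .refl⟩
    · obtain ⟨a, b, i, j, hij, rfl⟩ := exists_descent_of_not_mem_orderedWords hw
      obtain ⟨p, hp⟩ := hR' i j hij
      have hstep : RewriteStep R (a ++ [j, i] ++ b) (a ++ [p.1, p.2] ++ b) :=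
        ⟨a, b, _, hp, rfl, rfl⟩
      obtain ⟨w', hw', h⟩ := ih _ hstep
      exact ⟨w', hw', .head hstep h⟩

theorem shortlex_trans [LinearOrder X] {u v w : List X} (h : List.Shortlex (· < ·) u v)
    (h' : List.Shortlex (· < ·) v w) : List.Shortlex (· < ·) u w := by
  rw [List.shortlex_def] at h h' ⊢
  rcases h with h | ⟨h, hl⟩ <;> rcases h' with h' | ⟨h', hl'⟩
  · exact Or.inl (h.trans h')
  · exact Or.inl (h' ▸ h)
  · exact Or.inl (h ▸ h')
  · exact Or.inr ⟨h.trans h', lt_trans (a := u) (b := v) (c := w) hl hl'⟩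

theorem reflTransGen_shortlex [LinearOrder X] {R : Set ((X × X) × (X × X))}
    (hR : ∀ ρ ∈ R, ρ.2.1 < ρ.1.1) {u v : List X} (h : Relation.ReflTransGen (RewriteStep R) u v) :
    v = u ∨ List.Shortlex (· < ·) v u := by
  induction h with
  | refl => exact Or.inl rfl
  | tail _ h ih =>
    right
    rcases ih with rfl | ih
    · exact h.shortlex hR
    · exact shortlex_trans (h.shortlex hR) ih

/-- Newman's lemma: close the two first steps by local confluence, then apply the well-founded
induction hypothesis to each of their targets. -/
theorem join_of_locally_confluent {α : Type*} {s : α → α → Prop}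
    (wf : WellFounded (fun a b => s b a))
    (h : ∀ a b c, s a b → s a c → Relation.Join (Relation.ReflTransGen s) b c) (a b c : α)
    (hb : Relation.ReflTransGen s a b) (hc : Relation.ReflTransGen s a c) :
    Relation.Join (Relation.ReflTransGen s) b c := by
  induction a using wf.induction generalizing b c with
  | _ a ih =>
    rcases hb.cases_head with rfl | ⟨b', hab, hb'⟩
    · exact ⟨c, hc, .refl⟩
    rcases hc.cases_head with rfl | ⟨c', hac, hc'⟩
    · exact ⟨b, .refl, hb⟩
    obtain ⟨d, hd1, hd2⟩ := h a b' c' hab hac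
    obtain ⟨e, he1, he2⟩ := ih b' hab b d hb' hd1
    obtain ⟨f, hf1, hf2⟩ := ih c' hac e c (hd2.trans he2) hc'
    exact ⟨f, he1.trans hf1, hf2⟩

theorem join_of_eqvGen {α : Type*} {s : α → α → Prop}
    (wf : WellFounded (fun a b => s b a))
    (h : ∀ a b c, s a b → s a c → Relation.Join (Relation.ReflTransGen s) b c) {a b : α}
    (hab : Relation.EqvGen s a b) : Relation.Join (Relation.ReflTransGen s) a b := by
  induction hab with
  | rel _ _ h => exact ⟨_, .single h, .refl⟩
  | refl _ => exact ⟨_, .refl, .refl⟩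
  | symm _ _ _ ih => obtain ⟨d, h1, h2⟩ := ih; exact ⟨d, h2, h1⟩
  | trans _ _ _ _ _ ih₁ ih₂ =>
    obtain ⟨d, h1, h2⟩ := ih₁
    obtain ⟨e, h3, h4⟩ := ih₂
    obtain ⟨f, h5, h6⟩ := join_of_locally_confluent wf h _ d e h2 h3
    exact ⟨f, h1.trans h5, h4.trans h6⟩

theorem locally_confluent_rewriteStep {R : Set ((X × X) × (X × X))}
    (hfun : ∀ ρ ∈ R, ∀ ρ' ∈ R, ρ.1 = ρ'.1 → ρ = ρ')
    (hover : ∀ i j k p q, ((k, j), p) ∈ R → ((j, i), q) ∈ R →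
      Relation.Join (Relation.ReflTransGen (RewriteStep R)) [p.1, p.2, i] [k, q.1, q.2])
    (w u v : List X) (hu : RewriteStep R w u) (hv : RewriteStep R w v) :
    Relation.Join (Relation.ReflTransGen (RewriteStep R)) u v := by
  obtain ⟨a, b, ⟨⟨x, y⟩, p⟩, hρ, rfl, rfl⟩ := hu
  obtain ⟨a', b', ⟨⟨x', y'⟩, p'⟩, hρ', hw, rfl⟩ := hv
  have key : ∀ (a b a' b' : List X) (x y x' y' : X) (p p' : X × X), ((x, y), p) ∈ R →
      ((x', y'), p') ∈ R → (∃ c, a' = a ++ c ∧ [x, y] ++ b = c ++ ([x', y'] ++ b')) →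
      Relation.Join (Relation.ReflTransGen (RewriteStep R)) (a ++ [p.1, p.2] ++ b)
        (a' ++ [p'.1, p'.2] ++ b') := by
    rintro a b a' b' x y x' y' p p' hρ hρ' ⟨c, rfl, hc⟩
    -- The word `c` is the offset between the two redexes: they coincide for length zero, share one
    -- letter for length one, and are disjoint from length two on, where the steps commute.
    match c, hc with
    | [], hc =>
      simp only [List.cons_append, List.nil_append, List.cons.injEq] at hc
      obtain ⟨rfl, rfl, rfl⟩ := hc
      have := hfun _ hρ _ hρ' rfl
      simp only [Prod.mk.injEq, true_and] at this
      subst this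
      simp only [List.append_nil]
      exact ⟨_, .refl, .refl⟩
    | [z], hc =>
      simp only [List.cons_append, List.nil_append, List.cons.injEq] at hc
      obtain ⟨rfl, rfl, rfl⟩ := hc
      obtain ⟨d, h1, h2⟩ := hover _ _ _ _ _ hρ hρ'
      refine ⟨a ++ d ++ b', ?_, ?_⟩
      · simpa using reflTransGen_rewriteStep_append h1 a b'
      · simpa using reflTransGen_rewriteStep_append h2 a b'
    | z :: z' :: c, hc =>
      simp only [List.cons_append, List.nil_append, List.cons.injEq] at hc
      obtain ⟨rfl, rfl, rfl⟩ := hc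
      refine ⟨a ++ [p.1, p.2] ++ (c ++ [p'.1, p'.2] ++ b'), .single ?_, .single ?_⟩
      · exact ⟨a ++ [p.1, p.2] ++ c, b', _, hρ', by simp, by simp⟩
      · exact ⟨a, c ++ [p'.1, p'.2] ++ b', _, hρ, by simp, by simp⟩
  simp only [List.append_assoc] at hw
  rcases List.append_eq_append_iff.1 hw with h | h
  · exact key a b a' b' x y x' y' p p' hρ hρ' h
  · obtain ⟨c, hc, hc'⟩ := h
    obtain ⟨d, h1, h2⟩ := key a' b' a b x' y' x y p' p hρ' hρ ⟨c, hc, hc'⟩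
    exact ⟨d, h2, h1⟩

/-- Every descending pair `(j, i)` is sent by `r` to an ascending pair with a smaller first entry,
and the non-decreasing words represent pairwise distinct elements of `S(X, r)`. -/
structure IsStraightening [LinearOrder X] (r : X × X → X × X) : Prop where
  lt : ∀ i j, i < j → (r (j, i)).1 < (r (j, i)).2 ∧ (r (j, i)).1 < j
  injOn : Set.InjOn (wordProd r) (orderedWords X)

/-- The relations `(j, i) = r (j, i)` with `i < j`. -/
def descentRelations [LinearOrder X] (r : X × X → X × X) : Set ((X × X) × (X × X)) :=
  {ρ | ρ.1.2 < ρ.1.1 ∧ ρ.2 = r ρ.1}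

theorem wordProd_eq_of_descent_reflTransGen [LinearOrder X] {r : X × X → X × X} {u w : List X}
    (h : Relation.ReflTransGen (RewriteStep (descentRelations r)) u w) :
    wordProd r u = wordProd r w := by
  induction h with
  | refl => rfl
  | tail _ h ih =>
    obtain ⟨a, b, ρ, hρ, rfl, rfl⟩ := h
    rw [ih, wordProd_pair, hρ.2]

namespace IsStraightening

variable [LinearOrder X] {r : X × X → X × X}

theorem exists_ordered [Finite X] (h : IsStraightening r) (w : List X) : ∃ w' ∈ orderedWords X,
    Relation.ReflTransGen (RewriteStep (descentRelations r)) w w' ∧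
      wordProd r w = wordProd r w' := by
  obtain ⟨w', hw', h'⟩ := exists_ordered_reflTransGen (R := descentRelations r)
    (fun ρ hρ => by rw [hρ.2]; exact (h.lt _ _ hρ.1).2) (fun i j hij => ⟨r (j, i), hij, rfl⟩) w
  exact ⟨w', hw', h', wordProd_eq_of_descent_reflTransGen h'⟩

/-- Descents and ascents are equally numerous, so the injection of descents into ascents given by
`r` is onto; being an involution, `r` then sends every ascent back to a descent. -/
theorem asc (h : IsStraightening r) [Finite X] (hinv : Function.Involutive r) {i j : X}
    (hij : i < j) : (r (i, j)).2 < (r (i, j)).1 := by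
  have := Fintype.ofFinite X
  let D : Finset (X × X) := {p | p.2 < p.1}
  let A : Finset (X × X) := {p | p.1 < p.2}
  have hDA : D.image r ⊆ A := by
    intro p hp
    obtain ⟨q, hq, rfl⟩ := Finset.mem_image.1 hp
    simp only [D, Finset.mem_filter, Finset.mem_univ, true_and] at hq
    simpa [A] using (h.lt _ _ hq).1
  have hcard : A.card ≤ (D.image r).card := by
    rw [Finset.card_image_of_injective _ hinv.injective]
    apply le_of_eq
    refine Finset.card_bij (fun p _ => p.swap) ?_ ?_ ?_
    · intro p hp; simpa [A, D] using hp
    · intro p _ q _ hpq; exact Prod.swap_injective hpq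
    · intro p hp; exact ⟨p.swap, by simpa [A, D] using hp, by simp⟩
  have := Finset.eq_of_subset_of_card_le hDA hcard
  have hmem : (i, j) ∈ A := by simpa [A] using hij
  rw [← this] at hmem
  obtain ⟨q, hq, hqr⟩ := Finset.mem_image.1 hmem
  rw [← hqr, hinv q]
  simpa [D] using hq

end IsStraightening

end SetTheoreticYBE

namespace SetTheoreticYBE

variable {X : Type*}

/-! ### Skew-polynomial presentations -/

theorem freeMonoid_lift_gen (r : X × X → X × X) (w : List X) :
    FreeMonoid.lift (AssocMonoid.gen r) (FreeMonoid.ofList w) = wordProd r w := by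
  rw [FreeMonoid.lift_apply]
  rfl

theorem two_mul_card_descents [LinearOrder X] [Fintype X] :
    2 * (Finset.univ.filter fun p : X × X => p.2 < p.1).card =
      Fintype.card X * (Fintype.card X - 1) := by
  have h1 : (Finset.univ.filter fun p : X × X => p.1 < p.2).card =
      (Finset.univ.filter fun p : X × X => p.2 < p.1).card := by
    refine Finset.card_bij (fun p _ => p.swap) ?_ ?_ ?_
    · intro p hp; simpa using hp
    · intro p _ q _ hpq; exact Prod.swap_injective hpq
    · intro p hp; exact ⟨p.swap, by simpa using hp, by simp⟩
  have h2 : (Finset.univ : Finset X).offDiag = (Finset.univ.filter fun p : X × X => p.1 < p.2) ∪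
      (Finset.univ.filter fun p : X × X => p.2 < p.1) := by
    ext p
    simp [lt_or_lt_iff_ne]
  have h3 : Disjoint (Finset.univ.filter fun p : X × X => p.1 < p.2)
      (Finset.univ.filter fun p : X × X => p.2 < p.1) := by
    rw [Finset.disjoint_filter]
    intro p _ hp
    exact hp.asymm
  have h4 := Finset.offDiag_card (s := (Finset.univ : Finset X))
  rw [h2, Finset.card_union_of_disjoint h3, h1, Finset.card_univ] at h4
  rw [Nat.mul_sub, mul_one, ← h4]
  omega

/-- The relations can only be the graph of `r` on descents, since both sides of a relation lie in
one $r$-orbit. The irreducible words are then the ordered ones, and confluence gives uniqueness of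
normal forms. -/
theorem IsStraightening.of_isOfSkewPolynomialType [LinearOrder X] [Finite X]
    {r : X × X → X × X} (hinv : Function.Involutive r)
    (h : IsOfSkewPolynomialType (AssocMonoid.gen r)) : IsStraightening r := by
  obtain ⟨R, hR, -, hker⟩ := h
  have hiff : ∀ u w : List X, wordProd r u = wordProd r w ↔
      Relation.EqvGen (RewriteStep R) u w := by
    intro u w
    rw [← conGen_monoidRel_iff, ← hker, Con.ker_rel, freeMonoid_lift_gen, freeMonoid_lift_gen]
  have hr : ∀ ρ ∈ R, ρ.2 = r ρ.1 := by
    intro ρ hρ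
    have h1 : wordProd r [ρ.1.1, ρ.1.2] = wordProd r [ρ.2.1, ρ.2.2] :=
      (hiff _ _).2 (.rel _ _ ⟨[], [], ρ, hρ, rfl, rfl⟩)
    rcases (wordProd_pair_eq_iff hinv).1 h1 with h1 | h1
    · have := hR.shape ρ hρ
      rw [h1] at this
      exact absurd this.1 this.2.asymm
    · exact h1
  have hex : ∀ i j : X, i < j → ((j, i), r (j, i)) ∈ R := by
    intro i j hij
    obtain ⟨ρ, ⟨hρ, h1 | h1⟩, -⟩ := hR.occurs_once j i hij.ne'
    · have h2 := hr ρ hρ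
      rw [h1] at h2
      rwa [← h1, ← h1, ← h2, ← h1, Prod.mk.eta] at *
    · have := (hR.shape ρ hρ).2
      rw [h1] at this
      exact absurd this hij.asymm
  refine ⟨fun i j hij => ⟨(hR.shape _ (hex i j hij)).2, hR.lt_head _ (hex i j hij)⟩, ?_⟩
  intro u hu w hw huw
  have hirr : ∀ u ∈ orderedWords X, ∀ v, Relation.ReflTransGen (RewriteStep R) u v → v = u := by
    intro u hu v huv
    rcases huv.cases_head with rfl | ⟨v', ⟨a, b, ρ, hρ, rfl, rfl⟩, -⟩
    · rfl
    · exact absurd hu (not_mem_orderedWords_of_descent (hR.shape ρ hρ).1)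
  obtain ⟨d, h1, h2⟩ := join_of_eqvGen (wellFounded_rewriteStep hR.lt_head)
    (locally_confluent_rewriteStep (fun ρ hρ ρ' hρ' he => Prod.ext he (by rw [hr ρ hρ, hr ρ' hρ', he]))
      (fun i j k p q hp hq => hR.overlap i j k (hR.shape _ hq).1 (hR.shape _ hp).1 p q hp hq))
    ((hiff u w).1 huw)
  rw [← hirr u hu d h1, ← hirr w hw d h2]

theorem IsStraightening.isOfSkewPolynomialType [LinearOrder X] [Finite X]
    {r : X × X → X × X} (hinv : Function.Involutive r)
    (h : IsStraightening r) : IsOfSkewPolynomialType (AssocMonoid.gen r) := by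
  have := Fintype.ofFinite X
  have hiff : ∀ u w : List X, wordProd r u = wordProd r w ↔
      Relation.EqvGen (RewriteStep (descentRelations r)) u w := by
    intro u w
    constructor
    · intro huw
      obtain ⟨u', hu', h1, h2⟩ := h.exists_ordered u
      obtain ⟨w', hw', h3, h4⟩ := h.exists_ordered w
      have : u' = w' := h.injOn hu' hw' (by rw [← h2, ← h4, huw])
      subst this
      exact .trans _ _ _ (Relation.EqvGen.reflTransGen_le_eqvGen _ _ _ h1)
        (.symm _ _ (Relation.EqvGen.reflTransGen_le_eqvGen _ _ _ h3))
    · intro huw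
      induction huw with
      | rel _ _ h => exact wordProd_eq_of_descent_reflTransGen (.single h)
      | refl _ => rfl
      | symm _ _ _ ih => exact ih.symm
      | trans _ _ _ _ _ ih₁ ih₂ => exact ih₁.trans ih₂
  refine ⟨descentRelations r, ⟨?_, ?_, ?_, ?_, ?_, ?_⟩, ?_, ?_⟩
  · have : descentRelations r =
        (fun p => (p, r p)) '' ((Finset.univ.filter fun p : X × X => p.2 < p.1 : Finset _) : Set _) := by
      ext ⟨p, q⟩
      simp only [descentRelations, Set.mem_ofPred_eq, Set.mem_image, Finset.coe_filter,
        Finset.mem_univ, true_and, Prod.mk.injEq]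
      constructor
      · rintro ⟨h1, rfl⟩; exact ⟨p, h1, rfl, rfl⟩
      · rintro ⟨q, h1, rfl, rfl⟩; exact ⟨h1, rfl⟩
    rw [this, Set.ncard_image_of_injective _ (fun p q hpq => (Prod.ext_iff.1 hpq).1),
      Set.ncard_coe_finset, Nat.card_eq_fintype_card, ← two_mul_card_descents]
    simp
  · rintro ⟨p, q⟩ ⟨h1, h2⟩
    simp only at h1 h2
    subst h2
    exact ⟨h1, (h.lt _ _ h1).1⟩
  · intro x y hxy
    rcases lt_or_gt_of_ne hxy with hlt | hlt
    · refine ⟨(r (x, y), (x, y)), ⟨⟨h.asc hinv hlt, (hinv _).symm⟩, Or.inr rfl⟩, ?_⟩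
      rintro ⟨p, q⟩ ⟨⟨h1, h2⟩, h3 | h3⟩
      · simp only at h1 h2 h3
        subst h3
        exact absurd h1 hlt.asymm
      · simp only at h1 h2 h3
        rw [h3] at h2
        rw [h3, h2, hinv]
    · refine ⟨((x, y), r (x, y)), ⟨⟨hlt, rfl⟩, Or.inl rfl⟩, ?_⟩
      rintro ⟨p, q⟩ ⟨⟨h1, h2⟩, h3 | h3⟩
      · simp only at h1 h2 h3
        rw [h2, h3]
      · simp only at h1 h2 h3
        have := (h.lt _ _ h1).1
        rw [Prod.mk.eta, ← h2, h3] at this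
        exact absurd this hlt.asymm
  · rintro x ⟨p, q⟩ ⟨h1, h2⟩
    simp only at h1 h2 ⊢
    constructor
    · rintro rfl; exact lt_irrefl _ h1
    · rintro rfl
      have := (h.lt _ _ h1).1
      rw [Prod.mk.eta, ← h2] at this
      exact lt_irrefl _ this
  · rintro ⟨p, q⟩ ⟨h1, h2⟩
    simp only at h1 h2 ⊢
    rw [h2]
    exact (h.lt _ _ h1).2
  -- Both reducts of the overlap represent the same element of `S`, so their ordered forms agree;
  -- this common word resolves the overlap.
  · rintro i j k hij hjk p q ⟨-, hp⟩ ⟨-, hq⟩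
    simp only at hp hq
    obtain ⟨u', hu', h1, h2⟩ := h.exists_ordered [p.1, p.2, i]
    obtain ⟨w', hw', h3, h4⟩ := h.exists_ordered [k, q.1, q.2]
    have h5 : wordProd r [k, j, i] = wordProd r [p.1, p.2, i] := by
      rw [hp]; exact wordProd_pair r [] [i] (k, j)
    have h6 : wordProd r [k, j, i] = wordProd r [k, q.1, q.2] := by
      rw [hq]; exact wordProd_pair r [k] [] (j, i)
    have : u' = w' := h.injOn hu' hw' (by rw [← h2, ← h4, ← h5, ← h6])
    subst this
    exact ⟨_, h1, h3⟩
  · intro s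
    obtain ⟨w, rfl⟩ := wordProd_surjective r s
    exact ⟨_, freeMonoid_lift_gen r w⟩
  · ext u w
    rw [Con.ker_rel]
    have h1 := freeMonoid_lift_gen r u.toList
    have h2 := freeMonoid_lift_gen r w.toList
    rw [FreeMonoid.ofList_toList] at h1 h2
    rw [h1, h2, hiff, ← conGen_monoidRel_iff, FreeMonoid.ofList_toList, FreeMonoid.ofList_toList]

/-! ### Poincaré-Birkhoff-Witt bases -/

theorem assocAlgebra_gen_mul_gen (k : Type*) [Field k] (r : X × X → X × X) (p : X × X) :
    AssocAlgebra.gen k r p.1 * AssocAlgebra.gen k r p.2 =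
      AssocAlgebra.gen k r (r p).1 * AssocAlgebra.gen k r (r p).2 := by
  by_cases h : r p = p
  · rw [h]
  · simp only [AssocAlgebra.gen, ← map_mul]
    exact RingQuot.mkAlgHom_rel k ⟨(p, r p), ⟨h, rfl⟩, rfl, rfl⟩

/-- The canonical map from `S(X, r)` to `A(k, X, r)`. -/
noncomputable def toAssocAlgebra (k : Type*) [Field k] (r : X × X → X × X) :
    AssocMonoid r →* AssocAlgebra k r :=
  PresentedMonoid.lift (AssocAlgebra.gen k r) (by
    rintro u w ⟨ρ, ⟨-, h⟩, rfl, rfl⟩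
    simp only [map_mul, FreeMonoid.lift_eval_of]
    rw [h]
    exact assocAlgebra_gen_mul_gen k r ρ.1)

theorem toAssocAlgebra_wordProd (k : Type*) [Field k] (r : X × X → X × X) (w : List X) :
    toAssocAlgebra k r (wordProd r w) = (w.map (AssocAlgebra.gen k r)).prod := by
  rw [wordProd, map_list_prod, List.map_map]
  rfl

/-- The canonical map from `A(k, X, r)` to the monoid algebra of `S(X, r)`. -/
noncomputable def toMonoidAlgebra (k : Type*) [Field k] (r : X × X → X × X) :
    AssocAlgebra k r →ₐ[k] MonoidAlgebra k (AssocMonoid r) :=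
  RingQuot.liftAlgHom k ⟨FreeAlgebra.lift k
    (fun x => MonoidAlgebra.of k (AssocMonoid r) (AssocMonoid.gen r x)), by
      rintro _ _ ⟨ρ, ⟨-, h⟩, rfl, rfl⟩
      simp only [map_mul, FreeAlgebra.lift_ι_apply]
      rw [← map_mul, ← map_mul, h, gen_mul_gen]⟩

theorem toMonoidAlgebra_word (k : Type*) [Field k] (r : X × X → X × X) (w : List X) :
    toMonoidAlgebra k r ((w.map (AssocAlgebra.gen k r)).prod) =
      MonoidAlgebra.of k (AssocMonoid r) (wordProd r w) := by
  rw [map_list_prod, List.map_map, wordProd, map_list_prod, List.map_map]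
  congr 2
  funext x
  simp [toMonoidAlgebra, AssocAlgebra.gen]

theorem span_words_eq_top (k : Type*) [Field k] (r : X × X → X × X) :
    Submodule.span k (Set.range fun w : List X => (w.map (AssocAlgebra.gen k r)).prod) = ⊤ := by
  have hrange : (Set.range fun w : List X => (w.map (AssocAlgebra.gen k r)).prod) =
      (Submonoid.closure (Set.range (AssocAlgebra.gen k r)) : Set (AssocAlgebra k r)) := by
    rw [← FreeMonoid.mrange_lift]
    ext a
    constructor
    · rintro ⟨w, rfl⟩
      exact ⟨FreeMonoid.ofList w, by rw [FreeMonoid.lift_apply]; rfl⟩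
    · rintro ⟨w, rfl⟩
      exact ⟨w.toList, by rw [FreeMonoid.lift_apply]⟩
  rw [hrange, ← Algebra.adjoin_eq_span]
  have h2 : Set.range (AssocAlgebra.gen k r) =
      RingQuot.mkAlgHom k (algebraRel k (definingRelations r)) '' Set.range (FreeAlgebra.ι k) := by
    rw [← Set.range_comp]; rfl
  rw [h2, ← AlgHom.map_adjoin, FreeAlgebra.adjoin_range_ι, Algebra.map_top,
    (AlgHom.range_eq_top _).2 (RingQuot.mkAlgHom_surjective k _)]
  rfl

theorem mem_orderedWords_iff_split [LinearOrder X] (w : List X) (hw : 2 < w.length) :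
    w ∈ orderedWords X ↔
      ∀ u v : List X, u ≠ [] → v ≠ [] → w = u ++ v → u ∈ orderedWords X ∧ v ∈ orderedWords X := by
  constructor
  · rintro h u v - - rfl
    have h' : (u ++ v).Pairwise (· ≤ ·) := h
    exact ⟨(List.pairwise_append.1 h').1, (List.pairwise_append.1 h').2.1⟩
  · intro h
    match w, hw with
    | a :: b :: c :: t, _ =>
      have h1 : [a, b].Pairwise (· ≤ ·) := (h [a, b] (c :: t) (by simp) (by simp) rfl).1
      have h2 : (b :: c :: t).Pairwise (· ≤ ·) :=
        (h [a] (b :: c :: t) (by simp) (by simp) rfl).2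
      have hab : a ≤ b := by simpa using h1
      refine List.Pairwise.cons ?_ h2
      intro z hz
      rcases List.mem_cons.1 hz with rfl | hz
      · exact hab
      · exact hab.trans ((List.pairwise_cons.1 h2).1 z hz)

theorem linearIndependent_monoidAlgebra_of (k M : Type*) [Field k] [Monoid M] :
    LinearIndependent k (fun s => MonoidAlgebra.of k M s) := by
  apply LinearIndependent.of_comp (MonoidAlgebra.coeffLinearEquiv k).toLinearMap
  exact Finsupp.linearIndependent_single_one k M

theorem IsStraightening.isPBWBasis [LinearOrder X] [Finite X] {r : X × X → X × X}
    (h : IsStraightening r) (k : Type*) [Field k] :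
    IsPBWBasis k (AssocAlgebra.gen k r) (orderedWords X) where
  linearIndependent := by
    apply LinearIndependent.of_comp (toMonoidAlgebra k r).toLinearMap
    have : ((toMonoidAlgebra k r).toLinearMap ∘ fun w : orderedWords X =>
        ((w : List X).map (AssocAlgebra.gen k r)).prod) =
        (fun s => MonoidAlgebra.of k (AssocMonoid r) s) ∘ fun w : orderedWords X => wordProd r w := by
      funext w
      exact toMonoidAlgebra_word k r w
    rw [this]
    refine LinearIndependent.comp ?_ _ (fun u w huw => Subtype.ext (h.injOn u.2 w.2 huw))
    exact linearIndependent_monoidAlgebra_of k (AssocMonoid r)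
  span_eq_top := by
    rw [← span_words_eq_top k r]
    congr 1
    ext a
    constructor
    · rintro ⟨w, -, rfl⟩; exact ⟨w, rfl⟩
    · rintro ⟨w, rfl⟩
      obtain ⟨w', hw', -, h2⟩ := h.exists_ordered w
      refine ⟨w', hw', ?_⟩
      simp only
      rw [← toAssocAlgebra_wordProd, ← h2, toAssocAlgebra_wordProd]
  nil_mem := List.Pairwise.nil
  singleton_mem := fun _ => List.pairwise_singleton _ _
  straighten := by
    intro u _ v _ huv
    obtain ⟨w', hw', h1, h2⟩ := h.exists_ordered (u ++ v)
    apply Submodule.subset_span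
    refine ⟨w', ⟨hw', ?_⟩, ?_⟩
    · rcases reflTransGen_shortlex (R := descentRelations r)
        (fun ρ hρ => by rw [hρ.2]; exact (h.lt _ _ hρ.1).2) h1 with rfl | h3
      · exact absurd hw' huv
      · exact h3
    · simp only
      rw [← toAssocAlgebra_wordProd, ← h2, toAssocAlgebra_wordProd]
  mem_iff_split := fun w hw => mem_orderedWords_iff_split w hw

/-- Everything is transported to the monoid algebra of $S$, whose canonical basis turns a statement
about linear combinations into one about single words. -/
theorem IsStraightening.of_isPBWBasis [LinearOrder X] {r : X × X → X × X}
    (hinv : Function.Involutive r) (hsf : IsSquareFree r) (k : Type*) [Field k]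
    (h : IsPBWBasis k (AssocAlgebra.gen k r) (orderedWords X)) : IsStraightening r := by
  constructor
  · intro i j hij
    have hmem := h.straighten [j] (h.singleton_mem j) [i] (h.singleton_mem i)
      (not_mem_orderedWords_of_descent (a := []) (b := []) hij)
    have h1 := Submodule.mem_map_of_mem (f := (toMonoidAlgebra k r).toLinearMap) hmem
    rw [Submodule.map_span, ← Set.image_comp] at h1
    have h2 : ((toMonoidAlgebra k r).toLinearMap ∘ fun w : List X =>
        (w.map (AssocAlgebra.gen k r)).prod) =
        (fun s => MonoidAlgebra.of k (AssocMonoid r) s) ∘ wordProd r := by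
      funext w
      exact toMonoidAlgebra_word k r w
    rw [h2, AlgHom.toLinearMap_apply, toMonoidAlgebra_word, Set.image_comp] at h1
    -- A member of a linearly independent family lies in the span of a subfamily only if it belongs
    -- to it. So the straightened form of $x_jx_i$ may be taken to be a single monomial.
    have h3 : wordProd r ([j] ++ [i]) ∈
        wordProd r '' {w ∈ orderedWords X | List.Shortlex (· < ·) w ([j] ++ [i])} := by
      by_contra hcon
      exact (linearIndependent_monoidAlgebra_of k (AssocMonoid r)).notMem_span_image hcon h1
    obtain ⟨w, ⟨hw, hlex⟩, hw2⟩ := h3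
    have hlen := length_eq_of_wordProd_eq hw2
    match w, hlen with
    | [p, q], _ =>
      have h4 : wordProd r [j, i] = wordProd r [p, q] := hw2.symm
      have hpq : p ≤ q := by
        have : [p, q].Pairwise (· ≤ ·) := hw
        simpa using this
      rcases (wordProd_pair_eq_iff (p := (j, i)) (q := (p, q)) hinv).1 h4 with h5 | h5
      · simp only [Prod.mk.injEq] at h5
        obtain ⟨rfl, rfl⟩ := h5
        exact absurd hpq (not_le.2 hij)
      · rw [← h5]
        -- A square is fixed by `r`, so it cannot be the image of a descent.
        have hne : p ≠ q := by
          rintro rfl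
          have := congrArg r h5
          rw [hinv, hsf] at this
          simp only [Prod.mk.injEq] at this
          exact hij.ne (this.2.symm.trans this.1)
        refine ⟨lt_of_le_of_ne hpq hne, ?_⟩
        have hlex' := (List.shortlex_iff_lex (by simp)).1 hlex
        simp only [List.cons_append, List.nil_append] at hlex'
        cases hlex' with
        | rel h => exact h
        | cons h =>
          cases h with
          | rel h => exact absurd (h.trans hij) (not_lt.2 hpq)
          | cons h => cases h
  · intro u hu w hw huw
    have := h.linearIndependent.injective (a₁ := ⟨u, hu⟩) (a₂ := ⟨w, hw⟩) (by
      simp only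
      rw [← toAssocAlgebra_wordProd, huw, toAssocAlgebra_wordProd])
    exact congrArg Subtype.val this

end SetTheoreticYBE

namespace SetTheoreticYBE

variable {X : Type*}

/-! ### Solutions are of I-type -/

/-- An involutive, square-free, nondegenerate solution of the Yang-Baxter equation. -/
structure IsSolution (r : X × X → X × X) : Prop where
  inv : Function.Involutive r
  sqfree : IsSquareFree r
  nondeg : IsNondegenerate r
  braided : IsBraided r

namespace IsSolution

variable {r : X × X → X × X} (h : IsSolution r)
include h

/-- The inverse of the permutation `x ↦ (r (x, y)).2`. -/
noncomputable def perm (y : X) : Equiv.Perm X :=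
  (Equiv.ofBijective _ (h.nondeg.2 y))⁻¹

theorem snd_perm (x y : X) : (r (h.perm y x, y)).2 = x :=
  (Equiv.ofBijective _ (h.nondeg.2 y)).apply_symm_apply x

theorem perm_snd (x y : X) : h.perm y (r (x, y)).2 = x :=
  (Equiv.ofBijective _ (h.nondeg.2 y)).symm_apply_apply x

theorem perm_symm_apply (x y : X) : (h.perm y)⁻¹ x = (r (x, y)).2 := by
  rw [Equiv.Perm.inv_eq_iff_eq, perm_snd]

/-- This symmetric form of the relations, exchanging `a` and `b`, is what makes the twisted
multiplications below commute. It uses only involutivity and the bijectivity of the maps $\mathcal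
R_y$. -/
theorem apply_perm (a b : X) : r (h.perm b a, b) = (h.perm a b, a) := by
  have h1 := h.snd_perm a b
  have h2 : r ((r (h.perm b a, b)).1, a) = (h.perm b a, b) := by
    conv_lhs => rw [← h1]
    rw [h1]
    conv_lhs => enter [1, 2]; rw [← h1]
    exact h.inv _
  refine Prod.ext ?_ h1
  have h3 := h.perm_snd (r (h.perm b a, b)).1 a
  rw [h2] at h3
  exact h3.symm

theorem perm_self (x : X) : h.perm x x = x := by
  have := h.perm_snd x x
  rwa [h.sqfree] at this

/-- The third component of the braid relation says that the maps $\mathcal R$ form a right action of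
$S$; passing to inverses gives a left action. -/
theorem perm_mul_perm (p : X × X) :
    h.perm p.1 * h.perm p.2 = h.perm (r p).1 * h.perm (r p).2 := by
  rw [← inv_inj, mul_inv_rev, mul_inv_rev]
  ext x
  have h1 := congrFun h.braided (x, p.1, p.2)
  have h2 := congrArg (fun t => t.2.2) h1
  simp only [actLeft, actRight, Function.comp_apply, Prod.mk.eta] at h2
  simp only [Equiv.Perm.mul_apply, perm_symm_apply]
  exact h2

/-- The homomorphism from `S(X, r)` to the permutations of `X`. -/
noncomputable def permHom : AssocMonoid r →* Equiv.Perm X :=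
  PresentedMonoid.lift h.perm (by
    rintro u w ⟨ρ, ⟨-, h1⟩, rfl, rfl⟩
    simp only [map_mul, FreeMonoid.lift_eval_of]
    rw [h1]
    exact h.perm_mul_perm ρ.1)

@[simp]
theorem permHom_gen (x : X) : h.permHom (AssocMonoid.gen r x) = h.perm x := rfl

/-- Left multiplication by a generator, the label twisted by the permutation of the argument. -/
noncomputable def step (i : X) (s : AssocMonoid r) : AssocMonoid r :=
  AssocMonoid.gen r (h.permHom s i) * s

/-- Applying two twisted steps produces the prefix `h.perm b a`, `b`, where `a` and `b` are the
translates of the two labels; by `apply_perm` the other order gives the $r$-image of this prefix.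
Folding over a multiset is therefore well defined. -/
theorem leftCommutative_step : LeftCommutative h.step := by
  constructor
  intro i j s
  simp only [step, map_mul, permHom_gen, Equiv.Perm.mul_apply, ← mul_assoc]
  congr 1
  have := gen_mul_gen r (h.perm (h.permHom s j) (h.permHom s i), h.permHom s j)
  rwa [h.apply_perm] at this

/-- The bijection from the free commutative monoid to `S(X, r)`. -/
noncomputable def ofMultiset (a : Multiset X) : AssocMonoid r :=
  haveI := h.leftCommutative_step
  a.foldr h.step 1

/-- The permutation attached to an element of the free commutative monoid. -/
noncomputable def multisetPerm (a : Multiset X) : Equiv.Perm X :=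
  h.permHom (h.ofMultiset a)

theorem ofMultiset_cons (i : X) (a : Multiset X) :
    h.ofMultiset (i ::ₘ a) = AssocMonoid.gen r (h.multisetPerm a i) * h.ofMultiset a := by
  have := h.leftCommutative_step
  exact Multiset.foldr_cons _ _ _ _

@[simp]
theorem multisetPerm_zero : h.multisetPerm 0 = 1 := map_one _

theorem multisetPerm_cons (i : X) (a : Multiset X) :
    h.multisetPerm (i ::ₘ a) = h.perm (h.multisetPerm a i) * h.multisetPerm a := by
  rw [multisetPerm, ofMultiset_cons, map_mul, permHom_gen]
  rfl

/-- The action of a generator on pairs of a multiset and a permutation. -/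
noncomputable def multisetStep (x : X) : Function.End (Multiset X × Equiv.Perm X) :=
  fun p => (p.2⁻¹ x ::ₘ p.1, h.perm x * p.2)

/-- Passing from `p` to `r p` interchanges the two untwisted labels, an exchange which a multiset
does not see. The permutation component is handled by `perm_mul_perm`. -/
theorem multisetStep_mul_multisetStep (p : X × X) :
    h.multisetStep p.1 * h.multisetStep p.2 =
      h.multisetStep (r p).1 * h.multisetStep (r p).2 := by
  funext ⟨b, s⟩
  change ((h.perm p.2 * s)⁻¹ p.1 ::ₘ s⁻¹ p.2 ::ₘ b, h.perm p.1 * (h.perm p.2 * s)) =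
    ((h.perm (r p).2 * s)⁻¹ (r p).1 ::ₘ s⁻¹ (r p).2 ::ₘ b, h.perm (r p).1 * (h.perm (r p).2 * s))
  have h2 : ∀ p : X × X, (h.perm p.2)⁻¹ p.1 = (r p).2 := fun p => h.perm_symm_apply _ _
  simp only [mul_inv_rev, Equiv.Perm.mul_apply, ← mul_assoc]
  rw [← h.perm_mul_perm, h2, h2, h.inv, Multiset.cons_swap]

/-- The action of `S(X, r)` which inverts `ofMultiset`. -/
noncomputable def multisetAction :
    AssocMonoid r →* Function.End (Multiset X × Equiv.Perm X) :=
  PresentedMonoid.lift h.multisetStep (by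
    rintro u w ⟨ρ, ⟨-, h1⟩, rfl, rfl⟩
    simp only [map_mul, FreeMonoid.lift_eval_of]
    rw [h1]
    exact h.multisetStep_mul_multisetStep ρ.1)

theorem multisetAction_gen (x : X) (p : Multiset X × Equiv.Perm X) :
    h.multisetAction (AssocMonoid.gen r x) p = (p.2⁻¹ x ::ₘ p.1, h.perm x * p.2) := rfl

theorem multisetAction_ofMultiset (a : Multiset X) :
    h.multisetAction (h.ofMultiset a) (0, 1) = (a, h.multisetPerm a) := by
  induction a using Multiset.induction with
  | empty => rfl
  | cons i a ih =>
    rw [ofMultiset_cons, map_mul]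
    change h.multisetAction (AssocMonoid.gen r (h.multisetPerm a i))
      (h.multisetAction (h.ofMultiset a) (0, 1)) = _
    rw [ih, multisetAction_gen, multisetPerm_cons]
    simp

theorem ofMultiset_bijective : Function.Bijective h.ofMultiset := by
  constructor
  · intro a b hab
    have h1 := h.multisetAction_ofMultiset a
    rw [hab, multisetAction_ofMultiset] at h1
    exact (Prod.ext_iff.1 h1).1.symm
  · intro s
    obtain ⟨w, rfl⟩ := wordProd_surjective r s
    induction w with
    | nil => exact ⟨0, rfl⟩
    | cons x w ih =>
      obtain ⟨a, ha⟩ := ih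
      refine ⟨(h.multisetPerm a)⁻¹ x ::ₘ a, ?_⟩
      rw [ofMultiset_cons, ha]
      simp [wordProd]

theorem isOfIType : IsOfIType (AssocMonoid.gen r) := by
  refine ⟨PresentedMonoid.closure_range_of _, h.ofMultiset, h.ofMultiset_bijective, rfl, ?_⟩
  intro a
  ext s
  constructor
  · rintro ⟨i, rfl⟩
    exact ⟨_, (h.ofMultiset_cons i a).symm⟩
  · rintro ⟨x, rfl⟩
    refine ⟨(h.multisetPerm a)⁻¹ x, ?_⟩
    simp [ofMultiset_cons]

end IsSolution

/-! ### Monoids of I-type give solutions -/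

theorem isBraided_iff {r : X × X → X × X} :
    IsBraided r ↔ ∀ x y z, actLeft r (actRight r (actLeft r (x, y, z))) =
      actRight r (actLeft r (actRight r (x, y, z))) :=
  ⟨fun h x y z => congrFun h (x, y, z), fun h => funext fun ⟨x, y, z⟩ => h x y z⟩

/-- Relabelling the symbols $u_i$ by a permutation arranges that $v(u_i)=x_i$; the bijection `f a`
records which generator is multiplied on the left when `i` is added to `a`. -/
theorem exists_normalized_of_isOfIType [Finite X] {S : Type*} [Monoid S] {x : X → S}
    (h : IsOfIType x) : ∃ (v : Multiset X → S) (f : Multiset X → X → X), Function.Injective v ∧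
      (∀ a, Function.Bijective (f a)) ∧ f 0 = id ∧ v 0 = 1 ∧
      ∀ i a, v (i ::ₘ a) = x (f a i) * v a := by
  obtain ⟨-, v, hv, hv0, hr⟩ := h
  have h1 : ∀ a i, ∃ j, x j * v a = v (i ::ₘ a) := fun a i => by
    have : v (i ::ₘ a) ∈ Set.range (fun i => v (i ::ₘ a)) := ⟨i, rfl⟩
    rw [hr] at this
    exact this
  choose f hf using h1
  have hinj : ∀ a, Function.Bijective (f a) := fun a => by
    rw [← Finite.injective_iff_bijective]
    intro i j hij
    have := hf a i
    rw [hij, hf a j] at this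
    exact ((Multiset.cons_inj_left _).1 (hv.1 this)).symm
  let e : Equiv.Perm X := (Equiv.ofBijective _ (hinj 0)).symm
  refine ⟨fun a => v (a.map e), fun a => f (a.map e) ∘ e,
    hv.1.comp (Multiset.map_injective e.injective), fun a => (hinj _).comp e.bijective, ?_, ?_, ?_⟩
  · funext i
    exact (Equiv.ofBijective _ (hinj 0)).apply_symm_apply i
  · simpa using hv0
  · intro i a
    simp only [Multiset.map_cons, Function.comp_apply]
    rw [← hf]

/-- A multiset can be built in several orders, and each gives a word for the same element of $S$.
Comparison in sizes two and three expresses $r$ through the maps $f_{\{x\}}$ and shows that the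
$f_a$ satisfy a cocycle identity. -/
theorem IsOfIType.isNondegenerate_and_isBraided [Finite X] {r : X × X → X × X}
    (hinv : Function.Involutive r) (hsf : IsSquareFree r)
    (h : IsOfIType (AssocMonoid.gen r)) : IsNondegenerate r ∧ IsBraided r := by
  obtain ⟨v, f, hv, hf, hf0, hv0, hvf⟩ := exists_normalized_of_isOfIType h
  have hv1 : ∀ i, v {i} = AssocMonoid.gen r i := fun i => by
    rw [← Multiset.cons_zero, hvf, hf0, hv0, mul_one, id]
  have hv2 : ∀ i j, v {j, i} = AssocMonoid.gen r (f {i} j) * AssocMonoid.gen r i := fun i j => by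
    rw [Multiset.insert_eq_cons, hvf, hv1]
  have hA' : ∀ i j, i ≠ j → r (f {i} j, i) = (f {j} i, j) := by
    intro i j hij
    have h1 := hv2 i j
    rw [Multiset.pair_comm, hv2, map_gen_prod_eq_iff hinv] at h1
    rcases h1 with h1 | h1
    · exact absurd (Prod.ext_iff.1 h1).2 hij
    · rw [h1, hinv]
  have hff : ∀ i, f {i} i = i := by
    intro i
    obtain ⟨j, hj⟩ := (hf {i}).2 i
    by_cases hij : i = j
    · rwa [← hij] at hj
    · have h1 := hA' i j hij
      rw [hj, hsf] at h1
      exact absurd (Prod.ext_iff.1 h1).2 hij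
  have hA : ∀ i j, r (f {i} j, i) = (f {j} i, j) := by
    intro i j
    by_cases hij : i = j
    · subst hij; rw [hff, hsf]
    · exact hA' i j hij
  have hfix : ∀ p, r p = p → p.1 = p.2 := by
    rintro ⟨a, i⟩ hp
    obtain ⟨j, rfl⟩ := (hf {i}).2 a
    rw [hA] at hp
    have : j = i := (Prod.ext_iff.1 hp).2
    subst this
    exact hff _
  have hv3 : ∀ i j k, v {k, j, i} = AssocMonoid.gen r (f {j, i} k) *
      (AssocMonoid.gen r (f {i} j) * AssocMonoid.gen r i) := fun i j k => by
    rw [Multiset.insert_eq_cons, hvf, hv2]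
  -- Applying $r$ to the first two letters of a word for $\{k,j,i\}$ gives another word for the same
  -- element ending in the same letter; by injectivity of `v` only the roles of `j` and `k` can have
  -- changed.
  have hQ : ∀ i j k, r (f {j, i} k, f {i} j) = (f {j, i} k, f {i} j) ∨
      r (f {j, i} k, f {i} j) = (f {k, i} j, f {i} k) := by
    intro i j k
    set p := r (f {j, i} k, f {i} j) with hp
    obtain ⟨j', hj'⟩ := (hf {i}).2 p.2
    obtain ⟨k', hk'⟩ := (hf {j', i}).2 p.1
    have h1 : v {k, j, i} = v {k', j', i} := by
      rw [hv3, hv3, hj', hk', ← mul_assoc, ← mul_assoc]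
      congr 1
      exact gen_mul_gen r (f {j, i} k, f {i} j)
    have h2 := hv h1
    have h3 : ({k, j} : Multiset X) + {i} = {k', j'} + {i} := h2
    have h4 := add_right_cancel h3
    have h5 : (k = k' ∧ j = j') ∨ (k = j' ∧ j = k') := by
      have h6 : k ∈ ({k', j'} : Multiset X) := h4 ▸ (by simp)
      simp only [Multiset.insert_eq_cons, Multiset.mem_cons, Multiset.mem_singleton] at h6
      rcases h6 with rfl | rfl
      · left
        simpa [Multiset.insert_eq_cons] using h4
      · right
        rw [Multiset.pair_comm k' k] at h4
        simpa [Multiset.insert_eq_cons] using h4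
    rcases h5 with ⟨rfl, rfl⟩ | ⟨rfl, rfl⟩
    · exact Or.inl (Prod.ext hk'.symm hj'.symm)
    · exact Or.inr (Prod.ext hk'.symm hj'.symm)
  have hjj : ∀ i j, f {j, i} j = f {i} j := fun i j => hfix _ (by simpa using hQ i j j)
  have hB : ∀ i j k, r (f {j, i} k, f {i} j) = (f {k, i} j, f {i} k) := by
    intro i j k
    rcases hQ i j k with h1 | h1
    · have h2 : f {j, i} k = f {i} j := hfix _ h1
      rw [← hjj] at h2
      have := (hf _).1 h2
      subst this
      exact h1
    · exact h1
  -- The cocycle identity $f_{\{j,i\}}=f_{f_i(j)}\circ f_i$ comes from comparing the second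
  -- components of `hB` and `hA`.
  have hC : ∀ i j k, f {j, i} k = f {f {i} j} (f {i} k) := by
    intro i j k
    obtain ⟨m, hm⟩ := (hf {f {i} j}).2 (f {j, i} k)
    have h1 := hB i j k
    rw [← hm, hA] at h1
    rw [← hm, show m = f {i} k from (Prod.ext_iff.1 h1).2]
  have hD : ∀ i j k, f {f {i} j} (f {i} k) = f {f {j} i} (f {j} k) := fun i j k => by
    rw [← hC, ← hC, Multiset.pair_comm]
  have hr1 : ∀ x y, (r (x, y)).1 = f {x} y := by
    intro x i
    obtain ⟨j, rfl⟩ := (hf {i}).2 x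
    rw [hA]
    have := hD j i i
    rw [hff, hff] at this
    exact this
  have hr2 : ∀ x y, f {y} (r (x, y)).2 = x := by
    intro x i
    obtain ⟨j, rfl⟩ := (hf {i}).2 x
    rw [hA]
  have hE : ∀ p : X × X, f {(r p).1} ∘ f {(r p).2} = f {p.1} ∘ f {p.2} := by
    rintro ⟨x, i⟩
    obtain ⟨j, rfl⟩ := (hf {i}).2 x
    rw [hA]
    funext k
    exact (hD _ _ _).symm
  refine ⟨⟨fun x => ?_, fun y => ?_⟩, ?_⟩
  · simp only [hr1]
    exact hf {x}
  · rw [← Finite.surjective_iff_bijective]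
    intro j
    refine ⟨f {y} j, ?_⟩
    simp only [hA]
  rw [isBraided_iff]
  let G : X × X × X → AssocMonoid r := fun t =>
    AssocMonoid.gen r t.1 * (AssocMonoid.gen r t.2.1 * AssocMonoid.gen r t.2.2)
  let F : X × X × X → X → X := fun t => f {t.1} ∘ f {t.2.1} ∘ f {t.2.2}
  have hGl : ∀ t, G (actLeft r t) = G t := fun t => by
    simp only [G, actLeft, ← mul_assoc]
    congr 1
    exact (gen_mul_gen r (t.1, t.2.1)).symm
  have hGr : ∀ t, G (actRight r t) = G t := fun t => by
    simp only [G, actRight]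
    congr 1
    exact (gen_mul_gen r t.2).symm
  have hFl : ∀ t, F (actLeft r t) = F t := fun t => by
    simp only [F, actLeft, ← Function.comp_assoc]
    congr 1
    exact hE (t.1, t.2.1)
  have hFr : ∀ t, F (actRight r t) = F t := fun t => by
    simp only [F, actRight]
    congr 1
    exact hE t.2
  have h1 : ∀ t, (actLeft r (actRight r (actLeft r t))).1 =
      (actRight r (actLeft r (actRight r t))).1 := by
    intro t
    simp only [actLeft, actRight, hr1]
    have := congrFun (hE (t.1, t.2.1)) t.2.2
    simp only [Function.comp_apply, hr1] at this
    exact this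
  have h3 : ∀ t, (actLeft r (actRight r (actLeft r t))).2.2 =
      (actRight r (actLeft r (actRight r t))).2.2 := by
    rintro ⟨x, y, z⟩
    simp only [actLeft, actRight]
    apply (hf {z}).1
    apply (hf {y}).1
    rw [hr2, hr2]
    have := congrFun (hE (y, z)) (r ((r (x, (r (y, z)).1)).2, (r (y, z)).2)).2
    simp only [Function.comp_apply] at this
    rw [← this, hr2, hr2]
  -- The middle letter of a triple is determined by its outer letters, its product in $S$ and the
  -- composite of its three maps: the composite fixes $f_{\{j,c\}}$, then the product fixes the
  -- multiset. All three data are preserved by both $r\times\mathrm{id}$ and $\mathrm{id}\times r$,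
  -- so only outer letters need checking directly.
  have key : ∀ a b b' c, G (a, b, c) = G (a, b', c) → F (a, b, c) = F (a, b', c) → b = b' := by
    intro a b b' c hG hF
    obtain ⟨j, rfl⟩ := (hf {c}).2 b
    obtain ⟨j', rfl⟩ := (hf {c}).2 b'
    obtain ⟨k, rfl⟩ := (hf {j, c}).2 a
    have h4 : f {j, c} = f {j', c} := by
      funext m
      rw [hC, hC]
      exact (hf _).1 (congrFun hF m)
    have h5 : v {k, j, c} = v {k, j', c} := by
      rw [hv3, hv3, ← h4]
      exact hG
    have h6 := hv h5
    simp only [Multiset.insert_eq_cons, Multiset.cons_inj_right, Multiset.cons_inj_left] at h6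
    rw [h6]
  intro x y z
  refine Prod.ext (h1 _) (Prod.ext ?_ (h3 _))
  refine key (actLeft r (actRight r (actLeft r (x, y, z)))).1 _ _
    (actLeft r (actRight r (actLeft r (x, y, z)))).2.2 ?_ ?_
  · conv_rhs => rw [h1, h3]
    simp only [Prod.mk.eta]
    rw [hGl, hGr, hGl, hGr, hGl, hGr]
  · conv_rhs => rw [h1, h3]
    simp only [Prod.mk.eta]
    rw [hFl, hFr, hFl, hFr, hFl, hFr]

end SetTheoreticYBE

namespace SetTheoreticYBE

variable {X : Type*}

/-! ### Straightening maps are nondegenerate solutions -/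

/-- The sign of a pair: `1` for a descent, `-1` for an ascent. -/
def pairSign [LinearOrder X] (p : X × X) : ℤ :=
  if p.2 < p.1 then 1 else if p.1 < p.2 then -1 else 0

theorem pairSign_of_gt [LinearOrder X] {x y : X} (h : y < x) : pairSign (x, y) = 1 := if_pos h

theorem pairSign_of_lt [LinearOrder X] {x y : X} (h : x < y) : pairSign (x, y) = -1 := by
  simp [pairSign, h, h.asymm]

@[simp]
theorem pairSign_self [LinearOrder X] (x : X) : pairSign (x, x) = 0 := by
  simp [pairSign]

theorem neg_one_le_pairSign [LinearOrder X] (p : X × X) : -1 ≤ pairSign p := by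
  unfold pairSign
  split_ifs <;> norm_num

/-- Ordered words of length three with exactly one repetition. -/
def IsAscRep [LinearOrder X] (t : X × X × X) : Prop :=
  (t.1 = t.2.1 ∧ t.2.1 < t.2.2) ∨ (t.1 < t.2.1 ∧ t.2.1 = t.2.2)

/-- Decreasing words of length three with exactly one repetition. -/
def IsDescRep [LinearOrder X] (t : X × X × X) : Prop :=
  (t.1 = t.2.1 ∧ t.2.2 < t.2.1) ∨ (t.2.1 < t.1 ∧ t.2.1 = t.2.2)

/-- A map which straightens words of length two, together with the normal forms of the words of
length three. -/
structure IsTripleStraightening [LinearOrder X] (r : X × X → X × X)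
    (nf : X × X × X → X × X × X) : Prop where
  inv : Function.Involutive r
  sqfree : IsSquareFree r
  lt : ∀ i j, i < j → (r (j, i)).1 < (r (j, i)).2 ∧ (r (j, i)).1 < j
  asc : ∀ i j, i < j → (r (i, j)).2 < (r (i, j)).1
  nf_le_left : ∀ t, (nf t).1 ≤ (nf t).2.1
  nf_le_right : ∀ t, (nf t).2.1 ≤ (nf t).2.2
  nf_self : ∀ t : X × X × X, t.1 ≤ t.2.1 → t.2.1 ≤ t.2.2 → nf t = t
  nf_actLeft : ∀ t, nf (actLeft r t) = nf t
  nf_actRight : ∀ t, nf (actRight r t) = nf t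

theorem actLeft_involutive {r : X × X → X × X} (h : Function.Involutive r) :
    Function.Involutive (actLeft r) := by
  rintro ⟨x, y, z⟩
  simp [actLeft, h (x, y)]

theorem actRight_involutive {r : X × X → X × X} (h : Function.Involutive r) :
    Function.Involutive (actRight r) := by
  rintro ⟨x, y, z⟩
  simp [actRight, h (y, z)]

theorem IsStraightening.exists_isTripleStraightening [LinearOrder X] [Finite X]
    {r : X × X → X × X} (hinv : Function.Involutive r) (hsf : IsSquareFree r)
    (h : IsStraightening r) : ∃ nf, IsTripleStraightening r nf := by
  have hex : ∀ t : X × X × X, ∃ e : X × X × X, [e.1, e.2.1, e.2.2] ∈ orderedWords X ∧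
      wordProd r [t.1, t.2.1, t.2.2] = wordProd r [e.1, e.2.1, e.2.2] := by
    intro t
    obtain ⟨w, hw, -, hw2⟩ := h.exists_ordered [t.1, t.2.1, t.2.2]
    match w, length_eq_of_wordProd_eq hw2 with
    | [a, b, c], _ => exact ⟨(a, b, c), hw, hw2⟩
  choose nf hnf hnf' using hex
  have huniq : ∀ t t' : X × X × X,
      wordProd r [t.1, t.2.1, t.2.2] = wordProd r [t'.1, t'.2.1, t'.2.2] → nf t = nf t' := by
    intro t t' htt
    have := h.injOn (hnf t) (hnf t') (by rw [← hnf', ← hnf', htt])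
    simp only [List.cons.injEq, and_true] at this
    exact Prod.ext this.1 (Prod.ext this.2.1 this.2.2)
  have hord : ∀ a b c : X, [a, b, c] ∈ orderedWords X ↔ a ≤ b ∧ b ≤ c := by
    intro a b c
    simp only [orderedWords, Set.mem_ofPred_eq, List.pairwise_cons, List.mem_cons,
      List.not_mem_nil, or_false, forall_eq_or_imp, forall_eq, IsEmpty.forall_iff, implies_true,
      List.Pairwise.nil, and_true]
    exact ⟨fun h => ⟨h.1.1, h.2⟩, fun h => ⟨⟨h.1, h.1.trans h.2⟩, h.2⟩⟩
  refine ⟨nf, hinv, hsf, h.lt, fun i j hij => h.asc hinv hij, fun t => ((hord _ _ _).1 (hnf t)).1,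
    fun t => ((hord _ _ _).1 (hnf t)).2, ?_, ?_, ?_⟩
  · intro t h1 h2
    have := h.injOn (hnf t) ((hord t.1 t.2.1 t.2.2).2 ⟨h1, h2⟩) (hnf' t).symm
    simp only [List.cons.injEq, and_true] at this
    exact Prod.ext this.1 (Prod.ext this.2.1 this.2.2)
  · intro t
    exact huniq _ _ (wordProd_pair r [] [t.2.2] (t.1, t.2.1)).symm
  · intro t
    exact huniq _ _ (wordProd_pair r [t.1] [] t.2).symm

namespace IsTripleStraightening

variable [LinearOrder X] {r : X × X → X × X} {nf : X × X × X → X × X × X}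

theorem pairSign_apply (h : IsTripleStraightening r nf) (p : X × X) :
    pairSign (r p) = - pairSign p := by
  obtain ⟨x, y⟩ := p
  rcases lt_trichotomy x y with hxy | rfl | hxy
  · rw [pairSign_of_lt hxy, ← Prod.mk.eta (p := r (x, y)), pairSign_of_gt (h.asc _ _ hxy), neg_neg]
  · rw [h.sqfree, pairSign_self, neg_zero]
  · rw [pairSign_of_gt hxy, ← Prod.mk.eta (p := r (x, y)), pairSign_of_lt (h.lt _ _ hxy).1]

/-- Each class is stable under `actLeft r`, which reverses the first sign, and under `actRight r`,
which reverses the second. -/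
theorem sum_sign_eq_zero (h : IsTripleStraightening r nf) [Fintype X] (e : X × X × X) :
    ∑ t with nf t = e, (pairSign (t.1, t.2.1) + pairSign t.2) = 0 := by
  rw [Finset.sum_add_distrib]
  have h1 : ∑ t with nf t = e, pairSign (t.1, t.2.1) =
      - ∑ t with nf t = e, pairSign (t.1, t.2.1) := by
    rw [← Finset.sum_neg_distrib]
    refine Finset.sum_nbij' (actLeft r) (actLeft r) ?_ ?_ ?_ ?_ ?_
    · intro t ht; simpa [h.nf_actLeft] using ht
    · intro t ht; simpa [h.nf_actLeft] using ht
    · intro t _; exact actLeft_involutive h.inv t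
    · intro t _; exact actLeft_involutive h.inv t
    · intro t _
      simp only [actLeft, Prod.mk.eta]
      rw [h.pairSign_apply, neg_neg]
  have h2 : ∑ t with nf t = e, pairSign t.2 = - ∑ t with nf t = e, pairSign t.2 := by
    rw [← Finset.sum_neg_distrib]
    refine Finset.sum_nbij' (actRight r) (actRight r) ?_ ?_ ?_ ?_ ?_
    · intro t ht; simpa [h.nf_actRight] using ht
    · intro t ht; simpa [h.nf_actRight] using ht
    · intro t _; exact actRight_involutive h.inv t
    · intro t _; exact actRight_involutive h.inv t
    · intro t _
      simp only [actRight]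
      rw [h.pairSign_apply, neg_neg]
  omega

theorem nf_of_isAscRep (h : IsTripleStraightening r nf) {t : X × X × X} (ht : IsAscRep t) :
    nf t = t := by
  rcases ht with ht | ht
  · exact h.nf_self t ht.1.le ht.2.le
  · exact h.nf_self t ht.1.le ht.2.le

theorem exists_descent (h : IsTripleStraightening r nf) {x y z : X}
    (ht : nf (x, y, z) ≠ (x, y, z)) : y < x ∨ z < y := by
  by_contra hcon
  rw [not_or, not_lt, not_lt] at hcon
  exact ht (h.nf_self _ hcon.1 hcon.2)

theorem sign_nonneg_of_ne (h : IsTripleStraightening r nf) {t : X × X × X} (ht : nf t ≠ t) :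
    0 ≤ pairSign (t.1, t.2.1) + pairSign t.2 := by
  obtain ⟨x, y, z⟩ := t
  rcases h.exists_descent ht with h1 | h1
  · have := neg_one_le_pairSign (y, z)
    rw [pairSign_of_gt h1]
    simp only at this ⊢
    omega
  · have := neg_one_le_pairSign (x, y)
    rw [show ((x, y, z) : X × X × X).2 = (y, z) from rfl, pairSign_of_gt h1]
    simp only at this ⊢
    omega

/-- The ordered word itself contributes $-1$ to a vanishing sum. Since every other word of the class
has a descent and contributes at least $0$, exactly one of them contributes $1$ and the rest
contribute $0$. -/
theorem sum_sign_erase (h : IsTripleStraightening r nf) [Fintype X] {e : X × X × X}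
    (he : IsAscRep e) :
    ∑ t ∈ (Finset.univ.filter fun t => nf t = e).erase e,
      (pairSign (t.1, t.2.1) + pairSign t.2) = 1 := by
  have h1 := h.sum_sign_eq_zero e
  rw [← Finset.add_sum_erase _ _ (a := e) (by simp [h.nf_of_isAscRep he])] at h1
  have h2 : pairSign (e.1, e.2.1) + pairSign e.2 = -1 := by
    obtain ⟨x, y, z⟩ := e
    rcases he with ⟨h3, h4⟩ | ⟨h3, h4⟩ <;> simp only at h3 h4 ⊢
    · rw [h3, pairSign_self, pairSign_of_lt h4, zero_add]
    · rw [h4, pairSign_self, ← h4, pairSign_of_lt h3, add_zero]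
  omega

theorem sign_le_one (h : IsTripleStraightening r nf) [Finite X] {t : X × X × X}
    (ht : IsAscRep (nf t)) : pairSign (t.1, t.2.1) + pairSign t.2 ≤ 1 := by
  have := Fintype.ofFinite X
  by_cases hte : nf t = t
  · rcases hte ▸ ht with h1 | h1
    · rw [h1.1, pairSign_self, ← Prod.mk.eta (p := t.2), pairSign_of_lt h1.2]; norm_num
    · rw [← Prod.mk.eta (p := t.2), h1.2, pairSign_self, ← h1.2, pairSign_of_lt h1.1]; norm_num
  · rw [← h.sum_sign_erase ht]
    refine Finset.single_le_sum (f := fun t : X × X × X => pairSign (t.1, t.2.1) + pairSign t.2)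
      ?_ (by simpa using Ne.symm hte)
    intro s hs
    simp only [Finset.mem_erase, Finset.mem_filter, Finset.mem_univ, true_and] at hs
    exact h.sign_nonneg_of_ne (hs.2 ▸ hs.1.symm)

theorem exists_isDescRep (h : IsTripleStraightening r nf) [Finite X] {e : X × X × X}
    (he : IsAscRep e) : ∃ t, nf t = e ∧ IsDescRep t := by
  have := Fintype.ofFinite X
  have h1 := h.sum_sign_erase he
  obtain ⟨t, ht, ht'⟩ := Finset.exists_ne_zero_of_sum_ne_zero (h1.trans_ne one_ne_zero)
  simp only [Finset.mem_erase, Finset.mem_filter, Finset.mem_univ, true_and] at ht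
  refine ⟨t, ht.2, ?_⟩
  have hne : nf t ≠ t := ht.2 ▸ ht.1.symm
  have h2 := h.sign_le_one (t := t) (ht.2.symm ▸ he)
  obtain ⟨x, y, z⟩ := t
  simp only [IsDescRep] at *
  rcases h.exists_descent hne with h1 | h1
  · rcases lt_trichotomy y z with hyz | hyz | hyz
    · simp [pairSign_of_gt h1, pairSign_of_lt hyz] at ht'
    · exact Or.inr ⟨h1, hyz⟩
    · simp [pairSign_of_gt h1, pairSign_of_gt hyz] at h2
  · rcases lt_trichotomy x y with hxy | hxy | hxy
    · simp [pairSign_of_lt hxy, pairSign_of_gt h1] at ht'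
    · exact Or.inl ⟨hxy, h1⟩
    · simp [pairSign_of_gt hxy, pairSign_of_gt h1] at h2

/-- Choosing a decreasing word with a repetition in each class of `exists_isDescRep` is injective.
Reversal matches the two finite kinds of words, so the choice exhausts all decreasing words with a
repetition. -/
theorem isAscRep_nf_of_isDescRep (h : IsTripleStraightening r nf) [Finite X] {t : X × X × X}
    (ht : IsDescRep t) : IsAscRep (nf t) := by
  choose ψ hψ hψ' using fun e : {e : X × X × X // IsAscRep e} => h.exists_isDescRep e.2
  have hrev : ∀ t : X × X × X, IsDescRep t → IsAscRep (t.2.2, t.2.1, t.1) := by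
    rintro t (⟨h1, h2⟩ | ⟨h1, h2⟩)
    · exact Or.inr ⟨h2, h1.symm⟩
    · exact Or.inl ⟨h2.symm, h1⟩
  let F : {e : X × X × X // IsAscRep e} → {e : X × X × X // IsAscRep e} :=
    fun e => ⟨((ψ e).2.2, (ψ e).2.1, (ψ e).1), hrev _ (hψ' e)⟩
  have hF : Function.Injective F := by
    intro e e' hee
    simp only [F, Subtype.mk.injEq, Prod.mk.injEq] at hee
    have : ψ e = ψ e' := Prod.ext hee.2.2 (Prod.ext hee.2.1 hee.1)
    apply Subtype.ext
    rw [← hψ e, ← hψ e', this]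
  obtain ⟨e, he⟩ := (Finite.injective_iff_surjective.1 hF) ⟨_, hrev t ht⟩
  simp only [F, Subtype.mk.injEq, Prod.mk.injEq] at he
  have : ψ e = t := Prod.ext he.2.2 (Prod.ext he.2.1 he.1)
  rw [← this, hψ e]
  exact e.2

theorem not_desc_desc (h : IsTripleStraightening r nf) [Finite X] {x y z : X}
    (ht : IsAscRep (nf (x, y, z))) (hxy : y < x) : y ≤ z := by
  by_contra hyz
  have := h.sign_le_one ht
  simp only at this
  rw [pairSign_of_gt hxy, pairSign_of_gt (not_le.1 hyz)] at this
  norm_num at this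

theorem not_asc_asc (h : IsTripleStraightening r nf) {x y z : X}
    (ht : IsAscRep (nf (x, y, z))) (hxy : x < y) : z ≤ y := by
  by_contra hyz
  rw [not_le] at hyz
  rw [h.nf_self _ hxy.le hyz.le] at ht
  rcases ht with ⟨h1, -⟩ | ⟨-, h1⟩
  · exact hxy.ne h1
  · exact hyz.ne h1

theorem isAscRep_nf_left (h : IsTripleStraightening r nf) [Finite X] {x y : X} (hxy : x ≠ y) :
    IsAscRep (nf (x, x, y)) := by
  rcases lt_or_gt_of_ne hxy with h1 | h1
  · rw [h.nf_of_isAscRep (Or.inl ⟨rfl, h1⟩)]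
    exact Or.inl ⟨rfl, h1⟩
  · exact h.isAscRep_nf_of_isDescRep (Or.inl ⟨rfl, h1⟩)

theorem isAscRep_nf_right (h : IsTripleStraightening r nf) [Finite X] {x y : X} (hxy : x ≠ y) :
    IsAscRep (nf (x, y, y)) := by
  rcases lt_or_gt_of_ne hxy with h1 | h1
  · rw [h.nf_of_isAscRep (Or.inr ⟨h1, rfl⟩)]
    exact Or.inr ⟨h1, rfl⟩
  · exact h.isAscRep_nf_of_isDescRep (Or.inr ⟨h1, rfl⟩)

/-- Start from the word $jii$, whose class contains an ordered word with a repetition, and apply `r`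
to its left pair; a strictly increasing word cannot result. -/
theorem le_snd (h : IsTripleStraightening r nf) [Finite X] {i j : X} (hij : i < j) :
    i ≤ (r (j, i)).2 := by
  have h1 := h.isAscRep_nf_right hij.ne'
  rw [← h.nf_actLeft] at h1
  exact h.not_asc_asc h1 (h.lt i j hij).1

theorem fst_ne (h : IsTripleStraightening r nf) {i j : X} (hij : i ≠ j) : (r (i, j)).1 ≠ i := by
  rcases lt_or_gt_of_ne hij with h1 | h1
  · have h2 := h.asc i j h1
    have h3 := (h.lt _ _ h2).2
    rw [Prod.mk.eta, h.inv] at h3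
    exact h3.ne'
  · exact (h.lt _ _ h1).2.ne

end IsTripleStraightening

end SetTheoreticYBE

namespace SetTheoreticYBE

variable {X : Type*}

/-! ### Nondegeneracy of straightening maps -/

namespace IsTripleStraightening

variable [LinearOrder X] {r : X × X → X × X} {nf : X × X × X → X × X × X}

theorem isAscRep_or_of_isAscRep_nf (h : IsTripleStraightening r nf) [Finite X] (t : X × X × X) :
    IsAscRep (nf t) ∨ t.1 = t.2.1 ∧ t.2.1 = t.2.2 ∨ t.1 ≠ t.2.1 ∧ t.2.1 ≠ t.2.2 := by
  obtain ⟨x, y, z⟩ := t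
  by_cases hxy : x = y <;> by_cases hyz : y = z
  · exact Or.inr (Or.inl ⟨hxy, hyz⟩)
  · subst hxy; exact Or.inl (h.isAscRep_nf_left hyz)
  · subst hyz; exact Or.inl (h.isAscRep_nf_right hxy)
  · exact Or.inr (Or.inr ⟨hxy, hyz⟩)

/-- In a word with repetitions in its class, a right factor which neither is preceded nor becomes
preceded by its first letter keeps its last letter. -/
theorem snd_eq_of_isAscRep_nf (h : IsTripleStraightening r nf) [Finite X] {x y z : X}
    (ht : IsAscRep (nf (x, y, z))) (hxy : x ≠ y) (hyz : y ≠ z) (hx : x ≠ (r (y, z)).1) :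
    (r (y, z)).2 = z := by
  classical
  have := Fintype.ofFinite X
  obtain ⟨f, hf⟩ : ∃ f : X → ℤ, StrictMono f :=
    ⟨fun x => ((Fintype.orderIsoFinOfCardEq X rfl).symm x : Fin _).1, fun a b hab => by
      have := (Fintype.orderIsoFinOfCardEq X rfl).symm.strictMono hab
      simpa using this⟩
  -- `G` measures how far `r` moves the second letter, signed so that it is nonnegative by `le_snd`
  -- and invariant under `r`. Its sum over the words of `C` equals $2\sum G$, and two families of
  -- words in `C` already account for that total, so it vanishes on all the others.
  let G : X × X → ℤ := fun p => pairSign p * (f (r p).2 - f p.2)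
  have hG0 : ∀ p : X × X, p.1 = p.2 → G p = 0 := by
    rintro ⟨a, b⟩ hab
    simp only at hab
    subst hab
    simp [G]
  have hGr : ∀ p, G (r p) = G p := fun p => by
    simp only [G]
    rw [h.pairSign_apply, h.inv]
    ring
  have hGD : ∀ p : X × X, p.2 < p.1 → 0 ≤ G p := by
    rintro ⟨a, b⟩ hab
    simp only [G]
    rw [pairSign_of_gt hab, one_mul, sub_nonneg]
    exact hf.monotone (h.le_snd hab)
  have hG : ∀ p, 0 ≤ G p := by
    intro p
    rcases lt_trichotomy p.1 p.2 with hp | hp | hp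
    · rw [← hGr]; exact hGD _ (h.asc _ _ hp)
    · rw [hG0 p hp]
    · exact hGD _ hp
  let Θ : ℤ := ∑ p : X × X, pairSign p * f p.2
  have hΓ : ∑ p, G p = - 2 * Θ := by
    have : ∑ p : X × X, pairSign p * f (r p).2 = - Θ := by
      rw [← Equiv.sum_comp (h.inv.toPerm r), ← Finset.sum_neg_distrib]
      refine Finset.sum_congr rfl fun p _ => ?_
      simp only [Function.Involutive.coe_toPerm]
      rw [h.inv, h.pairSign_apply]
      ring
    simp only [G, mul_sub, Finset.sum_sub_distrib, this]
    simp only [Θ]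
    ring
  let C : Finset (X × X × X) := Finset.univ.filter fun t => IsAscRep (nf t)
  -- The involution `actLeft r` keeps the third letter and reverses the sign of the first pair.
  have hl : ∑ t ∈ C, pairSign (t.1, t.2.1) * f t.2.2 = 0 := by
    have : ∑ t ∈ C, pairSign (t.1, t.2.1) * f t.2.2 =
        - ∑ t ∈ C, pairSign (t.1, t.2.1) * f t.2.2 := by
      rw [← Finset.sum_neg_distrib]
      refine Finset.sum_nbij' (actLeft r) (actLeft r) ?_ ?_ ?_ ?_ ?_
      · intro t ht; simpa [C, h.nf_actLeft] using ht
      · intro t ht; simpa [C, h.nf_actLeft] using ht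
      · intro t _; exact actLeft_involutive h.inv t
      · intro t _; exact actLeft_involutive h.inv t
      · intro t _
        simp only [actLeft, Prod.mk.eta]
        rw [h.pairSign_apply]
        ring
    omega
  have hK : ∑ t ∈ C, G t.2 = - 2 * ∑ t ∈ C, pairSign t.2 * f t.2.2 := by
    have : ∑ t ∈ C, pairSign t.2 * f (r t.2).2 = - ∑ t ∈ C, pairSign t.2 * f t.2.2 := by
      rw [← Finset.sum_neg_distrib]
      refine Finset.sum_nbij' (actRight r) (actRight r) ?_ ?_ ?_ ?_ ?_
      · intro t ht; simpa [C, h.nf_actRight] using ht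
      · intro t ht; simpa [C, h.nf_actRight] using ht
      · intro t _; exact actRight_involutive h.inv t
      · intro t _; exact actRight_involutive h.inv t
      · intro t _
        simp only [actRight]
        rw [h.pairSign_apply]
        ring
    simp only [G, mul_sub, Finset.sum_sub_distrib, this]
    ring
  -- In a word of `C` without adjacent equal letters an ascent meets a descent, so the signs cancel.
  -- The words $aac$ and $abb$ contribute one copy of `Θ` each.
  have hS : ∑ t ∈ C, (pairSign (t.1, t.2.1) + pairSign t.2) * f t.2.2 = 2 * Θ := by
    have h1 : ∀ t : X × X × X, (if IsAscRep (nf t) then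
        (pairSign (t.1, t.2.1) + pairSign t.2) * f t.2.2 else 0) =
        (if t.1 = t.2.1 then pairSign t.2 * f t.2.2 else 0) +
          (if t.2.1 = t.2.2 then pairSign (t.1, t.2.1) * f t.2.1 else 0) := by
      rintro ⟨a, b, c⟩
      simp only
      by_cases hab : a = b <;> by_cases hbc : b = c
      · subst hab; subst hbc; simp
      · subst hab
        simp [hbc, h.isAscRep_nf_left hbc]
      · subst hbc
        simp [hab, h.isAscRep_nf_right hab]
      · simp only [hab, hbc, if_false, add_zero, ite_eq_right_iff]
        intro hc
        have h2 := h.sign_le_one hc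
        rcases lt_or_gt_of_ne hab with h3 | h3 <;> rcases lt_or_gt_of_ne hbc with h4 | h4
        · exact absurd (h.not_asc_asc hc h3) (not_le.2 h4)
        · rw [pairSign_of_lt h3, pairSign_of_gt h4]; simp
        · rw [pairSign_of_gt h3, pairSign_of_lt h4]; simp
        · exact absurd (h.not_desc_desc hc h3) (not_le.2 h4)
    simp only [C]
    rw [Finset.sum_filter, Finset.sum_congr rfl fun t _ => h1 t, Finset.sum_add_distrib, two_mul]
    congr 1
    · rw [Fintype.sum_prod_type, Finset.sum_comm]
      simp [Θ]
    · simp only [Fintype.sum_prod_type]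
      simp [Θ, Fintype.sum_prod_type]
  have hK2 : ∑ t ∈ C, G t.2 = 2 * ∑ p, G p := by
    have h1 : ∑ t ∈ C, pairSign t.2 * f t.2.2 = 2 * Θ := by
      rw [← hS]
      simp only [add_mul, Finset.sum_add_distrib, hl, zero_add]
    rw [hK, h1, hΓ]
    ring
  -- The two families are the words $abc$ with $a=b$ and those which acquire this form under
  -- `actRight r`. Where `G` is nonzero they are disjoint, by `fst_ne`.
  have hle : ∀ t : X × X × X, (if t.1 = t.2.1 then G t.2 else 0) +
      (if t.1 = (r t.2).1 then G t.2 else 0) ≤ if IsAscRep (nf t) then G t.2 else 0 := by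
    rintro ⟨a, b, c⟩
    simp only
    by_cases hbc : b = c
    · rw [hG0 (b, c) hbc]; simp
    by_cases hab : a = b
    · subst hab
      simp [(h.fst_ne hbc).symm, h.isAscRep_nf_left hbc]
    · by_cases hab' : a = (r (b, c)).1
      · have : IsAscRep (nf (a, b, c)) := by
          rw [← h.nf_actRight]
          have h2 : actRight r (a, b, c) = (a, a, (r (b, c)).2) := by
            simp only [actRight]
            rw [← Prod.mk.eta (p := r (b, c)), ← hab']
          rw [h2]
          apply h.isAscRep_nf_left
          intro h3
          have h4 : r (b, c) = (a, a) := Prod.ext hab'.symm h3.symm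
          have h5 := congrArg r h4
          rw [h.inv, h.sqfree] at h5
          exact hbc ((Prod.ext_iff.1 h5).1.trans (Prod.ext_iff.1 h5).2.symm)
        simp [hab, ← hab', this]
      · simp only [hab, hab', if_false, add_zero]
        split_ifs
        · exact hG _
        · exact le_rfl
  have hsum : ∑ t : X × X × X, ((if t.1 = t.2.1 then G t.2 else 0) +
      (if t.1 = (r t.2).1 then G t.2 else 0)) =
      ∑ t : X × X × X, if IsAscRep (nf t) then G t.2 else 0 := by
    rw [← Finset.sum_filter]
    refine Eq.trans ?_ hK2.symm
    rw [Finset.sum_add_distrib, two_mul]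
    congr 1
    · rw [Fintype.sum_prod_type, Finset.sum_comm]
      simp
    · rw [Fintype.sum_prod_type, Finset.sum_comm]
      simp
  have h2 := (Finset.sum_eq_sum_iff_of_le fun t _ => hle t).1 hsum (x, y, z) (Finset.mem_univ _)
  simp only [hxy, hx, ht, if_true, if_false, add_zero] at h2
  have h3 : pairSign (y, z) ≠ 0 := by
    rcases lt_or_gt_of_ne hyz with h4 | h4
    · rw [pairSign_of_lt h4]; norm_num
    · rw [pairSign_of_gt h4]; norm_num
  have h4 := (mul_eq_zero.1 h2.symm).resolve_left h3
  exact hf.injective (sub_eq_zero.1 h4)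

section Nondegenerate

variable {t : X}

/-- The word $att$ becomes $pqt$ with $q<p$, and two successive descents are impossible. If the
first component of $r(q,t)$ differed from $p$, `snd_eq_of_isAscRep_nf` would give $\mathcal
R_t(q)=t$, against the assumption on $t$. -/
theorem snd_lt_of_nondegenerate (h : IsTripleStraightening r nf) [Finite X]
    (ht : ∀ y, (r (y, t)).2 = t → y = t) {a : X} (ha : a < t) :
    (r (a, t)).2 < t ∧ (r ((r (a, t)).2, t)).1 = (r (a, t)).1 := by
  have h1 := h.isAscRep_nf_right ha.ne
  rw [← h.nf_actLeft] at h1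
  set p := (r (a, t)).1 with hp
  set q := (r (a, t)).2 with hq
  change IsAscRep (nf (p, q, t)) at h1
  have hqp : q < p := h.asc _ _ ha
  have hqt' : q ≠ t := fun h2 => ha.ne (ht a h2)
  have hqt : q < t := lt_of_le_of_ne (h.not_desc_desc h1 hqp) hqt'
  refine ⟨hqt, ?_⟩
  by_contra hne
  rw [← h.nf_actRight] at h1
  have h2 := h.snd_eq_of_isAscRep_nf (x := p) (y := (r (q, t)).1) (z := (r (q, t)).2) h1
    (Ne.symm hne) (h.asc _ _ hqt).ne' (by rw [Prod.mk.eta, h.inv]; exact hqp.ne')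
  rw [Prod.mk.eta, h.inv] at h2
  exact hqt' (ht q h2.symm)

/-- The map $\mathcal R_t$ preserves the letters below $t$, and $\mathcal R_t(a)$ determines the
whole of $r(a,t)$ by the preceding lemma. Hence it is injective there, and by finiteness surjective.
-/
theorem exists_snd_eq_of_nondegenerate (h : IsTripleStraightening r nf) [Finite X]
    (ht : ∀ y, (r (y, t)).2 = t → y = t) {a : X} (ha : a < t) :
    (∃ a' < t, (r (a', t)).2 = a) ∧ (r ((r (a, t)).1, a)).2 = t := by
  let F : Set.Iio t → Set.Iio t := fun b => ⟨_, (h.snd_lt_of_nondegenerate ht b.2).1⟩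
  have hF : Function.Injective F := by
    rintro ⟨b, hb⟩ ⟨c, hc⟩ hbc
    replace hbc := congrArg Subtype.val hbc
    simp only [F] at hbc
    have h1 := (h.snd_lt_of_nondegenerate ht hb).2
    have h2 := (h.snd_lt_of_nondegenerate ht hc).2
    rw [hbc, h2] at h1
    have h3 : r (b, t) = r (c, t) := Prod.ext h1.symm hbc
    have h4 := h.inv.injective h3
    exact Subtype.ext (Prod.ext_iff.1 h4).1
  obtain ⟨⟨a', ha'⟩, hF'⟩ := (Finite.injective_iff_surjective.1 hF) ⟨a, ha⟩
  replace hF' := congrArg Subtype.val hF'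
  simp only [F] at hF'
  refine ⟨⟨a', ha', hF'⟩, ?_⟩
  have h1 := (h.snd_lt_of_nondegenerate ht ha').2
  rw [hF'] at h1
  rw [h1]
  have h2 : r (a', t) = ((r (a', t)).1, a) := Prod.ext rfl hF'
  rw [← h2, h.inv]

end Nondegenerate

/-- The ascents starting at `i` are permuted by `z ↦ (r (i, z)).1` if all larger letters are
nondegenerate. -/
theorem exists_fst_eq (h : IsTripleStraightening r nf) [Finite X] {i : X}
    (hi : ∀ z, i < z → ∀ y, (r (y, z)).2 = z → y = z) {j : X} (hij : i < j) :
    ∃ z, i < z ∧ (r (i, z)).1 = j ∧ (r (j, i)).2 = z := by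
  have hlt : ∀ z, i < z → i < (r (i, z)).1 := fun z hz => by
    have h1 := (h.lt _ _ (h.asc _ _ hz)).2
    rwa [Prod.mk.eta, h.inv] at h1
  -- Since $\mathcal R_i$ recovers $z$ from $\mathcal L_i(z)$ by `hR`, the map is injective and
  -- hence a permutation of the letters above $i$.
  let F : Set.Ioi i → Set.Ioi i := fun z => ⟨(r (i, z)).1, hlt z z.2⟩
  have hR : ∀ z, i < z → (r ((r (i, z)).1, i)).2 = z := fun z hz =>
    (h.exists_snd_eq_of_nondegenerate (hi z hz) hz).2
  have hF : Function.Injective F := by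
    rintro ⟨b, hb⟩ ⟨c, hc⟩ hbc
    replace hbc := congrArg Subtype.val hbc
    simp only [F] at hbc
    apply Subtype.ext
    simp only
    rw [← hR b hb, hbc, hR c hc]
  obtain ⟨⟨z, hz⟩, hz'⟩ := (Finite.injective_iff_surjective.1 hF) ⟨j, hij⟩
  replace hz' := congrArg Subtype.val hz'
  simp only [F] at hz'
  refine ⟨z, hz, hz', ?_⟩
  rw [← hz', hR z hz]

/-- Induction descends from the largest letter. If all letters above `i` are nondegenerate, then
$\mathcal R_i$ sends letters above `i` to letters above `i`; a smaller `y` with $\mathcal R_i(y)=i$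
would yield a larger letter with the same property. -/
theorem eq_of_snd_eq (h : IsTripleStraightening r nf) [Finite X] (t y : X)
    (hy : (r (y, t)).2 = t) : y = t := by
  induction t using WellFoundedGT.induction generalizing y with
  | _ i ih =>
    have key : ∀ j, i < j → (r (j, i)).2 = i → False := by
      intro j hij hj
      obtain ⟨z, hz, -, hz'⟩ := h.exists_fst_eq (fun z hz y hy => ih z hz y hy) hij
      rw [hj] at hz'
      exact hz.ne hz'
    rcases lt_trichotomy y i with h1 | h1 | h1
    · exfalso
      have h2 := h.asc _ _ h1
      rw [hy] at h2
      refine key _ h2 ?_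
      have h3 : r (y, i) = ((r (y, i)).1, i) := Prod.ext rfl hy
      have h4 := congrArg r h3
      rw [h.inv] at h4
      rw [← h4]
    · exact h1
    · exact (key y h1 hy).elim

theorem isNondegenerate (h : IsTripleStraightening r nf) [Finite X] : IsNondegenerate r := by
  have hi : ∀ z y : X, (r (y, z)).2 = z → y = z := h.eq_of_snd_eq
  constructor
  · intro i
    rw [← Finite.surjective_iff_bijective]
    intro j
    rcases lt_trichotomy i j with hij | rfl | hij
    · obtain ⟨z, -, hz, -⟩ := h.exists_fst_eq (fun z _ => hi z) hij
      exact ⟨z, hz⟩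
    · exact ⟨i, congrArg Prod.fst (h.sqfree i)⟩
    · obtain ⟨z, hz, hz', -⟩ := h.exists_fst_eq (fun z _ => hi z) hij
      refine ⟨(r (j, z)).2, ?_⟩
      have : r (j, z) = (i, (r (j, z)).2) := Prod.ext hz' rfl
      simp only
      rw [← this, h.inv]
  · intro i
    rw [← Finite.surjective_iff_bijective]
    intro j
    rcases lt_trichotomy i j with hij | rfl | hij
    · exact ⟨_, (h.exists_snd_eq_of_nondegenerate (hi j) hij).2⟩
    · exact ⟨i, congrArg Prod.snd (h.sqfree i)⟩
    · obtain ⟨a, -, ha⟩ := (h.exists_snd_eq_of_nondegenerate (hi i) hij).1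
      exact ⟨a, ha⟩

end IsTripleStraightening

end SetTheoreticYBE

namespace SetTheoreticYBE

variable {X : Type*}

/-! ### The braid relation by counting orbits of two involutions -/

section Involutions

variable {T : Type*} {l m : T → T} {F : Finset T}

/-- Alternating products of `l` and `m` applied to `t` give six distinct points. A set of at most
six points leaves `m (l (m t))` nowhere to go except `l (m (l t))`. -/
theorem six_le_card_of_involutive (hl : Function.Involutive l) (hm : Function.Involutive m)
    (hlF : ∀ t ∈ F, l t ∈ F) (hmF : ∀ t ∈ F, m t ∈ F)
    (hl' : ∀ t ∈ F, l t ≠ t) (hm' : ∀ t ∈ F, m t ≠ t) (hlm : ∀ t ∈ F, l t ≠ m t)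
    (hlm' : ∀ t ∈ F, l (m t) ≠ m (l t)) {t : T} (ht : t ∈ F) :
    6 ≤ F.card ∧ (F.card ≤ 6 → l (m (l t)) = m (l (m t))) := by
  classical
  have e1 := hl' t ht
  have e2 := hm' t ht
  have e3 := hlm t ht
  have e4 := hlm' t ht
  have e5 := hm' _ (hlF t ht)
  have e6 := hl' _ (hmF t ht)
  have e7 := hl' _ (hmF _ (hlF t ht))
  have e8 := hm' _ (hlF _ (hmF t ht))
  have hnd : [t, l t, m t, m (l t), l (m t), l (m (l t))].Nodup := by
    simp only [List.nodup_cons, List.mem_cons, List.not_mem_nil, or_false, not_or,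
      List.nodup_nil, not_false_eq_true, and_true]
    have h1 := fun t => hl t
    have h2 := fun t => hm t
    refine ⟨⟨?_, ?_, ?_, ?_, ?_⟩, ⟨?_, ?_, ?_, ?_⟩, ⟨?_, ?_, ?_⟩, ⟨?_, ?_⟩, ?_⟩ <;> grind
  constructor
  · rw [show 6 = [t, l t, m t, m (l t), l (m t), l (m (l t))].length from rfl,
      ← List.toFinset_card_of_nodup hnd]
    apply Finset.card_le_card
    intro s hs
    simp only [List.mem_toFinset, List.mem_cons, List.not_mem_nil, or_false] at hs
    rcases hs with rfl | rfl | rfl | rfl | rfl | rfl <;>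
      repeat (first | assumption | apply hlF | apply hmF)
  · intro hF
    by_contra hne
    have hnd' : (m (l (m t)) :: [t, l t, m t, m (l t), l (m t), l (m (l t))]).Nodup := by
      refine List.nodup_cons.2 ⟨?_, hnd⟩
      simp only [List.mem_cons, List.not_mem_nil, or_false, not_or]
      have h1 := fun t => hl t
      have h2 := fun t => hm t
      refine ⟨?_, ?_, ?_, ?_, ?_, ?_⟩ <;> grind
    have : 7 ≤ F.card := by
      rw [show 7 = (m (l (m t)) :: [t, l t, m t, m (l t), l (m t), l (m (l t))]).length from rfl,
        ← List.toFinset_card_of_nodup hnd']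
      apply Finset.card_le_card
      intro s hs
      simp only [List.mem_toFinset, List.mem_cons, List.not_mem_nil, or_false] at hs
      rcases hs with rfl | rfl | rfl | rfl | rfl | rfl | rfl <;>
      repeat (first | assumption | apply hlF | apply hmF)
    omega

/-- The orbit is a path starting at a fixed point of `l`; when it has only three points, its other
end must be fixed by `m`, which gives the braid relation on the whole path. -/
theorem three_le_card_of_involutive (hl : Function.Involutive l) (hm : Function.Involutive m)
    (hlF : ∀ t ∈ F, l t ∈ F) (hmF : ∀ t ∈ F, m t ∈ F) {e : T} (he : e ∈ F)
    (h1 : l e = e) (h2 : m e ≠ e) (h3 : l (m e) ≠ m e) :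
    3 ≤ F.card ∧ (F.card ≤ 3 → ∀ t ∈ F, l (m (l t)) = m (l (m t))) := by
  classical
  have h4 : l (m e) ≠ e := fun h => h2 (hl.injective (h.trans h1.symm))
  have hnd : [e, m e, l (m e)].Nodup := by
    simp [h2.symm, h3.symm, h4.symm]
  have hsub : [e, m e, l (m e)].toFinset ⊆ F := by
    intro s hs
    simp only [List.mem_toFinset, List.mem_cons, List.not_mem_nil, or_false] at hs
    rcases hs with rfl | rfl | rfl <;>
      repeat (first | assumption | apply hlF | apply hmF)
  have hcard : [e, m e, l (m e)].toFinset.card = 3 := List.toFinset_card_of_nodup hnd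
  refine ⟨hcard ▸ Finset.card_le_card hsub, fun hF t ht => ?_⟩
  have hFe := Finset.eq_of_subset_of_card_le hsub (hcard ▸ hF)
  have hu : m (l (m e)) = l (m e) := by
    have : m (l (m e)) ∈ F := hmF _ (hlF _ (hmF _ he))
    rw [← hFe] at this
    simp only [List.mem_toFinset, List.mem_cons, List.not_mem_nil, or_false] at this
    rcases this with h | h | h
    · exact absurd (hm.injective (h.trans (hm e).symm)) h3
    · exact absurd (hm.injective h) h4
    · exact h
  rw [← hFe] at ht
  simp only [List.mem_toFinset, List.mem_cons, List.not_mem_nil, or_false] at ht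
  rcases ht with rfl | rfl | rfl
  · rw [h1, hu]
  · rw [hu, hl, hm, h1]
  · rw [hl, hm, h1, hu, hl, hm]

end Involutions

namespace IsTripleStraightening

variable [LinearOrder X] {r : X × X → X × X} {nf : X × X × X → X × X × X}

/-- The class of an ordered triple has at least as many elements as the triple has rearrangements,
namely one, three or six, and equality forces the braid relation on the class. Rearrangements of
ordered triples cover $X^3$ while the classes partition it, so equality holds for every class. -/
theorem isBraided (h : IsTripleStraightening r nf) [Finite X] : IsBraided r := by
  classical
  have := Fintype.ofFinite X
  have hnd := h.isNondegenerate
  have hL : ∀ x y, (r (x, y)).1 = x → x = y := fun x y hxy => by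
    by_contra hne
    exact h.fst_ne hne hxy
  have hR : ∀ x y, (r (x, y)).2 = y → x = y := fun x y hxy => h.eq_of_snd_eq _ _ hxy
  have hl := actLeft_involutive h.inv
  have hm := actRight_involutive h.inv
  let F : X × X × X → Finset (X × X × X) := fun e => Finset.univ.filter fun t => nf t = e
  have hmem : ∀ {e t}, t ∈ F e ↔ nf t = e := by simp [F]
  have hlF : ∀ e, ∀ t ∈ F e, actLeft r t ∈ F e := fun e t ht => by
    rwa [hmem, h.nf_actLeft, ← hmem]
  have hmF : ∀ e, ∀ t ∈ F e, actRight r t ∈ F e := fun e t ht => by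
    rwa [hmem, h.nf_actRight, ← hmem]
  let perms : X × X × X → Finset (X × X × X) := fun e =>
    {(e.1, e.2.1, e.2.2), (e.1, e.2.2, e.2.1), (e.2.1, e.1, e.2.2), (e.2.1, e.2.2, e.1),
      (e.2.2, e.1, e.2.1), (e.2.2, e.2.1, e.1)}
  have hl' : ∀ t : X × X × X, actLeft r t = t → t.1 = t.2.1 := fun t ht =>
    hL _ _ (Prod.ext_iff.1 ht).1
  have hm' : ∀ t : X × X × X, actRight r t = t → t.2.1 = t.2.2 := fun t ht =>
    hL _ _ (Prod.ext_iff.1 (Prod.ext_iff.1 ht).2).1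
  -- the four kinds of ordered words
  have key : ∀ e : X × X × X, e.1 ≤ e.2.1 → e.2.1 ≤ e.2.2 → (perms e).card ≤ (F e).card ∧
      ((F e).card ≤ (perms e).card → ∀ t ∈ F e, actLeft r (actRight r (actLeft r t)) =
        actRight r (actLeft r (actRight r t))) := by
    rintro ⟨a, b, c⟩ hab hbc
    have he : (a, b, c) ∈ F (a, b, c) := hmem.2 (h.nf_self _ hab hbc)
    simp only at hab hbc
    rcases hab.eq_or_lt with rfl | hab <;> rcases hbc.eq_or_lt with rfl | hbc
    · have hp : (perms (a, a, a)).card = 1 := by simp [perms]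
      rw [hp]
      refine ⟨Finset.card_pos.2 ⟨_, he⟩, fun h1 t ht => ?_⟩
      exact Finset.card_le_one.1 h1 _ (hlF _ _ (hmF _ _ (hlF _ _ ht))) _
        (hmF _ _ (hlF _ _ (hmF _ _ ht)))
    · have hp : (perms (a, a, c)).card ≤ 3 := by
        refine (Finset.card_le_card (t := {(a, a, c), (a, c, a), (c, a, a)}) ?_).trans
          Finset.card_le_three
        intro s hs
        simp only [perms, Finset.mem_insert, Finset.mem_singleton] at hs ⊢
        tauto
      obtain ⟨h1, h2⟩ := three_le_card_of_involutive hl hm (hlF _) (hmF _) he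
        (by simp [actLeft, h.sqfree a]) (fun h3 => hbc.ne (hm' _ h3))
        (fun h3 => h.fst_ne hbc.ne (hl' _ h3).symm)
      exact ⟨hp.trans h1, fun h3 => h2 (h3.trans hp)⟩
    · have hp : (perms (a, b, b)).card ≤ 3 := by
        refine (Finset.card_le_card (t := {(a, b, b), (b, a, b), (b, b, a)}) ?_).trans
          Finset.card_le_three
        intro s hs
        simp only [perms, Finset.mem_insert, Finset.mem_singleton] at hs ⊢
        tauto
      obtain ⟨h1, h2⟩ := three_le_card_of_involutive hm hl (hmF _) (hlF _) he
        (by simp [actRight, h.sqfree b]) (fun h3 => hab.ne (hl' _ h3))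
        (fun h3 => hab.ne (hR _ _ (hm' _ h3)))
      exact ⟨hp.trans h1, fun h3 t ht => (h2 (h3.trans hp) t ht).symm⟩
    · have hp : (perms (a, b, c)).card ≤ 6 := Finset.card_le_six
      have hno : ∀ t ∈ F (a, b, c), t.1 ≠ t.2.1 ∧ t.2.1 ≠ t.2.2 := by
        intro t ht
        rcases h.isAscRep_or_of_isAscRep_nf t with h1 | h1 | h1
        · rw [hmem.1 ht] at h1
          rcases h1 with h1 | h1
          · exact absurd h1.1 hab.ne
          · exact absurd h1.2 hbc.ne
        · have h2 := h.nf_self t h1.1.le h1.2.le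
          rw [hmem.1 ht] at h2
          rw [← h2] at h1
          exact absurd h1.1 hab.ne
        · exact h1
      have := fun t ht => six_le_card_of_involutive (t := t) hl hm (hlF _) (hmF _)
        (fun t ht h1 => (hno t ht).1 (hl' t h1)) (fun t ht h1 => (hno t ht).2 (hm' t h1))
        (fun t ht h1 => (hno t ht).1 (hL _ _ (Prod.ext_iff.1 h1).1))
        (fun t ht h1 => (hno t ht).1 (hR _ _ ((hnd.2 t.2.2).1
          (Prod.ext_iff.1 (Prod.ext_iff.1 h1).2).2).symm)) ht
      exact ⟨hp.trans (this _ he).1, fun h3 t ht => (this t ht).2 (h3.trans hp)⟩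
  let O : Finset (X × X × X) := Finset.univ.filter fun e => e.1 ≤ e.2.1 ∧ e.2.1 ≤ e.2.2
  have h1 : (Finset.univ : Finset (X × X × X)).card = ∑ e ∈ O, (F e).card :=
    Finset.card_eq_sum_card_fiberwise (f := nf) fun t _ => by
      simp [O, h.nf_le_left, h.nf_le_right]
  have h2 : (Finset.univ : Finset (X × X × X)) ⊆ O.biUnion perms := by
    rintro ⟨x, y, z⟩ -
    simp only [Finset.mem_biUnion, O, Finset.mem_filter, Finset.mem_univ, true_and, perms,
      Finset.mem_insert, Finset.mem_singleton]
    rcases le_total x y with hxy | hxy <;> rcases le_total y z with hyz | hyz <;>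
      rcases le_total x z with hxz | hxz
    · exact ⟨(x, y, z), ⟨hxy, hyz⟩, by simp⟩
    · exact ⟨(x, y, z), ⟨hxy, hyz⟩, by simp⟩
    · exact ⟨(x, z, y), ⟨hxz, hyz⟩, by simp⟩
    · exact ⟨(z, x, y), ⟨hxz, hxy⟩, by simp⟩
    · exact ⟨(y, x, z), ⟨hxy, hxz⟩, by simp⟩
    · exact ⟨(y, z, x), ⟨hyz, hxz⟩, by simp⟩
    · exact ⟨(z, y, x), ⟨hyz, hxy⟩, by simp⟩
    · exact ⟨(z, y, x), ⟨hyz, hxy⟩, by simp⟩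
  have h3 : ∀ e ∈ O, (perms e).card ≤ (F e).card := fun e he => by
    simp only [O, Finset.mem_filter, Finset.mem_univ, true_and] at he
    exact (key e he.1 he.2).1
  have h4 : ∑ e ∈ O, (perms e).card = ∑ e ∈ O, (F e).card := by
    refine le_antisymm (Finset.sum_le_sum h3) ?_
    rw [← h1]
    exact (Finset.card_le_card h2).trans Finset.card_biUnion_le
  have h5 := (Finset.sum_eq_sum_iff_of_le h3).1 h4
  rw [isBraided_iff]
  intro x y z
  refine (key (nf (x, y, z)) (h.nf_le_left _) (h.nf_le_right _)).2 (h5 _ ?_).ge _ (hmem.2 rfl)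
  simp [O, h.nf_le_left, h.nf_le_right]

end IsTripleStraightening

theorem IsStraightening.isNondegenerate_and_isBraided [LinearOrder X] [Finite X]
    {r : X × X → X × X} (hinv : Function.Involutive r) (hsf : IsSquareFree r)
    (h : IsStraightening r) : IsNondegenerate r ∧ IsBraided r := by
  obtain ⟨nf, hnf⟩ := h.exists_isTripleStraightening hinv hsf
  exact ⟨hnf.isNondegenerate, hnf.isBraided⟩

end SetTheoreticYBE

namespace SetTheoreticYBE

/-! ### Burnside's theorem on conjugacy classes of prime power size -/

section Burnside

open Polynomial

theorem eq_of_re_mul_eq_one {c z : ℂ} (hc : ‖c‖ = 1) (hz : ‖z‖ = 1)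
    (h : ((starRingEnd ℂ) c * z).re = 1) : z = c := by
  have h1 : c.re * c.re + c.im * c.im = 1 := by
    rw [← Complex.normSq_apply, Complex.normSq_eq_norm_sq, hc, one_pow]
  have h2 : z.re * z.re + z.im * z.im = 1 := by
    rw [← Complex.normSq_apply, Complex.normSq_eq_norm_sq, hz, one_pow]
  simp only [Complex.mul_re, Complex.conj_re, Complex.conj_im] at h
  have h3 : (z.re - c.re) ^ 2 + (z.im - c.im) ^ 2 = 0 := by ring_nf; linarith
  have h4 : (z.re - c.re) ^ 2 = 0 := by nlinarith [sq_nonneg (z.re - c.re), sq_nonneg (z.im - c.im)]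
  have h5 : (z.im - c.im) ^ 2 = 0 := by nlinarith [sq_nonneg (z.re - c.re), sq_nonneg (z.im - c.im)]
  exact Complex.ext (sub_eq_zero.1 (pow_eq_zero_iff (two_ne_zero) |>.1 h4))
    (sub_eq_zero.1 (pow_eq_zero_iff (two_ne_zero) |>.1 h5))

theorem norm_sum_le_card {s : Multiset ℂ} (hs : ∀ z ∈ s, ‖z‖ = 1) : ‖s.sum‖ ≤ s.card := by
  refine (norm_multiset_sum_le s).trans (le_of_eq ?_)
  rw [Multiset.map_congr rfl hs]
  simp

/-- The mean of the roots of unity, if nonzero, is an algebraic integer all of whose conjugates have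
norm at most one. By Kronecker's theorem it is a root of unity, and equality in the triangle
inequality makes all terms equal. -/
theorem sum_eq_zero_or_forall_eq_of_isCyclotomicExtension {s : Multiset ℂ} {m : ℕ} (hm : m ≠ 0)
    (K : Type*) [Field K] [NumberField K] [IsCyclotomicExtension {m} ℚ K]
    (hs : ∀ z ∈ s, z ^ m = 1)
    (hint : IsIntegral ℤ (s.sum / s.card)) : s.sum = 0 ∨ ∃ c, ∀ z ∈ s, z = c := by
  have : NeZero m := ⟨hm⟩
  by_cases hs0 : s.card = 0
  · left; rw [Multiset.card_eq_zero.1 hs0, Multiset.sum_zero]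
  have hs0' : (s.card : ℝ) ≠ 0 := by exact_mod_cast hs0
  rw [or_iff_not_imp_left]
  intro hsum
  let ι : K →+* ℂ := (IsAlgClosed.lift : K →ₐ[ℚ] ℂ).toRingHom
  have hζ := IsCyclotomicExtension.zeta_spec m ℚ K
  have hζ' : IsPrimitiveRoot (ι (IsCyclotomicExtension.zeta m ℚ K)) m :=
    hζ.map_of_injective ι.injective
  have hlift : ∀ z : ℂ, ∃ y : K, z ∈ s → ι y = z ∧ y ^ m = 1 := by
    intro z
    by_cases hz : z ∈ s
    · obtain ⟨i, -, hi⟩ := hζ'.eq_pow_of_pow_eq_one (hs z hz)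
      refine ⟨IsCyclotomicExtension.zeta m ℚ K ^ i, fun _ => ⟨by rw [map_pow, hi], ?_⟩⟩
      rw [← pow_mul, mul_comm, pow_mul, hζ.pow_eq_one, one_pow]
    · exact ⟨0, fun h => absurd h hz⟩
  choose f hf using hlift
  let α : K := (s.map f).sum / s.card
  have hα : ι α = s.sum / s.card := by
    simp only [α, map_div₀, map_natCast, map_multiset_sum, Multiset.map_map]
    rw [Multiset.map_congr rfl (g := id) (fun z hz => by simpa using (hf z hz).1),
      Multiset.map_id]
  have hαint : IsIntegral ℤ α := by
    rw [← hα] at hint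
    exact (isIntegral_algHom_iff (ι.toIntAlgHom) ι.injective).1 hint
  have hα0 : α ≠ 0 := by
    intro h0
    rw [h0, map_zero] at hα
    refine hsum ?_
    rcases div_eq_zero_iff.1 hα.symm with h | h
    · exact h
    · exact absurd (by exact_mod_cast h) hs0
  obtain ⟨n, hn, hαn⟩ := NumberField.Embeddings.pow_eq_one_of_norm_le_one K ℂ hα0 hαint (by
    intro φ
    simp only [α, map_div₀, map_natCast, map_multiset_sum, Multiset.map_map, norm_div,
      Complex.norm_natCast]
    rw [div_le_one (by exact_mod_cast Nat.pos_of_ne_zero hs0)]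
    have : (s.card : ℝ) = (s.map (φ ∘ f)).card := by simp
    rw [this]
    apply norm_sum_le_card
    intro z hz
    obtain ⟨y, hy, rfl⟩ := Multiset.mem_map.1 hz
    refine Complex.norm_eq_one_of_pow_eq_one (n := m) ?_ hm
    simp only [Function.comp_apply]
    rw [← map_pow, (hf y hy).2, map_one])
  have hc : ‖ι α‖ = 1 := Complex.norm_eq_one_of_pow_eq_one (n := n)
    (by rw [← map_pow, hαn, map_one]) hn.ne'
  refine ⟨ι α, fun z hz => ?_⟩
  have hnorm : ∀ z ∈ s, ‖z‖ = 1 := fun z hz => Complex.norm_eq_one_of_pow_eq_one (hs z hz) hm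
  let g : ℂ → ℝ := fun z => 1 - ((starRingEnd ℂ) (ι α) * z).re
  have hg : ∀ x ∈ s.map g, 0 ≤ x := by
    intro x hx
    obtain ⟨y, hy, rfl⟩ := Multiset.mem_map.1 hx
    simp only [g, sub_nonneg]
    refine (Complex.re_le_norm _).trans ?_
    rw [norm_mul, RCLike.norm_conj, hc, hnorm y hy, one_mul]
  have hgs : (s.map g).sum = 0 := by
    have h1 : (s.map fun z => ((starRingEnd ℂ) (ι α) * z).re).sum =
        ((starRingEnd ℂ) (ι α) * s.sum).re := by
      have h2 : ∀ t : Multiset ℂ, (t.map fun z => ((starRingEnd ℂ) (ι α) * z).re).sum =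
          ((starRingEnd ℂ) (ι α) * t.sum).re := by
        intro t
        induction t using Multiset.induction with
        | empty => simp
        | cons a t ih =>
          rw [Multiset.map_cons, Multiset.sum_cons, Multiset.sum_cons, ih, mul_add, Complex.add_re]
      exact h2 s
    have h3 : s.sum = s.card * ι α := by
      rw [hα]; field_simp
    simp only [g]
    rw [Multiset.sum_map_sub, h1, h3]
    have h4 : (starRingEnd ℂ) (ι α) * (s.card * ι α) = ((s.card : ℝ) : ℂ) := by
      rw [mul_left_comm, Complex.conj_mul', hc]
      simp
    rw [h4, Complex.ofReal_re]
    simp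
  have := Multiset.all_zero_of_le_zero_le_of_sum_eq_zero hg hgs (g z) (Multiset.mem_map_of_mem g hz)
  exact eq_of_re_mul_eq_one hc (hnorm z hz) (by simp only [g] at this; linarith)

theorem sum_eq_zero_or_forall_eq {s : Multiset ℂ} {m : ℕ} (hm : m ≠ 0) (hs : ∀ z ∈ s, z ^ m = 1)
    (hint : IsIntegral ℤ (s.sum / s.card)) : s.sum = 0 ∨ ∃ c, ∀ z ∈ s, z = c :=
  have : NeZero m := ⟨hm⟩
  have : IsCyclotomicExtension {m} ℚ (CyclotomicField m ℚ) := by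
    convert CyclotomicField.isCyclotomicExtension m ℚ
    · rfl
    · exact Subsingleton.elim _ _
  sum_eq_zero_or_forall_eq_of_isCyclotomicExtension hm (CyclotomicField m ℚ) hs hint

section Matrix

variable {d m : ℕ} {A : Matrix (Fin d) (Fin d) ℂ}

theorem pow_eq_one_of_mem_roots_charpoly (hA : A ^ m = 1) {z : ℂ} (hz : z ∈ A.charpoly.roots) :
    z ^ m = 1 := by
  have h1 : A.charpoly.IsRoot z := isRoot_of_mem_roots hz
  rw [← Matrix.mem_spectrum_iff_isRoot_charpoly] at h1
  have h2 := spectrum.pow_mem_pow A m h1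
  rw [hA] at h2
  have : Nontrivial (Matrix (Fin d) (Fin d) ℂ) := by
    by_contra hcon
    rw [not_nontrivial_iff_subsingleton] at hcon
    rw [spectrum.of_subsingleton] at h2
    exact h2
  rw [spectrum.one_eq] at h2
  exact h2

theorem card_roots_charpoly (A : Matrix (Fin d) (Fin d) ℂ) : A.charpoly.roots.card = d := by
  rw [← (IsAlgClosed.splits A.charpoly).natDegree_eq_card_roots, Matrix.charpoly_natDegree_eq_dim,
    Fintype.card_fin]

theorem isIntegral_trace_of_pow_eq_one (hm : m ≠ 0) (hA : A ^ m = 1) : IsIntegral ℤ A.trace := by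
  rw [Matrix.trace_eq_sum_roots_charpoly]
  refine IsIntegral.multiset_sum fun z hz => ?_
  exact IsIntegral.of_pow (Nat.pos_of_ne_zero hm)
    (by rw [pow_eq_one_of_mem_roots_charpoly hA hz]; exact isIntegral_one)

/-- The trace divided by $d$ is the mean of the eigenvalues, which are roots of unity. If they all
coincide then $A$ is scalar, because its minimal polynomial divides the squarefree $X^m-1$. -/
theorem trace_eq_zero_or_eq_smul_one (hm : m ≠ 0) (hA : A ^ m = 1)
    (hint : IsIntegral ℤ (A.trace / d)) : A.trace = 0 ∨ ∃ c : ℂ, A = c • 1 := by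
  have hcard := card_roots_charpoly A
  rw [Matrix.trace_eq_sum_roots_charpoly] at hint ⊢
  rcases sum_eq_zero_or_forall_eq hm (fun z hz => pow_eq_one_of_mem_roots_charpoly hA hz)
    (by rwa [hcard]) with h | ⟨c, hc⟩
  · exact Or.inl h
  · right
    refine ⟨c, ?_⟩
    have h1 : A.charpoly = (X - C c) ^ d := by
      rw [(IsAlgClosed.splits A.charpoly).eq_prod_roots_of_monic A.charpoly_monic,
        Multiset.map_congr (g := fun _ => X - C c) rfl (fun z hz => by rw [hc z hz]),
        Multiset.map_const',
        Multiset.prod_replicate, hcard]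
    have h2 : minpoly ℂ A ∣ (X - C c) ^ d := by
      rw [← h1]; exact minpoly.dvd _ _ (Matrix.aeval_self_charpoly A)
    have h3 : minpoly ℂ A ∣ X ^ m - 1 := minpoly.dvd _ _ (by simp [hA])
    have h4 : Squarefree (minpoly ℂ A) :=
      ((X_pow_sub_one_separable_iff.2 (by exact_mod_cast hm)).squarefree).squarefree_of_dvd h3
    have hp : Prime (X - C c) := prime_X_sub_C c
    obtain ⟨k, -, hk⟩ := (dvd_prime_pow hp d).1 h2
    have h5 : minpoly ℂ A ∣ X - C c := by
      have h6 : k ≤ 1 := by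
        by_contra hk1
        have h7 : (X - C c) * (X - C c) ∣ minpoly ℂ A := by
          refine Dvd.dvd.trans ?_ hk.symm.dvd
          rw [← pow_two]
          exact pow_dvd_pow _ (by omega)
        exact hp.not_isUnit (h4 _ h7)
      refine hk.dvd.trans ?_
      calc (X - C c) ^ k ∣ (X - C c) ^ 1 := pow_dvd_pow _ h6
        _ = X - C c := pow_one _
    have h8 : aeval A (X - C c) = 0 := (aeval_eq_zero_of_dvd_aeval_eq_zero h5 (minpoly.aeval ℂ A))
    rw [map_sub, aeval_X, aeval_C, sub_eq_zero] at h8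
    rw [h8, Algebra.algebraMap_eq_smul_one]

end Matrix

end Burnside

end SetTheoreticYBE

namespace SetTheoreticYBE

/-! ### Characters of a finite group and Burnside's theorem -/

section Burnside

variable {G : Type*} [Group G] {d : ℕ}

/-- The conjugacy class of `g`. -/
noncomputable def conjFinset [Fintype G] (g : G) : Finset G := by
  classical exact Finset.univ.filter fun h => IsConj g h

theorem mem_conjFinset [Fintype G] {g h : G} : h ∈ conjFinset g ↔ IsConj g h := by
  classical simp [conjFinset]

theorem card_conjFinset [Fintype G] (g : G) :
    (conjFinset g).card = (Subgroup.centralizer {g}).index := by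
  have h1 := MulAction.index_stabilizer (ConjAct G) g
  have h2 : (MulAction.orbit (ConjAct G) g) = (conjFinset g : Set G) := by
    ext h
    rw [ConjAct.mem_orbit_conjAct, Finset.mem_coe, mem_conjFinset, isConj_comm]
  rw [h2, Set.ncard_coe_finset] at h1
  rw [← h1]
  have h3 := Subgroup.nat_card_centralizer_nat_card_stabilizer g
  have h4 := (Subgroup.centralizer {g}).card_mul_index
  have h5 := (MulAction.stabilizer (ConjAct G) g).card_mul_index
  have h6 : Nat.card (ConjAct G) = Nat.card G := Nat.card_congr ConjAct.ofConjAct.toEquiv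
  rw [h6, ← h4, ← h3] at h5
  exact Nat.eq_of_mul_eq_mul_left Nat.card_pos h5

theorem conj_conjFinset [Fintype G] {M : Type*} [AddCommMonoid M] (f : G → M) (g h : G) :
    ∑ x ∈ conjFinset g, f (h * x * h⁻¹) = ∑ x ∈ conjFinset g, f x := by
  refine Finset.sum_nbij' (fun x => h * x * h⁻¹) (fun x => h⁻¹ * x * h) ?_ ?_ ?_ ?_ ?_
  · intro x hx
    rw [mem_conjFinset] at hx ⊢
    exact hx.trans (isConj_iff.2 ⟨h, rfl⟩)
  · intro x hx
    rw [mem_conjFinset] at hx ⊢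
    exact hx.trans (isConj_iff.2 ⟨h⁻¹, by simp⟩)
  · intro x _; group
  · intro x _; group
  · intro x _; rfl

/-- Schur's lemma, with irreducibility expressed as the image spanning the full matrix algebra. -/
theorem exists_eq_smul_one_of_commute {ρ : G →* Matrix (Fin d) (Fin d) ℂ}
    (hρ : Submodule.span ℂ (Set.range ρ) = ⊤) {A : Matrix (Fin d) (Fin d) ℂ}
    (hA : ∀ h, Commute (ρ h) A) : ∃ c : ℂ, A = c • 1 := by
  have h1 : ∀ B : Matrix (Fin d) (Fin d) ℂ, Commute B A := by
    intro B
    have hB : B ∈ Submodule.span ℂ (Set.range ρ) := hρ ▸ Submodule.mem_top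
    induction hB using Submodule.span_induction with
    | mem x hx => obtain ⟨h, rfl⟩ := hx; exact hA h
    | zero => exact Commute.zero_left _
    | add x y _ _ hx hy => exact hx.add_left hy
    | smul c x _ hx => exact hx.smul_left c
  obtain ⟨c, hc⟩ := Matrix.mem_range_scalar_iff_commute_single'.2 fun i j => h1 (Matrix.single i j 1)
  refine ⟨c, ?_⟩
  rw [← hc, Matrix.scalar_apply, Matrix.smul_one_eq_diagonal]

/-- The class sum acts as a scalar by Schur's lemma, and its trace identifies that scalar. It is
integral because $\mathbb Z[G]$ is a finite $\mathbb Z$-module. -/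
theorem isIntegral_sum_conjFinset [Fintype G] [NeZero d] {ρ : G →* Matrix (Fin d) (Fin d) ℂ}
    (hρ : Submodule.span ℂ (Set.range ρ) = ⊤) (g : G) :
    IsIntegral ℤ (((conjFinset g).card : ℂ) * ((ρ g).trace / d)) := by
  have hd : (d : ℂ) ≠ 0 := by exact_mod_cast NeZero.ne d
  set A := ∑ x ∈ conjFinset g, ρ x with hA
  have hcomm : ∀ h, Commute (ρ h) A := by
    intro h
    have h1 := conj_conjFinset ρ g h
    rw [Commute, SemiconjBy, hA]
    conv_rhs => rw [← h1]
    rw [Finset.mul_sum, Finset.sum_mul]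
    refine Finset.sum_congr rfl fun x _ => ?_
    rw [← map_mul, ← map_mul]
    congr 1
    group
  obtain ⟨c, hc⟩ := exists_eq_smul_one_of_commute hρ hcomm
  have htr : A.trace = (conjFinset g).card * (ρ g).trace := by
    rw [hA, Matrix.trace_sum, Finset.sum_congr rfl (g := fun _ => (ρ g).trace), Finset.sum_const,
      nsmul_eq_mul]
    intro x hx
    obtain ⟨h, rfl⟩ := isConj_iff.1 (mem_conjFinset.1 hx)
    rw [map_mul, Matrix.trace_mul_comm, ← map_mul]
    congr 2
    group
  have hc' : c = (conjFinset g).card * ((ρ g).trace / d) := by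
    rw [← mul_div_assoc, ← htr, hc, Matrix.trace_smul, Matrix.trace_one, Fintype.card_fin,
      smul_eq_mul, mul_div_assoc, div_self hd, mul_one]
  rw [← hc']
  let ψ : MonoidAlgebra ℤ G →ₐ[ℤ] Matrix (Fin d) (Fin d) ℂ := MonoidAlgebra.lift ℤ _ G ρ
  have hz : IsIntegral ℤ (∑ x ∈ conjFinset g, MonoidAlgebra.of ℤ G x) :=
    (Algebra.IsIntegral.of_finite ℤ (MonoidAlgebra ℤ G)).isIntegral _
  have hA' : IsIntegral ℤ A := by
    have := hz.map ψ
    rw [map_sum] at this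
    simpa [ψ] using this
  rw [hc, ← Algebra.algebraMap_eq_smul_one] at hA'
  exact (isIntegral_algebraMap_iff (FaithfulSMul.algebraMap_injective ℂ _)).1 hA'

/-- A Bézout combination of $\chi(g)$ and $|K|\chi(g)/d$, with $K$ the conjugacy class of $g$, shows
that $\chi(g)/d$ is itself an algebraic integer. -/
theorem trace_eq_zero_or_eq_smul_one_of_coprime [Fintype G] [NeZero d]
    {ρ : G →* Matrix (Fin d) (Fin d) ℂ} (hρ : Submodule.span ℂ (Set.range ρ) = ⊤) (g : G)
    (hcop : Nat.Coprime d (conjFinset g).card) : (ρ g).trace = 0 ∨ ∃ c : ℂ, ρ g = c • 1 := by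
  have hd : (d : ℂ) ≠ 0 := by exact_mod_cast NeZero.ne d
  have hpow : ρ g ^ Fintype.card G = 1 := by rw [← map_pow, pow_card_eq_one, map_one]
  refine trace_eq_zero_or_eq_smul_one Fintype.card_ne_zero hpow ?_
  have h1 := isIntegral_sum_conjFinset hρ g
  have h2 := isIntegral_trace_of_pow_eq_one Fintype.card_ne_zero hpow
  have h3 : (ρ g).trace / d = (Nat.gcdA d (conjFinset g).card : ℤ) * (ρ g).trace +
      (Nat.gcdB d (conjFinset g).card : ℤ) * ((conjFinset g).card * ((ρ g).trace / d)) := by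
    have h4 := Nat.gcd_eq_gcd_ab d (conjFinset g).card
    rw [hcop.gcd_eq_one] at h4
    have h5 : (1 : ℂ) = d * (Nat.gcdA d (conjFinset g).card : ℤ) +
        (conjFinset g).card * (Nat.gcdB d (conjFinset g).card : ℤ) := by exact_mod_cast h4
    calc (ρ g).trace / d = 1 * ((ρ g).trace / d) := (one_mul _).symm
      _ = _ := by rw [h5]; field_simp
  rw [h3]
  exact ((isIntegral_algebraMap (x := Nat.gcdA d (conjFinset g).card)).mul h2).add
    ((isIntegral_algebraMap (x := Nat.gcdB d (conjFinset g).card)).mul h1)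

/-- The elements with central image form a normal subgroup containing $g$, hence everything. The
image is then abelian, so the kernel is not trivial and must be the whole group. -/
theorem forall_eq_one_of_eq_smul_one [NeZero d] [IsSimpleGroup G] (hG : ∃ a b : G, a * b ≠ b * a)
    (ρ : G →* Matrix (Fin d) (Fin d) ℂ) {g : G} (hg : g ≠ 1) (hρg : ∃ c : ℂ, ρ g = c • 1)
    (h : G) : ρ h = 1 := by
  have hcomm : ∀ x y : G, ρ (x * y) = ρ (y * x) := by
    let N : Subgroup G := (Subgroup.center ρ.toHomUnits.range).comap
      ρ.toHomUnits.rangeRestrict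
    have hN : N.Normal := Subgroup.Normal.comap inferInstance _
    have hmem : ∀ x, x ∈ N ↔ ∀ y, ρ (x * y) = ρ (y * x) := by
      intro x
      rw [Subgroup.mem_comap, Subgroup.mem_center_iff]
      constructor
      · intro h y
        have := congrArg (fun z : ρ.toHomUnits.range => ((z : (Matrix (Fin d) (Fin d) ℂ)ˣ) :
          Matrix (Fin d) (Fin d) ℂ)) (h (ρ.toHomUnits.rangeRestrict y))
        simpa [← map_mul] using this.symm
      · rintro h ⟨_, y, rfl⟩
        apply Subtype.ext
        apply Units.ext
        have := h y
        rw [map_mul, map_mul] at this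
        exact this.symm
    have hgN : g ∈ N := by
      rw [hmem]
      obtain ⟨c, hc⟩ := hρg
      intro y
      rw [map_mul, map_mul, hc, smul_mul_assoc, one_mul, mul_smul_comm, mul_one]
    rcases hN.eq_bot_or_eq_top with h1 | h1
    · rw [h1, Subgroup.mem_bot] at hgN
      exact absurd hgN hg
    · intro x y
      exact (hmem x).1 (h1 ▸ Subgroup.mem_top x) y
  rcases ρ.normal_ker.eq_bot_or_eq_top with h1 | h1
  · obtain ⟨a, b, hab⟩ := hG
    exact absurd (ρ.ker_eq_bot_iff.1 h1 (hcomm a b)) hab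
  · exact ρ.mem_ker.1 (h1 ▸ Subgroup.mem_top h)

/-- The regular representation decomposes into irreducible ones. -/
theorem exists_irreducible_family [Fintype G] : ∃ (n : ℕ) (d : Fin n → ℕ)
    (_ : ∀ i, NeZero (d i)) (ρ : ∀ i, G →* Matrix (Fin (d i)) (Fin (d i)) ℂ),
    (∀ i, Submodule.span ℂ (Set.range (ρ i)) = ⊤) ∧
    (∀ g : G, g ≠ 1 → ∑ i, (d i : ℂ) * (ρ i g).trace = 0) ∧
    ∃ i, (∀ h, ρ i h = 1) ∧ ∀ j, (∀ h, ρ j h = 1) → j = i := by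
  classical
  obtain ⟨n, d, hd, ⟨φ⟩⟩ :=
    IsSemisimpleRing.exists_algEquiv_pi_matrix_of_isAlgClosed ℂ (MonoidAlgebra ℂ G)
  let π : ∀ i, (Π i, Matrix (Fin (d i)) (Fin (d i)) ℂ) →ₐ[ℂ] Matrix (Fin (d i)) (Fin (d i)) ℂ :=
    fun i => Pi.evalAlgHom ℂ _ i
  let ρ : ∀ i, G →* Matrix (Fin (d i)) (Fin (d i)) ℂ := fun i =>
    ((π i).comp φ.toAlgHom : _ →* _).comp (MonoidAlgebra.of ℂ G)
  have hρ : ∀ i h, ρ i h = φ (MonoidAlgebra.of ℂ G h) i := fun i h => rfl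
  have hofspan : Submodule.span ℂ (Set.range (MonoidAlgebra.of ℂ G)) = ⊤ := by
    have := (MonoidAlgebra.basis G ℂ).span_eq
    convert this using 2
    exact congrArg Set.range (funext fun h => rfl)
  have hspan : ∀ i, Submodule.span ℂ (Set.range (ρ i)) = ⊤ := by
    intro i
    have h1 : Set.range (ρ i) = ((π i).comp φ.toAlgHom).toLinearMap ''
        Set.range (MonoidAlgebra.of ℂ G) := by
      rw [← Set.range_comp]; rfl
    rw [h1, ← Submodule.map_span, hofspan, Submodule.map_top, LinearMap.range_eq_top]
    exact (Function.surjective_eval i).comp φ.surjective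
  refine ⟨n, d, hd, ρ, hspan, ?_, ?_⟩
  · intro g hg
    -- The trace of left multiplication by $g$ is computed twice: in the basis of group elements it
    -- vanishes since $gh\ne h$, and in the basis of matrix units each block contributes
    -- $d_i\chi_i(g)$.
    let b := (Pi.basis fun i => Matrix.stdBasis ℂ (Fin (d i)) (Fin (d i))).map
      φ.symm.toLinearEquiv
    have h1 := LinearMap.trace_eq_matrix_trace ℂ (MonoidAlgebra.basis G ℂ)
      (LinearMap.mulLeft ℂ (MonoidAlgebra.of ℂ G g))
    have h2 := LinearMap.trace_eq_matrix_trace ℂ b (LinearMap.mulLeft ℂ (MonoidAlgebra.of ℂ G g))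
    rw [h1] at h2
    have h3 : (LinearMap.toMatrix (MonoidAlgebra.basis G ℂ) (MonoidAlgebra.basis G ℂ)
        (LinearMap.mulLeft ℂ (MonoidAlgebra.of ℂ G g))).trace = 0 := by
      rw [Matrix.trace]
      refine Finset.sum_eq_zero fun h _ => ?_
      rw [Matrix.diag_apply, LinearMap.toMatrix_apply]
      simp [MonoidAlgebra.basis, MonoidAlgebra.single_mul_single, hg]
    rw [h3] at h2
    rw [h2, Matrix.trace, Fintype.sum_sigma]
    refine Finset.sum_congr rfl fun i _ => ?_
    have h4 : ∀ p : Fin (d i) × Fin (d i), (LinearMap.toMatrix b b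
        (LinearMap.mulLeft ℂ (MonoidAlgebra.of ℂ G g))).diag ⟨i, p⟩ = ρ i g p.1 p.1 := by
      rintro ⟨j, k⟩
      rw [Matrix.diag_apply, LinearMap.toMatrix_apply]
      simp only [b, Module.Basis.map_repr, LinearEquiv.trans_apply, Module.Basis.map_apply,
        LinearMap.mulLeft_apply]
      have h5 : ∀ (a : MonoidAlgebra ℂ G) c,
          (φ.symm.toLinearEquiv.symm (a * φ.symm.toLinearEquiv c)) = φ a * c := by
        intro a c
        change φ (a * φ.symm c) = _
        rw [map_mul, φ.apply_symm_apply]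
      rw [h5, Pi.basis_repr, Pi.basis_apply]
      simp only [Pi.mul_apply, Pi.single_eq_same, Matrix.stdBasis_eq_single]
      rw [← hρ]
      change ((ρ i g * Matrix.single j k 1 : Matrix (Fin (d i)) (Fin (d i)) ℂ)) j k = _
      simp
    rw [Finset.sum_congr rfl fun p _ => h4 p, Fintype.sum_prod_type]
    simp [Matrix.trace, Finset.mul_sum]
  -- The sum of all group elements is nonzero and absorbs every group element, so a block in which
  -- its image is nonzero carries the trivial representation.
  · have he : φ (∑ h : G, MonoidAlgebra.of ℂ G h) ≠ 0 := by
      rw [Ne, map_eq_zero_iff φ φ.injective]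
      intro h0
      have := congrArg (fun a : MonoidAlgebra ℂ G => a.coeff 1) h0
      simp at this
    obtain ⟨i, hi⟩ := Function.ne_iff.1 he
    have hsum : ∑ h : G, ρ i h ≠ 0 := by
      rw [map_sum, Finset.sum_apply] at hi
      exact hi
    have hmul : ∀ h, ρ i h * ∑ x : G, ρ i x = ∑ x : G, ρ i x := by
      intro h
      rw [Finset.mul_sum]
      simp only [← map_mul]
      exact Equiv.sum_comp (Equiv.mulLeft h) (fun x => ρ i x)
    have hmul' : ∀ h, (∑ x : G, ρ i x) * ρ i h = ∑ x : G, ρ i x := by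
      intro h
      rw [Finset.sum_mul]
      simp only [← map_mul]
      exact Equiv.sum_comp (Equiv.mulRight h) (fun x => ρ i x)
    obtain ⟨c, hc⟩ := exists_eq_smul_one_of_commute (hspan i)
      (A := ∑ x : G, ρ i x) (fun h => (hmul h).trans (hmul' h).symm)
    have hc0 : c ≠ 0 := by
      rintro rfl
      rw [zero_smul] at hc
      exact hsum hc
    refine ⟨i, fun h => ?_, fun j hj => ?_⟩
    · have := hmul h
      rw [hc, mul_smul_comm, mul_one] at this
      exact smul_right_injective _ hc0 this
    · have hi1 : ∀ h, ρ i h = 1 := fun h => by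
        have := hmul h
        rw [hc, mul_smul_comm, mul_one] at this
        exact smul_right_injective _ hc0 this
      by_contra hij
      -- Two trivial blocks would have equal coordinates on the whole algebra, which the element
      -- that is $1$ in block $i$ and $0$ elsewhere contradicts.
      have h1 : ∀ a : MonoidAlgebra ℂ G, ∃ c : ℂ, φ a i = c • 1 ∧ φ a j = c • 1 := by
        intro a
        have ha : a ∈ Submodule.span ℂ (Set.range (MonoidAlgebra.of ℂ G)) :=
          hofspan ▸ Submodule.mem_top
        induction ha using Submodule.span_induction with
        | mem x hx =>
          obtain ⟨h, rfl⟩ := hx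
          exact ⟨1, by rw [← hρ, hi1, one_smul], by rw [← hρ, hj, one_smul]⟩
        | zero => exact ⟨0, by simp, by simp⟩
        | add x y _ _ hx hy =>
          obtain ⟨c, h1, h2⟩ := hx
          obtain ⟨c', h1', h2'⟩ := hy
          exact ⟨c + c', by rw [map_add, Pi.add_apply, h1, h1', add_smul],
            by rw [map_add, Pi.add_apply, h2, h2', add_smul]⟩
        | smul c x _ hx =>
          obtain ⟨c', h1, h2⟩ := hx
          exact ⟨c * c', by rw [map_smul, Pi.smul_apply, h1, smul_smul],
            by rw [map_smul, Pi.smul_apply, h2, smul_smul]⟩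
      obtain ⟨c, h2, h3⟩ := h1 (φ.symm (Pi.single i 1))
      rw [φ.apply_symm_apply] at h2 h3
      rw [Pi.single_eq_same] at h2
      rw [Pi.single_eq_of_ne hij] at h3
      have := hd i
      have := hd j
      have h4 : c = 0 := by
        by_contra hc
        exact one_ne_zero ((smul_eq_zero.1 h3.symm).resolve_left hc)
      rw [h4, zero_smul] at h2
      exact one_ne_zero h2

/-- **Burnside's theorem**: a nonabelian finite simple group has no nontrivial conjugacy class of
prime power size. -/
theorem centralizer_index_ne_prime_pow [Finite G] [IsSimpleGroup G]
    (hG : ∃ a b : G, a * b ≠ b * a) {g : G} (hg : g ≠ 1) {q : ℕ} (hq : q.Prime) (b : ℕ) :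
    (Subgroup.centralizer {g}).index ≠ q ^ b := by
  classical
  have := Fintype.ofFinite G
  intro hidx
  rw [← card_conjFinset] at hidx
  obtain ⟨n, d, hd, ρ, hspan, hsum, i, hi, hi'⟩ := exists_irreducible_family (G := G)
  have hdi : d i = 1 := by
    have hmem : ∀ A : Matrix (Fin (d i)) (Fin (d i)) ℂ, ∃ c : ℂ, A = c • 1 := fun A =>
      exists_eq_smul_one_of_commute (hspan i) (A := A) fun h => by
        rw [hi h]; exact Commute.one_left _
    have := hd i
    by_contra hne
    have h2 : 1 < d i := by have := NeZero.ne (d i); omega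
    obtain ⟨c, hc⟩ := hmem (Matrix.single ⟨0, by omega⟩ ⟨1, h2⟩ 1)
    have := congrFun (congrFun hc ⟨0, by omega⟩) ⟨1, h2⟩
    simp at this
  -- Either $q$ divides the degree, or the degree is coprime to the class size and the character
  -- vanishes at $g$, the scalar case being excluded by nontriviality.
  have hterm : ∀ j, j ≠ i → ∃ β : ℂ, IsIntegral ℤ β ∧ (d j : ℂ) * (ρ j g).trace = q * β := by
    intro j hj
    have := hd j
    by_cases hqd : q ∣ d j
    · obtain ⟨e, he⟩ := hqd
      have he' : (d j : ℂ) = q * e := by exact_mod_cast he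
      refine ⟨e * (ρ j g).trace, ?_, by rw [he', mul_assoc]⟩
      exact (isIntegral_algebraMap (x := (e : ℤ))).mul (isIntegral_trace_of_pow_eq_one
        (m := Fintype.card G) Fintype.card_ne_zero (by rw [← map_pow, pow_card_eq_one, map_one]))
    · refine ⟨0, isIntegral_zero, ?_⟩
      have hcop : Nat.Coprime (d j) (conjFinset g).card := by
        rw [hidx]
        exact (Nat.Coprime.pow_left b ((Nat.Prime.coprime_iff_not_dvd hq).2 hqd)).symm
      rcases trace_eq_zero_or_eq_smul_one_of_coprime (hspan j) g hcop with h1 | h1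
      · rw [h1]; simp
      · exact absurd (hi' j (forall_eq_one_of_eq_smul_one hG (ρ j) hg h1)) hj
  choose! β hβ hβ' using hterm
  have h1 := hsum g hg
  rw [← Finset.add_sum_erase _ _ (Finset.mem_univ i), hi g, Matrix.trace_one, Fintype.card_fin, hdi,
    Finset.sum_congr rfl (fun j hj => hβ' j (Finset.ne_of_mem_erase hj)), ← Finset.mul_sum] at h1
  have h2 : IsIntegral ℤ (∑ j ∈ Finset.univ.erase i, β j) :=
    IsIntegral.sum _ fun j hj => hβ j (Finset.ne_of_mem_erase hj)
  have hq0 : (q : ℂ) ≠ 0 := by exact_mod_cast hq.ne_zero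
  -- The relation $1+q\sum_j\beta_j=0$ makes $-1/q$ an algebraic integer.
  have h3 : ∑ j ∈ Finset.univ.erase i, β j = ((-(1 / q : ℚ) : ℚ) : ℂ) := by
    push_cast
    field_simp
    push_cast at h1
    linear_combination h1
  rw [h3] at h2
  have h4 : IsIntegral ℤ (-(1 / q : ℚ)) :=
    (isIntegral_algebraMap_iff (algebraMap ℚ ℂ).injective).1 h2
  obtain ⟨z, hz⟩ := IsIntegrallyClosed.isIntegral_iff.1 h4
  have h5 : ((z * q : ℤ) : ℚ) = -1 := by
    have : (q : ℚ) ≠ 0 := by exact_mod_cast hq.ne_zero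
    push_cast
    rw [show (z : ℚ) = -(1 / q : ℚ) from hz]
    field_simp
  have h6 : z * q = -1 := by exact_mod_cast h5
  have h7 : (q : ℤ) ∣ 1 := ⟨-z, by linarith⟩
  exact hq.one_lt.ne' (by exact_mod_cast Int.eq_one_of_dvd_one (by positivity) h7)

end Burnside

end SetTheoreticYBE

namespace SetTheoreticYBE

/-! ### Groups with complements of Sylow subgroups -/

section Hall

open scoped commutatorElement

variable {G : Type u} [Group G]

/-- For each prime `p` there is a subgroup of order prime to `p` and of `p`-power index. -/
def HasSylowComplements (G : Type u) [Group G] : Prop :=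
  ∀ p : ℕ, p.Prime → ∃ C : Subgroup G, ¬ p ∣ Nat.card C ∧ ∃ k, C.index = p ^ k

theorem relIndex_sup_of_normal [Finite G] (N C : Subgroup G) [N.Normal] :
    C.relIndex (C ⊔ N) = C.relIndex N := by
  have h1 := Subgroup.relIndex_mul_relIndex (C ⊓ N) C (C ⊔ N) inf_le_left le_sup_left
  have h2 := Subgroup.relIndex_mul_relIndex (C ⊓ N) N (C ⊔ N) inf_le_right le_sup_right
  rw [Subgroup.inf_relIndex_left] at h1
  rw [Subgroup.inf_relIndex_right, Subgroup.relIndex_sup_right, ← h1, mul_comm] at h2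
  exact (Nat.eq_of_mul_eq_mul_left (Nat.pos_of_ne_zero Subgroup.FiniteIndex.index_ne_zero) h2).symm

theorem relIndex_dvd_index [Finite G] (N C : Subgroup G) [N.Normal] :
    C.relIndex N ∣ C.index := by
  rw [← relIndex_sup_of_normal, ← Subgroup.relIndex_mul_index (le_sup_left : C ≤ C ⊔ N)]
  exact dvd_mul_right _ _

theorem card_subgroupOf_dvd (H K : Subgroup G) : Nat.card (H.subgroupOf K) ∣ Nat.card H := by
  have h1 := Subgroup.card_map_of_injective (K := H.subgroupOf K) K.subtype_injective
  rw [Subgroup.subgroupOf_map_subtype] at h1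
  rw [← h1]
  exact Subgroup.card_dvd_of_le inf_le_left

theorem HasSylowComplements.of_normal [Finite G] (h : HasSylowComplements G) (N : Subgroup G)
    [N.Normal] : HasSylowComplements N := by
  intro p hp
  obtain ⟨C, hC, k, hk⟩ := h p hp
  refine ⟨C.subgroupOf N, fun hd => hC (hd.trans (card_subgroupOf_dvd C N)), ?_⟩
  obtain ⟨j, -, hj⟩ := (Nat.dvd_prime_pow hp).1 (hk ▸ relIndex_dvd_index N C)
  exact ⟨j, hj⟩

theorem HasSylowComplements.map {G' : Type*} [Group G'] (h : HasSylowComplements G)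
    {f : G →* G'} (hf : Function.Surjective f) : HasSylowComplements G' := by
  intro p hp
  obtain ⟨C, hC, k, hk⟩ := h p hp
  refine ⟨C.map f, fun hd => hC (hd.trans (Subgroup.card_map_dvd C f)), ?_⟩
  obtain ⟨j, -, hj⟩ := (Nat.dvd_prime_pow hp).1 (hk ▸ Subgroup.index_map_dvd C hf)
  exact ⟨j, hj⟩

theorem relIndex_eq_index_of_coprime [Finite G] {H K : Subgroup G}
    (h : Nat.Coprime H.index K.index) : K.relIndex H = K.index := by
  have h1 : (H ⊓ K).index = H.index * K.index := by
    refine le_antisymm Subgroup.index_inf_le (Nat.le_of_dvd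
      (Nat.pos_of_ne_zero Subgroup.FiniteIndex.index_ne_zero) ?_)
    exact h.mul_dvd_of_dvd_of_dvd (Subgroup.index_dvd_of_le inf_le_left)
      (Subgroup.index_dvd_of_le inf_le_right)
  have h2 := Subgroup.relIndex_mul_index (inf_le_left : H ⊓ K ≤ H)
  rw [h1, Subgroup.inf_relIndex_left, mul_comm] at h2
  exact Nat.eq_of_mul_eq_mul_left (Nat.pos_of_ne_zero Subgroup.FiniteIndex.index_ne_zero) h2

/-- By coprimality the $H$-orbit of the base coset has as many points as $G/K$, so $H$ is transitive
there. -/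
theorem exists_mul_eq_of_coprime_index [Finite G] {H K : Subgroup G}
    (h : Nat.Coprime H.index K.index) (g : G) : ∃ x ∈ H, ∃ y ∈ K, g = x * y := by
  have h1 := MulAction.index_stabilizer H ((1 : G) : G ⧸ K)
  have h2 : MulAction.stabilizer H ((1 : G) : G ⧸ K) = K.subgroupOf H := by
    ext x
    rw [MulAction.mem_stabilizer_iff, Subgroup.mem_subgroupOf]
    change (((x : G) * 1 : G) : G ⧸ K) = ((1 : G) : G ⧸ K) ↔ _
    rw [mul_one, eq_comm, QuotientGroup.eq, inv_one, one_mul]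
  rw [h2] at h1
  have h3 : (MulAction.orbit H ((1 : G) : G ⧸ K)).ncard = Nat.card (G ⧸ K) := by
    rw [← h1]
    exact relIndex_eq_index_of_coprime h
  have h4 : MulAction.orbit H ((1 : G) : G ⧸ K) = Set.univ := by
    rw [Set.eq_univ_iff_ncard, h3]
  obtain ⟨x, hx⟩ : (g : G ⧸ K) ∈ MulAction.orbit H ((1 : G) : G ⧸ K) := h4 ▸ Set.mem_univ _
  change (((x : G) * 1 : G) : G ⧸ K) = (g : G ⧸ K) at hx
  rw [mul_one, QuotientGroup.eq] at hx
  exact ⟨x, x.2, _, hx, by simp⟩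

/-- In the last nontrivial term of the derived series, which is abelian, the elements killed by a
prime $p$ dividing its order form a subgroup normal in $G$. -/
theorem exists_normal_isPGroup [Finite G] [Nontrivial G] (h : Group.IsSolvable G) :
    ∃ p : ℕ, p.Prime ∧ ∃ N : Subgroup G, N.Normal ∧ N ≠ ⊥ ∧ IsPGroup p N := by
  classical
  obtain ⟨n, hn⟩ := h.solvable
  have hex : ∃ n, derivedSeries G n = ⊥ := ⟨n, hn⟩
  obtain ⟨m, hm⟩ : ∃ m, Nat.find hex = m + 1 := by
    refine Nat.exists_eq_succ_of_ne_zero fun h0 => ?_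
    have := Nat.find_spec hex
    rw [h0, derivedSeries_zero] at this
    exact top_ne_bot this
  have h1 : derivedSeries G (m + 1) = ⊥ := hm ▸ Nat.find_spec hex
  have h2 : derivedSeries G m ≠ ⊥ := Nat.find_min hex (by omega)
  have hcomm : ∀ x ∈ derivedSeries G m, ∀ y ∈ derivedSeries G m, x * y = y * x := by
    intro x hx y hy
    have h3 : ⁅x, y⁆ ∈ derivedSeries G (m + 1) := Subgroup.commutator_mem_commutator hx hy
    rw [h1, Subgroup.mem_bot, commutatorElement_eq_one_iff_mul_comm] at h3
    exact h3
  obtain ⟨p, hp, hpd⟩ := Nat.exists_prime_and_dvd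
    (fun h3 => h2 (Subgroup.eq_bot_of_card_eq _ h3))
  have : Fact p.Prime := ⟨hp⟩
  obtain ⟨x, hx⟩ := exists_prime_orderOf_dvd_card' p hpd
  refine ⟨p, hp, ⟨⟨⟨{x | x ∈ derivedSeries G m ∧ x ^ p = 1}, ?_⟩, ?_⟩, ?_⟩, ⟨?_⟩, ?_, ?_⟩
  · rintro a b ⟨ha, ha'⟩ ⟨hb, hb'⟩
    exact ⟨mul_mem ha hb, by rw [Commute.mul_pow (hcomm a ha b hb), ha', hb', one_mul]⟩
  · exact ⟨one_mem _, one_pow _⟩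
  · rintro a ⟨ha, ha'⟩
    exact ⟨inv_mem ha, by rw [inv_pow, ha', inv_one]⟩
  · rintro a ⟨ha, ha'⟩ g
    exact ⟨(derivedSeries_normal G m).conj_mem a ha g, by rw [conj_pow, ha', mul_one, mul_inv_cancel]⟩
  · intro h3
    have h4 : (x : G) ∈ (⊥ : Subgroup G) := h3 ▸ ⟨x.2, by
      rw [← Subgroup.coe_pow, ← hx, pow_orderOf_eq_one, Subgroup.coe_one]⟩
    rw [Subgroup.mem_bot] at h4
    have h5 : x = 1 := Subtype.ext h4
    rw [h5, orderOf_one] at hx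
    exact hp.one_lt.ne hx
  · rintro ⟨a, ha⟩
    exact ⟨1, Subtype.ext (by simpa using ha.2)⟩

/-- The complement `C₁` of a Sylow $p_1$-subgroup is solvable by induction and so has a nontrivial
normal $p$-subgroup `N`. A third prime divisor of $|G|$ produces a proper nontrivial normal subgroup
of $G$; otherwise Burnside's theorem on classes of prime power size applies. -/
theorem HasSylowComplements.isSolvable_of_isSimpleGroup [Finite G] [IsSimpleGroup G]
    (h : HasSylowComplements G)
    (ih : ∀ C : Subgroup G, C ≠ ⊤ → HasSylowComplements C → Group.IsSolvable C) :
    Group.IsSolvable G := by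
  by_contra hsol
  have hcomm : ∃ a b : G, a * b ≠ b * a := by
    by_contra hcon
    push Not at hcon
    exact hsol (Group.isSolvable_of_comm hcon)
  have hpgroup : ∀ p : ℕ, p.Prime → ¬ IsPGroup p G := by
    intro p hp hpG
    have : Fact p.Prime := ⟨hp⟩
    have := hpG.isNilpotent
    exact hsol inferInstance
  have hcard : Nat.card G ≠ 1 := fun h1 => by
    have := (Nat.card_eq_one_iff_unique.1 h1).1
    exact hcomm.elim fun a ⟨b, hab⟩ => hab (Subsingleton.elim _ _)
  obtain ⟨p₁, hp₁, hp₁d⟩ := Nat.exists_prime_and_dvd hcard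
  obtain ⟨C₁, hC₁, k₁, hk₁⟩ := h p₁ hp₁
  have hC₁top : C₁ ≠ ⊤ := by
    rintro rfl
    rw [Subgroup.card_top] at hC₁
    exact hC₁ hp₁d
  have hC₁bot : Nontrivial C₁ := by
    rw [Subgroup.nontrivial_iff_ne_bot]
    rintro rfl
    rw [Subgroup.index_bot] at hk₁
    have : Fact p₁.Prime := ⟨hp₁⟩
    exact hpgroup p₁ hp₁ (IsPGroup.of_card hk₁)
  have hC₁h : HasSylowComplements C₁ := by
    intro p hp
    by_cases hpp : p = p₁
    · subst hpp
      exact ⟨⊤, by rwa [Subgroup.card_top], 0, by simp⟩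
    · obtain ⟨C, hC, k, hk⟩ := h p hp
      refine ⟨C.subgroupOf C₁, fun hd => hC (hd.trans (card_subgroupOf_dvd _ _)), k, ?_⟩
      rw [← hk]
      refine relIndex_eq_index_of_coprime ?_
      rw [hk, hk₁]
      exact Nat.Coprime.pow _ _ ((Nat.coprime_primes hp₁ hp).2 (Ne.symm hpp))
  obtain ⟨p, hp, N, hN, hN1, hNp⟩ := exists_normal_isPGroup (ih C₁ hC₁top hC₁h)
  have hfp : Fact p.Prime := ⟨hp⟩
  have hfp₁ : Fact p₁.Prime := ⟨hp₁⟩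
  have hpp₁ : p ≠ p₁ := by
    rintro rfl
    obtain ⟨n, hn⟩ := IsPGroup.iff_card.1 hNp
    have h1 : n ≠ 0 := by
      rintro rfl
      exact hN1 (Subgroup.eq_bot_of_card_eq _ (by simpa using hn))
    exact hC₁ ((dvd_pow_self p h1).trans (hn ▸ Subgroup.card_subgroup_dvd_card N))
  by_cases hq : ∃ q : ℕ, q.Prime ∧ q ∣ Nat.card G ∧ q ≠ p ∧ q ≠ p₁
  · obtain ⟨q, hq, hqd, hqp, hqp₁⟩ := hq
    obtain ⟨Cq, hCq, k, hk⟩ := h q hq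
    have hNp' : IsPGroup p (N.map C₁.subtype) := hNp.map _
    -- The $p$-group `N` fixes a coset of `Cq`, because their number $q^k$ is prime to $p$. Its
    -- stabilizer `D` is a subgroup of index $q^k$ containing `N`.
    obtain ⟨x, hx⟩ := hNp'.nonempty_fixed_point_of_prime_not_dvd_card (G ⧸ Cq) (by
      intro hd
      have h1 : p ∣ q ^ k := hk ▸ hd
      exact hqp ((Nat.prime_dvd_prime_iff_eq hp hq).1 (hp.dvd_of_dvd_pow h1)).symm)
    let D : Subgroup G := MulAction.stabilizer G x
    have hD : D.index = q ^ k := by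
      rw [← hk]
      exact MulAction.index_stabilizer_of_transitive G x
    have hND : ∀ n ∈ N.map C₁.subtype, n ∈ D := fun n hn => hx ⟨n, hn⟩
    have hDtop : D ≠ ⊤ := by
      intro h1
      rw [h1, Subgroup.index_top] at hD
      have h2 : Cq = ⊤ := Subgroup.index_eq_one.1 (hk.trans hD.symm)
      rw [h2, Subgroup.card_top] at hCq
      exact hCq hqd
    -- Coprime indices give $G=DC_1$. Conjugating by `C₁` preserves `N`, and conjugating by `D`
    -- preserves `D`, so all conjugates of `N` lie in `D`.
    have hle : Subgroup.normalClosure ((N.map C₁.subtype : Subgroup G) : Set G) ≤ D := by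
      rw [Subgroup.normalClosure, Subgroup.closure_le]
      intro y hy
      obtain ⟨n, hn, hny⟩ := Group.mem_conjugatesOfSet_iff.1 hy
      obtain ⟨g, rfl⟩ := isConj_iff.1 hny
      obtain ⟨d, hd, c, hc, rfl⟩ := exists_mul_eq_of_coprime_index (H := D) (K := C₁) (by
        rw [hD, hk₁]
        exact Nat.Coprime.pow _ _ ((Nat.coprime_primes hq hp₁).2 hqp₁)) g
      obtain ⟨n', hn', rfl⟩ := hn
      have h1 : c * C₁.subtype n' * c⁻¹ ∈ D :=
        hND _ ⟨⟨c, hc⟩ * n' * ⟨c, hc⟩⁻¹, hN.conj_mem n' hn' _, by simp⟩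
      have h2 : d * c * C₁.subtype n' * (d * c)⁻¹ = d * (c * C₁.subtype n' * c⁻¹) * d⁻¹ := by
        group
      rw [h2]
      exact mul_mem (mul_mem hd h1) (inv_mem hd)
    rcases (Subgroup.normalClosure_normal (s := ((N.map C₁.subtype : Subgroup G) : Set G))).eq_bot_or_eq_top
      with h1 | h1
    · refine hN1 ?_
      rw [Subgroup.normalClosure_eq_bot_iff] at h1
      have h2 : N.map C₁.subtype ≤ ⊥ := fun y hy => h1 hy
      rw [le_bot_iff, Subgroup.map_eq_bot_iff_of_injective _ C₁.subtype_injective] at h2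
      exact h2
    · exact hDtop (top_le_iff.1 (h1 ▸ hle))
  -- With only two primes the complement of a Sylow $p$-subgroup is a $p_1$-group. A nontrivial
  -- element of its centre has centralizer of $p$-power index.
  · push Not at hq
    obtain ⟨C, hC, k, hk⟩ := h p hp
    have hCp : IsPGroup p₁ C := by
      refine IsPGroup.of_card (Nat.eq_prime_pow_of_unique_prime_dvd Nat.card_pos.ne' ?_)
      intro q hq' hqd
      refine hq q hq' (hqd.trans (Subgroup.card_subgroup_dvd_card C)) ?_
      rintro rfl
      exact hC hqd
    have hCbot : Nontrivial C := by
      rw [Subgroup.nontrivial_iff_ne_bot]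
      rintro rfl
      rw [Subgroup.index_bot] at hk
      exact hpgroup p hp (IsPGroup.of_card hk)
    have := hCp.center_nontrivial
    obtain ⟨z, hz⟩ := exists_ne (1 : Subgroup.center C)
    have hle : C ≤ Subgroup.centralizer {((z : C) : G)} := by
      intro c hc
      rw [Subgroup.mem_centralizer_singleton_iff]
      exact congrArg Subtype.val (Subgroup.mem_center_iff.1 z.2 ⟨c, hc⟩)
    obtain ⟨j, -, hj⟩ := (Nat.dvd_prime_pow hp).1 (hk ▸ Subgroup.index_dvd_of_le hle)
    exact centralizer_index_ne_prime_pow hcomm (g := ((z : C) : G))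
      (fun h1 => hz (Subtype.ext (Subtype.ext h1))) hp j hj

/-- A finite group with complements of its Sylow subgroups is solvable. -/
theorem HasSylowComplements.isSolvable {G : Type u} [Group G] [Finite G]
    (h : HasSylowComplements G) : Group.IsSolvable G := by
  induction hn : Nat.card G using Nat.strong_induction_on generalizing G with
  | _ n ih =>
    subst hn
    rcases subsingleton_or_nontrivial G with hG | hG
    · exact Group.isSolvable_of_comm fun a b => Subsingleton.elim _ _
    have hlt : ∀ C : Subgroup G, C ≠ ⊤ → Nat.card C < Nat.card G := fun C hC =>
      lt_of_le_of_ne (Nat.le_of_dvd Nat.card_pos C.card_subgroup_dvd_card)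
        fun h1 => hC (Subgroup.eq_top_of_card_eq _ h1)
    by_cases hs : IsSimpleGroup G
    · exact h.isSolvable_of_isSimpleGroup fun C hC hC' => ih _ (hlt C hC) hC' rfl
    · obtain ⟨N, hN, hN1, hN2⟩ : ∃ N : Subgroup G, N.Normal ∧ N ≠ ⊥ ∧ N ≠ ⊤ := by
        by_contra hcon
        push Not at hcon
        exact hs ⟨fun N hN => or_iff_not_imp_left.2 (hcon N hN)⟩
      have h1 : Group.IsSolvable N := ih _ (hlt N hN2) (h.of_normal N) rfl
      have h2 : Group.IsSolvable (G ⧸ N) := by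
        refine ih _ ?_ (h.map (QuotientGroup.mk'_surjective N)) rfl
        have h3 := N.card_mul_index
        have h4 : 1 < Nat.card N := Subgroup.one_lt_card_iff_ne_bot N |>.2 hN1
        have h5 : 0 < Nat.card (G ⧸ N) := Nat.card_pos
        change Nat.card N * Nat.card (G ⧸ N) = _ at h3
        rw [← h3]
        nlinarith
      exact Group.isSolvable_of_ker_le_range N.subtype (QuotientGroup.mk' N) (by simp)

/-- In a finite solvable group, a subgroup which meets all the conjugacy classes of suitable
generators of Sylow subgroups is everything. -/
theorem eq_top_of_sylow_generators {G : Type u} [Group G] [Finite G] (hG : Group.IsSolvable G)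
    (H : Subgroup G) (h : ∀ p : ℕ, p.Prime → ∃ P : Subgroup G, IsPGroup p P ∧ ¬ p ∣ P.index ∧
      ∃ S : Set G, Subgroup.closure S = P ∧ ∀ s ∈ S, ∃ g, g * s * g⁻¹ ∈ H) : H = ⊤ := by
  induction hn : Nat.card G using Nat.strong_induction_on generalizing G with
  | _ n ih =>
    subst hn
    rcases subsingleton_or_nontrivial G with hG' | hG'
    · exact Subsingleton.elim _ _
    obtain ⟨p, hp, N, hN, hN1, hNp⟩ := exists_normal_isPGroup hG
    have hfp : Fact p.Prime := ⟨hp⟩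
    -- The hypotheses pass to the quotient by `N`, so induction gives $HN=G$; in particular `H` has
    -- $p$-power index.
    have hsup : H ⊔ N = ⊤ := by
      have h1 : H.map (QuotientGroup.mk' N) = ⊤ := by
        refine ih _ ?_ (Group.isSolvable_of_surjective (QuotientGroup.mk'_surjective N)) _ ?_ rfl
        · have h3 := N.card_mul_index
          have h4 : 1 < Nat.card N := Subgroup.one_lt_card_iff_ne_bot N |>.2 hN1
          have h5 : 0 < Nat.card (G ⧸ N) := Nat.card_pos
          change Nat.card N * Nat.card (G ⧸ N) = _ at h3
          rw [← h3]
          nlinarith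
        · intro q hq
          obtain ⟨P, hP, hPi, S, hS, hS'⟩ := h q hq
          refine ⟨P.map (QuotientGroup.mk' N), hP.map _, fun hd => hPi (hd.trans
            (Subgroup.index_map_dvd P (QuotientGroup.mk'_surjective N))),
            QuotientGroup.mk' N '' S, by rw [← MonoidHom.map_closure, hS], ?_⟩
          rintro _ ⟨s, hs, rfl⟩
          obtain ⟨g, hg⟩ := hS' s hs
          exact ⟨QuotientGroup.mk' N g, _, hg, by simp⟩
      have h2 := congrArg (Subgroup.comap (QuotientGroup.mk' N)) h1
      rwa [Subgroup.comap_map_eq, QuotientGroup.ker_mk', Subgroup.comap_top] at h2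
    obtain ⟨j, hj⟩ : ∃ j, H.index = p ^ j := by
      have h1 : H.index = H.relIndex N := by
        rw [← relIndex_sup_of_normal, hsup, Subgroup.relIndex_top_right]
      exact h1 ▸ hNp.index (H.subgroupOf N)
    obtain ⟨P, hP, hPi, S, hS, hS'⟩ := h p hp
    have hcop : Nat.Coprime P.index H.index := by
      rw [hj]
      exact Nat.Coprime.pow_right j ((Nat.Prime.coprime_iff_not_dvd hp).2 hPi).symm
    have hSP : ∀ s ∈ S, s ∈ P := fun s hs => hS ▸ Subgroup.subset_closure hs
    have hPH : P ≤ H := by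
      rw [← Subgroup.subgroupOf_eq_top]
      have := hP.isNilpotent
      -- If $H\cap P$ were proper it would lie in a maximal subgroup `K` of `P`, normal since `P` is
      -- nilpotent. As $G=PH$, each generator in `S` is conjugate into `H` by an element of `P`,
      -- hence lies in `K`, so `K` would be all of `P`.
      rcases eq_top_or_exists_le_coatom (H.subgroupOf P) with h1 | ⟨K, hK, hKH⟩
      · exact h1
      · exfalso
        have hKn : K.Normal :=
          Subgroup.NormalizerCondition.normal_of_coatom K Group.normalizerCondition_of_isNilpotent hK
        have h2 : P ≤ K.map P.subtype := by
          conv_lhs => rw [← hS]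
          rw [Subgroup.closure_le]
          intro s hs
          obtain ⟨g, hg⟩ := hS' s hs
          obtain ⟨x, hx, y, hy, hxy⟩ := exists_mul_eq_of_coprime_index hcop g⁻¹
          have h3 : x⁻¹ * s * x ∈ H := by
            have h4 : g = y⁻¹ * x⁻¹ := by rw [← mul_inv_rev, ← hxy, inv_inv]
            have h5 : x⁻¹ * s * x = y * (g * s * g⁻¹) * y⁻¹ := by rw [h4]; group
            rw [h5]
            exact mul_mem (mul_mem hy hg) (inv_mem hy)
          let s' : P := ⟨s, hSP s hs⟩
          let x' : P := ⟨x, hx⟩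
          have h4 : x'⁻¹ * s' * x' ∈ K := hKH (Subgroup.mem_subgroupOf.2 h3)
          have h5 := hKn.conj_mem _ h4 x'
          rw [show x' * (x'⁻¹ * s' * x') * x'⁻¹ = s' by group] at h5
          exact ⟨s', h5, rfl⟩
        refine hK.1 (top_le_iff.1 fun x _ => ?_)
        obtain ⟨y, hy, hxy⟩ := h2 x.2
        rwa [← Subtype.ext hxy]
    have h1 : p ^ j ∣ P.index := hj ▸ Subgroup.index_dvd_of_le hPH
    rw [← Subgroup.index_eq_one, hj]
    rcases Nat.eq_zero_or_pos j with rfl | hj0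
    · exact pow_zero p
    · exact absurd ((dvd_pow_self p hj0.ne').trans h1) hPi

end Hall

end SetTheoreticYBE

namespace SetTheoreticYBE

/-! ### The decomposition of square-free solutions -/

namespace IsSolution

variable {X : Type u} {r : X × X → X × X} (h : IsSolution r)
include h

/-- The cocycle identity: on the free commutative monoid the permutation is multiplicative only up
to twisting the second multiset. -/
theorem multisetPerm_add (a b : Multiset X) :
    h.multisetPerm (a + b) = h.multisetPerm (b.map (h.multisetPerm a)) * h.multisetPerm a := by
  induction b using Multiset.induction with
  | empty => simp
  | cons i b ih =>
    rw [Multiset.add_cons, multisetPerm_cons, ih, Multiset.map_cons, multisetPerm_cons, mul_assoc]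
    rfl

/-- Square-freeness enters here: since `h.perm x` fixes `x`, repeated letters are not twisted. -/
theorem multisetPerm_nsmul_singleton (k : ℕ) (x : X) :
    h.multisetPerm (k • {x}) = h.perm x ^ k := by
  induction k with
  | zero => simp
  | succ k ih =>
    have hx : (h.perm x ^ k) x = x := by
      have : h.perm x ∈ MulAction.stabilizer (Equiv.Perm X) x := h.perm_self x
      exact pow_mem this k
    rw [succ_nsmul', Multiset.singleton_add, multisetPerm_cons, ih, hx, pow_succ']

theorem multisetPerm_add_card_nsmul (a b : Multiset X) :
    h.multisetPerm (a + Nat.card (Equiv.Perm X) • b) = h.multisetPerm a := by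
  induction b using Multiset.induction with
  | empty => simp
  | cons x b ih =>
    rw [← Multiset.singleton_add, nsmul_add, add_comm (Nat.card (Equiv.Perm X) • ({x} : Multiset X)), ← add_assoc,
      multisetPerm_add, ih, Multiset.map_nsmul, Multiset.map_singleton, multisetPerm_nsmul_singleton, pow_card_eq_one',
      one_mul]

variable [Finite X]

omit h in
theorem exists_multiset_count_eq [DecidableEq X] (f : X → ℕ) :
    ∃ a : Multiset X, ∀ x, a.count x = f x := by
  have := Fintype.ofFinite X
  refine ⟨∑ x, f x • {x}, fun x => ?_⟩
  simp [Multiset.count_sum', Multiset.count_singleton]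

/-- The order of the symmetric group on $X$ serves as a common period: multiplicities matter only
modulo it, because each `h.perm x` has order dividing it. -/
theorem multisetPerm_congr [DecidableEq X] {a b : Multiset X}
    (hab : ∀ x, a.count x ≡ b.count x [MOD Nat.card (Equiv.Perm X)]) :
    h.multisetPerm a = h.multisetPerm b := by
  set M := Nat.card (Equiv.Perm X)
  obtain ⟨c, hc⟩ := exists_multiset_count_eq fun x => a.count x % M
  have key : ∀ b : Multiset X, (∀ x, a.count x ≡ b.count x [MOD M]) →
      h.multisetPerm b = h.multisetPerm c := by
    intro b hb
    obtain ⟨b', hb'⟩ := exists_multiset_count_eq fun x => b.count x / M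
    have : b = c + M • b' := by
      ext x
      rw [Multiset.count_add, Multiset.count_nsmul, hc, hb', hb x, Nat.mod_add_div]
    rw [this, multisetPerm_add_card_nsmul]
  rw [key a fun _ => rfl, key b hab]

/-- The permutations of the multiples of `d` in the free commutative monoid. -/
noncomputable def multiplePerms (d : ℕ) : Subgroup (Equiv.Perm X) :=
  let N : Submonoid (Equiv.Perm X) :=
    { carrier := Set.range fun b => h.multisetPerm (d • b)
      mul_mem' := by
        rintro _ _ ⟨b, rfl⟩ ⟨b', rfl⟩
        -- The inverse permutation applied to `b` compensates the twist in the cocycle identity.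
        refine ⟨b' + b.map ((h.multisetPerm (d • b'))⁻¹ : Equiv.Perm X), ?_⟩
        simp only [nsmul_add]
        rw [multisetPerm_add, Multiset.map_nsmul, Multiset.map_map]
        congr 3
        exact (Multiset.map_congr rfl fun x _ => Equiv.apply_symm_apply _ x).trans b.map_id
      one_mem' := ⟨0, by simp⟩ }
  { N with
    inv_mem' := by
      intro g hg
      have h1 : g⁻¹ ∈ Submonoid.powers g :=
        (isOfFinOrder_of_finite g).mem_powers_iff_mem_zpowers.2
          (inv_mem (Subgroup.mem_zpowers g))
      exact (Submonoid.powers_le (P := N)).2 hg h1 }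

theorem multiplePerms_le_one (d : ℕ) : h.multiplePerms d ≤ h.multiplePerms 1 := by
  rintro _ ⟨b, rfl⟩
  exact ⟨d • b, by simp only [one_nsmul]⟩

theorem closure_perm_pow (d : ℕ) :
    Subgroup.closure (Set.range fun x => h.perm x ^ d) = h.multiplePerms d := by
  apply le_antisymm
  · rw [Subgroup.closure_le]
    rintro _ ⟨x, rfl⟩
    exact ⟨{x}, h.multisetPerm_nsmul_singleton d x⟩
  · rintro _ ⟨b, rfl⟩
    simp only
    induction b using Multiset.induction with
    | empty => simp
    | cons x b ih =>
      rw [← Multiset.singleton_add, nsmul_add, add_comm, multisetPerm_add, Multiset.map_nsmul,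
        Multiset.map_singleton, multisetPerm_nsmul_singleton]
      exact mul_mem (Subgroup.subset_closure ⟨_, rfl⟩) ih

/-- The permutation of $d\cdot b$ depends only on the multiplicities of $b$ modulo $e$. This gives a
surjective crossed homomorphism from $(\mathbb Z/e)^X$, and its fibres all have the same size. -/
theorem card_multiplePerms_dvd {d e : ℕ} (hde : d * e = Nat.card (Equiv.Perm X)) :
    Nat.card (h.multiplePerms d) ∣ e ^ Nat.card X := by
  classical
  have he : NeZero e := ⟨by rintro rfl; exact Nat.card_pos.ne' (hde.symm.trans (mul_zero d))⟩
  let cnt : Multiset X → X → ZMod e := fun b x => (b.count x : ZMod e)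
  have hcnt : Function.Surjective cnt := by
    intro f
    obtain ⟨a, ha⟩ := exists_multiset_count_eq fun x => (f x).val
    exact ⟨a, funext fun x => by simp [cnt, ha]⟩
  have hcongr : ∀ b b', cnt b = cnt b' → h.multisetPerm (d • b) = h.multisetPerm (d • b') := by
    intro b b' hbb
    apply h.multisetPerm_congr
    intro x
    rw [Multiset.count_nsmul, Multiset.count_nsmul, ← hde]
    exact Nat.ModEq.mul_left' d ((ZMod.natCast_eq_natCast_iff _ _ _).1 (congrFun hbb x))
  let F : (X → ZMod e) → h.multiplePerms d := fun f =>
    ⟨h.multisetPerm (d • Function.surjInv hcnt f), _, rfl⟩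
  have hF : ∀ b, (F (cnt b) : Equiv.Perm X) = h.multisetPerm (d • b) := fun b =>
    hcongr _ _ (Function.surjInv_eq hcnt _)
  have hFsurj : Function.Surjective F := by
    rintro ⟨_, b, rfl⟩
    exact ⟨cnt b, Subtype.ext (hF b)⟩
  have hFadd : ∀ f f', F (f + f') = F (f' ∘ ((F f : Equiv.Perm X)⁻¹ : Equiv.Perm X)) * F f := by
    intro f f'
    obtain ⟨b, rfl⟩ := hcnt f
    obtain ⟨b', rfl⟩ := hcnt f'
    have h1 : cnt b + cnt b' = cnt (b + b') := by
      funext x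
      simp [cnt]
    have h2 : ∀ g : Equiv.Perm X, cnt b' ∘ (g⁻¹ : Equiv.Perm X) = cnt (b'.map g) := by
      intro g
      funext x
      simp only [cnt, Function.comp_apply]
      conv_rhs => rw [← (Equiv.apply_symm_apply g x : g (g⁻¹ x) = x)]
      rw [Multiset.count_map_eq_count' _ _ g.injective]
      rfl
    apply Subtype.ext
    rw [h1, h2, Subgroup.coe_mul, hF, hF, hF, nsmul_add, multisetPerm_add, Multiset.map_nsmul]
  have hfib : ∀ g : h.multiplePerms d, Nonempty ({f // F f = g} ≃ {f // F f = 1}) := by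
    intro g
    obtain ⟨f₀, rfl⟩ := hFsurj g
    -- The fibre over `1` is carried to the fibre through `f₀` by permuting coordinates by `F f₀`
    -- and then translating by `f₀`.
    refine ⟨(Equiv.subtypeEquiv ((Equiv.arrowCongr (F f₀ : Equiv.Perm X).symm
      (Equiv.refl (ZMod e))).trans (Equiv.addLeft f₀)) fun f => ?_).symm⟩
    have h1 : (((Equiv.arrowCongr (F f₀ : Equiv.Perm X).symm
      (Equiv.refl (ZMod e))).trans (Equiv.addLeft f₀)) f) = f₀ + f ∘ (F f₀ : Equiv.Perm X) := rfl
    rw [h1, hFadd, Function.comp_assoc]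
    have h2 : ((F f₀ : Equiv.Perm X) : X → X) ∘ ((F f₀ : Equiv.Perm X)⁻¹ : Equiv.Perm X) = id := by
      funext x; simp
    rw [h2, Function.comp_id, mul_eq_right]
  have hcard := Nat.card_congr ((Equiv.sigmaFiberEquiv F).symm.trans
    (Equiv.sigmaEquivProdOfEquiv fun g => (hfib g).some))
  rw [Nat.card_fun, Nat.card_zmod, Nat.card_prod] at hcard
  exact hcard ▸ dvd_mul_right _ _

/-- By the Chinese remainder theorem a multiset `b` may be replaced, modulo the common period, by
the sum of an $m$-multiple and a $q$-multiple of it; the cocycle identity then factors its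
permutation. -/
theorem exists_mul_eq_of_mem_multiplePerms {m q : ℕ} (hmq : m * q = Nat.card (Equiv.Perm X))
    (hcop : Nat.Coprime m q) {g : Equiv.Perm X} (hg : g ∈ h.multiplePerms 1) :
    ∃ c ∈ h.multiplePerms q, ∃ x ∈ h.multiplePerms m, c * x = g := by
  classical
  obtain ⟨b, rfl⟩ := hg
  obtain ⟨s, hs, hs'⟩ := Nat.chineseRemainder hcop 0 1
  obtain ⟨t, ht, ht'⟩ := Nat.chineseRemainder hcop 1 0
  obtain ⟨s, rfl⟩ := (Nat.modEq_zero_iff_dvd).1 hs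
  obtain ⟨t, rfl⟩ := (Nat.modEq_zero_iff_dvd).1 ht'
  have h1 : m * s + q * t ≡ 1 [MOD m * q] :=
    (Nat.modEq_and_modEq_iff_modEq_mul hcop).1 ⟨hs.add ht, hs'.add ht'⟩
  rw [hmq] at h1
  refine ⟨_, ⟨(t • b).map (h.multisetPerm (m • (s • b))), rfl⟩, _, ⟨s • b, rfl⟩, ?_⟩
  simp only
  rw [← Multiset.map_nsmul, ← multisetPerm_add, smul_smul, smul_smul, ← add_nsmul]
  apply h.multisetPerm_congr
  intro x
  rw [Multiset.count_nsmul, Multiset.count_nsmul]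
  exact h1.mul_right _

/-- Write $|\mathrm{Sym}(X)|=p^km$ with $p\nmid m$. The multiples of $m$ give a $p$-group and the
multiples of $p^k$ a group of order prime to $p$, and together they generate by factorization, so
they are complementary. -/
theorem exists_sylow_decomposition {p : ℕ} (hp : p.Prime) : ∃ m q : ℕ,
    IsPGroup p (h.multiplePerms m) ∧ ¬ p ∣ Nat.card (h.multiplePerms q) ∧
    ((h.multiplePerms q).subgroupOf (h.multiplePerms 1)).index = Nat.card (h.multiplePerms m) ∧
    ((h.multiplePerms m).subgroupOf (h.multiplePerms 1)).index =
      Nat.card (h.multiplePerms q) := by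
  have : Fact p.Prime := ⟨hp⟩
  obtain ⟨k, m, hm, hkm⟩ := Nat.exists_eq_pow_mul_and_not_dvd
    (Nat.card_pos (α := Equiv.Perm X)).ne' p hp.ne_one
  have hcop : Nat.Coprime m (p ^ k) :=
    (Nat.Coprime.pow_left k ((Nat.Prime.coprime_iff_not_dvd hp).2 hm)).symm
  have hc1 := h.card_multiplePerms_dvd (d := m) (e := p ^ k) (by rw [hkm, mul_comm])
  have hc2 := h.card_multiplePerms_dvd (d := p ^ k) (e := m) hkm.symm
  have hcop' : Nat.Coprime (Nat.card (h.multiplePerms m)) (Nat.card (h.multiplePerms (p ^ k))) :=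
    Nat.Coprime.of_dvd hc1 hc2 (hcop.symm.pow _ _)
  rw [← pow_mul] at hc1
  obtain ⟨j, -, hj⟩ := (Nat.dvd_prime_pow hp).1 hc1
  have hcompl : Subgroup.IsComplement' ((h.multiplePerms (p ^ k)).subgroupOf (h.multiplePerms 1))
      ((h.multiplePerms m).subgroupOf (h.multiplePerms 1)) := by
    apply Subgroup.isComplement'_of_disjoint_and_mul_eq_univ
    · apply Subgroup.disjoint_of_coprime_natCard
      exact (hcop'.of_dvd (card_subgroupOf_dvd _ _) (card_subgroupOf_dvd _ _)).symm
    · rw [Set.eq_univ_iff_forall]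
      rintro ⟨g, hg⟩
      obtain ⟨c, hc, x, hx, rfl⟩ :=
        h.exists_mul_eq_of_mem_multiplePerms (by rw [hkm, mul_comm]) hcop hg
      exact ⟨⟨c, h.multiplePerms_le_one _ hc⟩, hc, ⟨x, h.multiplePerms_le_one _ hx⟩, hx, rfl⟩
  have hcard : ∀ d, Nat.card ((h.multiplePerms d).subgroupOf (h.multiplePerms 1)) =
      Nat.card (h.multiplePerms d) := fun d =>
    Nat.card_congr (Subgroup.subgroupOfEquivOfLe (h.multiplePerms_le_one d)).toEquiv
  refine ⟨m, p ^ k, IsPGroup.of_card hj, ?_, ?_, ?_⟩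
  · intro hd
    exact hm (hp.dvd_of_dvd_pow (hd.trans hc2))
  · rw [← hcard m]
    exact hcompl.symm.index_eq_card
  · rw [← hcard (p ^ k)]
    exact hcompl.index_eq_card

theorem isSolvable_multiplePerms_one : Group.IsSolvable (h.multiplePerms 1) := by
  apply HasSylowComplements.isSolvable
  intro p hp
  have : Fact p.Prime := ⟨hp⟩
  obtain ⟨m, q, hm, hq, hi, -⟩ := h.exists_sylow_decomposition hp
  refine ⟨_, fun hd => hq (hd.trans (card_subgroupOf_dvd _ _)), ?_⟩
  rw [hi]
  exact IsPGroup.iff_card.1 hm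

/-- The permutation group of a square-free solution is intransitive. -/
theorem exists_forall_perm_ne (hX : 2 ≤ Nat.card X) (x₀ : X) :
    ∃ y, ∀ g ∈ h.multiplePerms 1, g x₀ ≠ y := by
  by_contra hcon
  push Not at hcon
  -- The Sylow generators are the powers `h.perm x ^ m`, and each fixes `x`. By transitivity `x` is
  -- a translate of `x₀`, so a conjugate of the generator fixes `x₀`.
  have htop : MulAction.stabilizer (h.multiplePerms 1) x₀ = ⊤ := by
    apply eq_top_of_sylow_generators h.isSolvable_multiplePerms_one
    intro p hp
    obtain ⟨m, q, hm, hq, -, hi⟩ := h.exists_sylow_decomposition hp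
    refine ⟨(h.multiplePerms m).subgroupOf (h.multiplePerms 1),
      hm.of_equiv (Subgroup.subgroupOfEquivOfLe (h.multiplePerms_le_one m)).symm,
      by rwa [hi], {s | ∃ x, (s : Equiv.Perm X) = h.perm x ^ m}, ?_, ?_⟩
    · apply Subgroup.map_injective (h.multiplePerms 1).subtype_injective
      rw [MonoidHom.map_closure, Subgroup.subgroupOf_map_subtype,
        inf_eq_left.2 (h.multiplePerms_le_one m)]
      refine Eq.trans ?_ (h.closure_perm_pow m)
      congr 1
      ext g
      constructor
      · rintro ⟨s, ⟨x, hx⟩, rfl⟩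
        exact ⟨x, hx.symm⟩
      · rintro ⟨x, rfl⟩
        refine ⟨⟨h.perm x ^ m, h.multiplePerms_le_one m ?_⟩, ⟨x, rfl⟩, rfl⟩
        rw [← h.closure_perm_pow m]
        exact Subgroup.subset_closure ⟨x, rfl⟩
    · rintro s ⟨x, hx⟩
      obtain ⟨g, hg, hgx⟩ := hcon x
      refine ⟨⟨g, hg⟩⁻¹, ?_⟩
      rw [MulAction.mem_stabilizer_iff, inv_inv]
      change (g⁻¹ * (s : Equiv.Perm X) * g) x₀ = x₀
      have hfix : (h.perm x ^ m) x = x := by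
        have : h.perm x ∈ MulAction.stabilizer (Equiv.Perm X) x := h.perm_self x
        exact pow_mem this m
      rw [Equiv.Perm.mul_apply, Equiv.Perm.mul_apply, hgx, hx, hfix, ← hgx]
      exact Equiv.symm_apply_apply g x₀
  have hall : ∀ y, y = x₀ := by
    intro y
    obtain ⟨g, hg, rfl⟩ := hcon y
    have : (⟨g, hg⟩ : h.multiplePerms 1) ∈ MulAction.stabilizer (h.multiplePerms 1) x₀ :=
      htop ▸ Subgroup.mem_top _
    exact this
  have : Subsingleton X := ⟨fun a b => (hall a).trans (hall b).symm⟩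
  have := Finite.card_le_one_iff_subsingleton.2 this
  omega

omit [Finite X] in
-- Both components of `r (x, y)` are translates, by permutations `h.perm z` or their inverses, of
-- `y` and `x` respectively; `r` therefore swaps the parts of a mixed pair.
theorem apply_mem_iff_of_perm {W : Set X} (hW : ∀ x y, h.perm x y ∈ W ↔ y ∈ W) (x y : X) :
    ((r (x, y)).1 ∈ W ↔ y ∈ W) ∧ ((r (x, y)).2 ∈ W ↔ x ∈ W) := by
  have h1 := h.perm_snd x y
  set a := (r (x, y)).2 with ha
  have h2 : r (x, y) = (h.perm a y, a) := by rw [← h1, h.apply_perm]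
  refine ⟨by rw [h2]; exact hW a y, ?_⟩
  conv_rhs => rw [← h1]
  exact (hW y a).symm

omit [Finite X] in
theorem isInvariantSubset_of_perm {W : Set X} (hW : ∀ x y, h.perm x y ∈ W ↔ y ∈ W) :
    IsInvariantSubset r W := by
  have hmaps : Set.MapsTo r (W ×ˢ W) (W ×ˢ W) := fun p hp =>
    ⟨(h.apply_mem_iff_of_perm hW p.1 p.2).1.2 hp.2, (h.apply_mem_iff_of_perm hW p.1 p.2).2.2 hp.1⟩
  exact Set.InvOn.bijOn ⟨fun p _ => h.inv p, fun p _ => h.inv p⟩ hmaps hmaps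

/-- **Rump's theorem**: the permutations `h.perm x` have a common nontrivial invariant subset. -/
theorem exists_perm_invariant (hX : 2 ≤ Nat.card X) :
    ∃ Y : Set X, Y.Nonempty ∧ Yᶜ.Nonempty ∧ ∀ x y, h.perm x y ∈ Y ↔ y ∈ Y := by
  have : Nonempty X := (Nat.card_pos_iff.1 (by omega)).1
  obtain ⟨x₀⟩ := this
  obtain ⟨y₀, hy₀⟩ := h.exists_forall_perm_ne hX x₀
  have hperm : ∀ x, h.perm x ∈ h.multiplePerms 1 := fun x =>
    ⟨{x}, (h.multisetPerm_nsmul_singleton 1 x).trans (pow_one _)⟩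
  refine ⟨{y | ∃ g ∈ h.multiplePerms 1, g x₀ = y}, ⟨x₀, 1, one_mem _, rfl⟩, ⟨y₀, ?_⟩, ?_⟩
  · rintro ⟨g, hg, hgy⟩
    exact hy₀ g hg hgy
  · intro x y
    constructor
    · rintro ⟨g, hg, hgy⟩
      exact ⟨(h.perm x)⁻¹ * g, mul_mem (inv_mem (hperm x)) hg, by
        rw [Equiv.Perm.mul_apply, hgy]
        exact Equiv.symm_apply_apply _ y⟩
    · rintro ⟨g, hg, rfl⟩
      exact ⟨h.perm x * g, mul_mem (hperm x) hg, rfl⟩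

theorem isDecomposable (hX : 2 ≤ Nat.card X) : IsDecomposable r := by
  obtain ⟨Y, hne, hne', hY⟩ := h.exists_perm_invariant hX
  exact ⟨Y, Yᶜ, hne, hne', disjoint_compl_right, Set.union_compl_self Y,
    h.isInvariantSubset_of_perm hY, h.isInvariantSubset_of_perm fun x y => not_congr (hY x y)⟩

end IsSolution

end SetTheoreticYBE

namespace SetTheoreticYBE

/-! ### Solutions are straightening for a suitable order -/

/-- The restriction of `r` to a subset. -/
def restrictPair {X : Type*} (r : X × X → X × X) {W : Set X}
    (hW : ∀ x ∈ W, ∀ y ∈ W, (r (x, y)).1 ∈ W ∧ (r (x, y)).2 ∈ W) : W × W → W × W :=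
  fun p => (⟨(r (p.1, p.2)).1, (hW _ p.1.2 _ p.2.2).1⟩, ⟨(r (p.1, p.2)).2, (hW _ p.1.2 _ p.2.2).2⟩)

namespace IsSolution

theorem restrictPair {X : Type*} [Finite X] {r : X × X → X × X} (h : IsSolution r) {W : Set X}
    (hW : ∀ x ∈ W, ∀ y ∈ W, (r (x, y)).1 ∈ W ∧ (r (x, y)).2 ∈ W) :
    IsSolution (restrictPair r hW) where
  inv p := by
    have := h.inv (p.1, p.2)
    exact Prod.ext (Subtype.ext (congrArg Prod.fst this)) (Subtype.ext (congrArg Prod.snd this))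
  sqfree x := by
    have := h.sqfree x
    exact Prod.ext (Subtype.ext (congrArg Prod.fst this)) (Subtype.ext (congrArg Prod.snd this))
  nondeg := by
    constructor
    · intro x
      apply Finite.injective_iff_bijective.1
      intro y y' hy
      exact Subtype.ext ((h.nondeg.1 x).1 (congrArg Subtype.val hy))
    · intro y
      apply Finite.injective_iff_bijective.1
      intro x x' hx
      exact Subtype.ext ((h.nondeg.2 y).1 (congrArg Subtype.val hx))
  braided := by
    funext t
    have := congrFun h.braided (t.1, t.2.1, t.2.2)
    exact Prod.ext (Subtype.ext (congrArg (fun t => t.1) this))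
      (Prod.ext (Subtype.ext (congrArg (fun t => t.2.1) this))
        (Subtype.ext (congrArg (fun t => t.2.2) this)))

/-- By Rump's theorem $X$ splits into two invariant parts, each ordered by induction, and one is
placed below the other. A mixed descent has its letters' parts exchanged by `r`, hence becomes an
ascent with a smaller head. -/
theorem exists_injective_lt {X : Type u} [Finite X] {r : X × X → X × X} (h : IsSolution r) :
    ∃ f : X → ℕ, Function.Injective f ∧
      ∀ x y, f x < f y → f (r (y, x)).1 < f (r (y, x)).2 ∧ f (r (y, x)).1 < f y := by
  classical
  induction hn : Nat.card X using Nat.strong_induction_on generalizing X with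
  | _ n ih =>
    subst hn
    by_cases hX : 2 ≤ Nat.card X
    swap
    · have : Subsingleton X := Finite.card_le_one_iff_subsingleton.1 (by omega)
      exact ⟨fun _ => 0, fun a b _ => Subsingleton.elim a b, fun _ _ h => absurd h (lt_irrefl _)⟩
    obtain ⟨Y, ⟨y₀, hy₀⟩, ⟨z₀, hz₀⟩, hY⟩ := h.exists_perm_invariant hX
    have hsub : ∀ W : Set X, (∀ x y, h.perm x y ∈ W ↔ y ∈ W) → (∃ x, x ∉ W) →
        ∃ f : X → ℕ, Set.InjOn f W ∧ ∀ x ∈ W, ∀ y ∈ W, f x < f y →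
          f (r (y, x)).1 < f (r (y, x)).2 ∧ f (r (y, x)).1 < f y := by
      rintro W hW ⟨x₀, hx₀⟩
      have hW' : ∀ x ∈ W, ∀ y ∈ W, (r (x, y)).1 ∈ W ∧ (r (x, y)).2 ∈ W := fun x hx y hy =>
        ⟨(h.apply_mem_iff_of_perm hW x y).1.2 hy, (h.apply_mem_iff_of_perm hW x y).2.2 hx⟩
      obtain ⟨f, hf, hf'⟩ := ih _ (Finite.card_subtype_lt hx₀) (h.restrictPair hW') rfl
      have hext : ∀ x (hx : x ∈ W), (if hx : x ∈ W then f ⟨x, hx⟩ else 0) = f ⟨x, hx⟩ :=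
        fun x hx => dif_pos hx
      refine ⟨fun x => if hx : x ∈ W then f ⟨x, hx⟩ else 0, ?_, ?_⟩
      · intro x hx y hy hxy
        simp only [hext x hx, hext y hy] at hxy
        exact congrArg Subtype.val (hf hxy)
      · intro x hx y hy hxy
        simp only [hext x hx, hext y hy, hext _ (hW' y hy x hx).1, hext _ (hW' y hy x hx).2]
          at hxy ⊢
        exact hf' ⟨x, hx⟩ ⟨y, hy⟩ hxy
    obtain ⟨f, hf, hf'⟩ := hsub Y hY ⟨z₀, hz₀⟩
    obtain ⟨g, hg, hg'⟩ := hsub Yᶜ (fun x y => not_congr (hY x y)) ⟨y₀, not_not.2 hy₀⟩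
    -- The values on the complement are shifted by `N + 1`, beyond all the values of `f`.
    obtain ⟨N, hN⟩ := (Set.finite_range f).bddAbove
    have hlt : ∀ x, f x < N + 1 := fun x => Nat.lt_succ_of_le (hN ⟨x, rfl⟩)
    have hpos : ∀ x ∈ Y, (if x ∈ Y then f x else N + 1 + g x) = f x := fun x hx => if_pos hx
    have hneg : ∀ x ∉ Y, (if x ∈ Y then f x else N + 1 + g x) = N + 1 + g x :=
      fun x hx => if_neg hx
    refine ⟨fun x => if x ∈ Y then f x else N + 1 + g x, ?_, ?_⟩
    · intro x y hxy
      have h1 := hlt x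
      have h2 := hlt y
      by_cases hx : x ∈ Y <;> by_cases hy : y ∈ Y <;> simp only [hx, hy, if_true, if_false] at hxy
      · exact hf hx hy hxy
      · omega
      · omega
      · exact hg hx hy (by omega)
    · intro x y hxy
      obtain ⟨h1, h2⟩ := h.apply_mem_iff_of_perm hY y x
      have hx' := hlt (r (y, x)).1
      have hy' := hlt y
      by_cases hx : x ∈ Y <;> by_cases hy : y ∈ Y <;> simp only [hx, hy, iff_true, iff_false] at h1 h2
      · simp only [hpos x hx, hpos y hy, hpos _ h1, hpos _ h2] at hxy ⊢
        exact hf' x hx y hy hxy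
      · simp only [hneg y hy, hpos _ h1, hneg _ h2]
        omega
      · simp only [hneg x hx, hpos y hy] at hxy
        omega
      · simp only [hneg x hx, hneg y hy, hneg _ h1, hneg _ h2] at hxy ⊢
        have := hg' x hx y hy (by omega)
        omega

theorem card_multisetAction_wordProd {X : Type*} {r : X × X → X × X} (h : IsSolution r)
    (w : List X) (p : Multiset X × Equiv.Perm X) :
    (h.multisetAction (wordProd r w) p).1.card = w.length + p.1.card := by
  induction w with
  | nil =>
    change (h.multisetAction 1 p).1.card = _
    rw [map_one, List.length_nil, zero_add]
    rfl
  | cons x w ih =>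
    have hw : wordProd r (x :: w) = AssocMonoid.gen r x * wordProd r w :=
      wordProd_append r [x] w
    rw [hw, map_mul]
    change (h.multisetAction (AssocMonoid.gen r x) (h.multisetAction (wordProd r w) p)).1.card = _
    rw [multisetAction_gen, Multiset.card_cons, ih, List.length_cons]
    omega

/-- Every element of $S$ has an ordered representative, since descents can be rewritten away. In
each length there are as many ordered words as multisets, and by the I-type bijection as many as
elements of $S$, so the representative is unique. -/
theorem isStraightening_of_lt {X : Type*} [LinearOrder X] [Finite X] {r : X × X → X × X}
    (h : IsSolution r) (hlt : ∀ i j, i < j → (r (j, i)).1 < (r (j, i)).2 ∧ (r (j, i)).1 < j) :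
    IsStraightening r := by
  refine ⟨hlt, ?_⟩
  let F : List X → Multiset X := fun w => (h.multisetAction (wordProd r w) (0, 1)).1
  have hF : ∀ w, (F w).card = w.length := fun w => by
    simpa using h.card_multisetAction_wordProd w (0, 1)
  have hsurj : ∀ a, ∃ w ∈ orderedWords X, F w = a := by
    intro a
    obtain ⟨u, hu⟩ := wordProd_surjective r (h.ofMultiset a)
    obtain ⟨w, hw, huw⟩ := exists_ordered_reflTransGen (R := descentRelations r)
      (fun ρ hρ => by rw [hρ.2]; exact (hlt _ _ hρ.1).2) (fun i j hij => ⟨r (j, i), hij, rfl⟩) u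
    refine ⟨w, hw, ?_⟩
    simp only [F]
    rw [← wordProd_eq_of_descent_reflTransGen huw, hu, multisetAction_ofMultiset]
  have hperm : ∀ w ∈ orderedWords X, ∀ w' ∈ orderedWords X, (w : Multiset X) = w' → w = w' :=
    fun w hw w' hw' hww => (Multiset.coe_eq_coe.1 hww).eq_of_pairwise' hw hw'
  have hsort : ∀ a : Multiset X, a.sort (· ≤ ·) ∈ orderedWords X := fun a => a.pairwise_sort _
  intro w hw w' hw' hww
  have hlen := length_eq_of_wordProd_eq hww
  have := Fintype.ofFinite X
  -- A multiset is sorted into a word and then read off through the I-type bijection. This self-map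
  -- of a finite set is surjective, hence injective.
  let G : Sym X w.length → Sym X w.length := fun a =>
    ⟨F ((a : Multiset X).sort (· ≤ ·)), by rw [hF, Multiset.length_sort]; exact a.2⟩
  have hG : Function.Surjective G := by
    rintro ⟨a, ha⟩
    obtain ⟨u, hu, rfl⟩ := hsurj a
    refine ⟨⟨u, by rw [← ha, hF, Multiset.coe_card]⟩, Subtype.ext ?_⟩
    exact congrArg F (hperm _ (hsort _) _ hu (Multiset.sort_eq _ _))
  have hGw : ∀ u ∈ orderedWords X, F ((u : Multiset X).sort (· ≤ ·)) = F u := fun u hu =>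
    congrArg F (hperm _ (hsort _) _ hu (Multiset.sort_eq _ _))
  have h1 := (Finite.injective_iff_surjective.2 hG) (a₁ := ⟨w, Multiset.coe_card w⟩)
    (a₂ := ⟨w', by rw [Multiset.coe_card, hlen]⟩) (Subtype.ext (by
      change F ((w : Multiset X).sort (· ≤ ·)) = F ((w' : Multiset X).sort (· ≤ ·))
      rw [hGw w hw, hGw w' hw']
      simp only [F, hww]))
  exact hperm w hw w' hw' (congrArg Subtype.val h1)

theorem exists_isStraightening {X : Type u} [Finite X] {r : X × X → X × X} (h : IsSolution r) :
    ∃ _ : LinearOrder X, IsStraightening r := by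
  obtain ⟨f, hf, hlt⟩ := h.exists_injective_lt
  let _ : LinearOrder X := LinearOrder.lift' f hf
  exact ⟨inferInstance, h.isStraightening_of_lt hlt⟩

end IsSolution

end SetTheoreticYBE

/-! ### The equivalences and the decomposition -/

theorem mainTheorem1 {X : Type u} [Finite X] [Nonempty X] (r : X × X → X × X)
    (hbij : Function.Bijective r) (hinv : Function.Involutive r)
    (hsf : SetTheoreticYBE.IsSquareFree r) :
    List.TFAE
      [ SetTheoreticYBE.IsNondegenerate r ∧ SetTheoreticYBE.IsBraided r,
        SetTheoreticYBE.IsOfIType (SetTheoreticYBE.AssocMonoid.gen r),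
        ∃ _ : LinearOrder X,
          SetTheoreticYBE.IsOfSkewPolynomialType (SetTheoreticYBE.AssocMonoid.gen r),
        ∃ _ : LinearOrder X, ∀ (k : Type v) [Field k],
          SetTheoreticYBE.IsPBWBasis k (SetTheoreticYBE.AssocAlgebra.gen k r)
            (SetTheoreticYBE.orderedWords X) ] ∧
    (2 ≤ Nat.card X →
      (SetTheoreticYBE.IsNondegenerate r ∧ SetTheoreticYBE.IsBraided r →
        SetTheoreticYBE.IsDecomposable r) ∧
      (SetTheoreticYBE.IsOfIType (SetTheoreticYBE.AssocMonoid.gen r) →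
        SetTheoreticYBE.IsDecomposable r) ∧
      ((∃ _ : LinearOrder X,
          SetTheoreticYBE.IsOfSkewPolynomialType (SetTheoreticYBE.AssocMonoid.gen r)) →
        SetTheoreticYBE.IsDecomposable r) ∧
      ((∃ _ : LinearOrder X, ∀ (k : Type v) [Field k],
          SetTheoreticYBE.IsPBWBasis k (SetTheoreticYBE.AssocAlgebra.gen k r)
            (SetTheoreticYBE.orderedWords X)) →
        SetTheoreticYBE.IsDecomposable r)) := by
  open SetTheoreticYBE in
  have hsol : IsNondegenerate r ∧ IsBraided r → IsSolution r := fun h => ⟨hinv, hsf, h.1, h.2⟩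
  have h12 : IsNondegenerate r ∧ IsBraided r → IsOfIType (AssocMonoid.gen r) := fun h =>
    (hsol h).isOfIType
  have h21 : IsOfIType (AssocMonoid.gen r) → IsNondegenerate r ∧ IsBraided r := fun h =>
    h.isNondegenerate_and_isBraided hinv hsf
  have h13 : IsNondegenerate r ∧ IsBraided r →
      ∃ _ : LinearOrder X, IsOfSkewPolynomialType (AssocMonoid.gen r) := fun h => by
    obtain ⟨hX, hr⟩ := (hsol h).exists_isStraightening
    exact ⟨hX, hr.isOfSkewPolynomialType hinv⟩
  have h34 : (∃ _ : LinearOrder X, IsOfSkewPolynomialType (AssocMonoid.gen r)) →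
      ∃ _ : LinearOrder X, ∀ (k : Type v) [Field k],
        IsPBWBasis k (AssocAlgebra.gen k r) (orderedWords X) := by
    rintro ⟨hX, hr⟩
    exact ⟨hX, fun k _ => (IsStraightening.of_isOfSkewPolynomialType hinv hr).isPBWBasis k⟩
  have h41 : (∃ _ : LinearOrder X, ∀ (k : Type v) [Field k],
      IsPBWBasis k (AssocAlgebra.gen k r) (orderedWords X)) →
      IsNondegenerate r ∧ IsBraided r := by
    rintro ⟨hX, hr⟩
    -- A single field suffices; $\mathbb Q$ is lifted to the universe over which the fields range.
    exact (IsStraightening.of_isPBWBasis hinv hsf (ULift.{v} ℚ)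
      (hr _)).isNondegenerate_and_isBraided hinv hsf
  refine ⟨?_, fun hX => ?_⟩
  · tfae_have 1 → 2 := h12
    tfae_have 2 → 1 := h21
    tfae_have 1 → 3 := h13
    tfae_have 3 → 4 := h34
    tfae_have 4 → 1 := h41
    tfae_finish
  · have hdec : IsNondegenerate r ∧ IsBraided r → IsDecomposable r := fun h =>
      (hsol h).isDecomposable hX
    exact ⟨hdec, hdec ∘ h21, hdec ∘ h41 ∘ h34, hdec ∘ h41⟩
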